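/- Let $\mathbf{k}$ be a field of characteristic $0$. Let $\mathcal{A}$ be a (non-unital) differential graded cyclic operad over $\mathbf{k}$, that is, a sequence of ($\mathbb{Z}$-graded, homological) chain complexes $\mathcal{A}((n+1))=\mathcal{A}(n)$, $n\ge 0$, with actions of $\mathbb{S}_{n+1}=\mathrm{Aut}\{0,\dots,n\}$ and partial compositions $\circ_i:\mathcal{A}(m)\otimes\mathcal{A}(n)\to\mathcal{A}(m+n-1)$, $1\le i\le m$, which are maps of chain complexes satisfying the equivariance and (with Koszul signs) the two associativity axioms, and $(a\circ_m b)^*=(-1)^{|a||b|}\,b^*\circ_1a^*$, where $a^*$ is the result of applying the cycle $(0\,1\dots n)$ to $a \in \mathcal{A}(n)$. Suppose that $\mathcal{A}((n))=0$ for $n\le 2$ and that each $\mathcal{A}((n))$ is finite-dimensional. Let $\mathsf{B}\mathcal{A}$ be the cobar operad of $\mathcal{A}$. Up to differential, it is the cyclic operad $\mathbb{T}\,\mathfrak{s}^{-1}\Sigma^{-1}\mathcal{A}^*$; only its underlying graded cyclic $\mathbb{S}$-module enters here. Here $\mathcal{A}^*$ is the linear dual, $\mathcal{A}^*((n))_i=(\mathcal{A}((n))_{-i})^*$;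 $(\Sigma^{-1}\mathcal{V})((n))_i=\mathcal{V}((n))_{i+1}$; $(\mathfrak{s}^{-1}\mathcal{V})((n))=\Sigma^{n-2}\,\mathrm{sgn}_n\otimes\mathcal{V}((n))$; and $(\mathbb{T}\mathcal{V})((n))=\bigoplus_T\bigotimes_{v}\mathcal{V}((\mathrm{Leg}(v)))$, where $T$ runs over the isomorphism classes of trees with legs labelled by $n$ labels all of whose vertices have valence at least three, $v$ runs over the vertices of $T$, $\mathrm{Leg}(v)$ is the set of flags at $v$, and the tensor product is that of graded vector spaces, with Koszul signs. For a graded cyclic $\mathbb{S}$-module $\mathcal{V}$ with finite-dimensional components, let $$\mathrm{Ch}(\mathcal{V})=\sum_{n\ge1}\frac1{n!}\sum_{\sigma\in\mathbb{S}_n}\sum_i(-1)^i\,\mathrm{Tr}_{\mathcal{V}((n))_i}(\sigma)\,\psi(\sigma),\qquad \psi(\sigma)=p_{a_1}\cdots p_{a_\ell},$$ where $a_1,\dots,a_\ell$ are the cycle lengths of $\sigma$. It is an element of the completed ring of symmetric functions $\mathbf{k}[[p_1,p_2,\dots]]$ in the power sums $p_n$. Let $h_2=\tfrac12(p_1^2+p_2)$,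 let $\tilde\omega$ be the continuous ring involution with $\tilde\omega(p_n)=-p_n$, and let $\circ$ be plethysm: $f\circ g$ is obtained from $f$ by substituting $g(p_n,p_{2n},p_{3n},\dots)$ for each $p_n$. Let $\Lambda_*$ be the set of those $f$ for which $f(x,0,0,\dots)=\sum_{n\ge2}a_nx^n/n!$ with $a_2\ne0$. The Legendre transform $g=\mathcal{L}f$ of $f\in\Lambda_*$ is the unique $g\in\Lambda_*$ with $$g\circ\frac{\partial f}{\partial p_1}+f=p_1\frac{\partial f}{\partial p_1}.$$ Then the components of $\mathsf{B}\mathcal{A}$ are finite-dimensional, $\tilde\omega(h_2+\mathrm{Ch}(\mathcal{A}))$ and $h_2+\mathrm{Ch}(\mathsf{B}\mathcal{A})$ belong to $\Lambda_*$, and $$h_2+\mathrm{Ch}(\mathsf{B}\mathcal{A})=\mathcal{L}\,\tilde\omega\bigl(h_2+\mathrm{Ch}(\mathcal{A})\bigr).$$ -/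

import Mathlib

open scoped DirectSum TensorProduct

universe u v

noncomputable section

/-! ### Symmetric functions in the power sum presentation -/

/-- The completed ring of symmetric functions with coefficients in `k`, presented as the ring
`k⟦p₁, p₂, …⟧` of formal power series in the power sums. -/
abbrev SymFun (k : Type u) [Field k] : Type u := MvPowerSeries ℕ+ k

namespace SymFun

variable {k : Type u} [Field k]

/-- The power sum `p_n`. -/
def p (n : ℕ+) : SymFun k := MvPowerSeries.X n

/-- The complete symmetric function `h₂ = (p₁² + p₂) / 2`. -/
def h₂ : SymFun k := MvPowerSeries.C (2⁻¹ : k) * (p 1 ^ 2 + p 2)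

/-- The derivation `∂/∂p₁`. -/
def dp₁ (f : SymFun k) : SymFun k := MvPowerSeries.pderiv k (1 : ℕ+) f

/-- `p_n ∘ f = f(p_n, p_{2n}, p_{3n}, …)`. -/
def adams (n : ℕ+) (f : SymFun k) : SymFun k :=
  MvPowerSeries.subst (fun m : ℕ+ => (p (n * m) : SymFun k)) f

/-- Plethysm `f ∘ g`: substitute `p_n ∘ g` for `p_n` in `f`
(for `g` without constant term, so that the substitution makes sense). -/
def plethysm (f g : SymFun k) : SymFun k :=
  MvPowerSeries.subst (fun n : ℕ+ => adams n g) f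

/-- The involution `ω̃`, the continuous ring homomorphism with `ω̃(p_n) = -p_n`. -/
def omegaTilde (f : SymFun k) : SymFun k :=
  MvPowerSeries.rescale (fun _ : ℕ+ => (-1 : k)) f

/-- The rank homomorphism `rk`, which sends `p₁` to `x` and `p_n` to `0` for `n > 1`. -/
def rk (f : SymFun k) : PowerSeries k :=
  PowerSeries.mk fun n => MvPowerSeries.coeff (Finsupp.single (1 : ℕ+) n) f

/-- `f` belongs to `Λ_*`: the series `rk f` has the form `∑_{n ≥ 2} aₙ xⁿ / n!` with `a₂ ≠ 0`. -/
def IsStar (f : SymFun k) : Prop :=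
  PowerSeries.coeff 0 (rk f) = 0 ∧ PowerSeries.coeff 1 (rk f) = 0 ∧
    PowerSeries.coeff 2 (rk f) ≠ 0

/-- The equation `g ∘ ∂f/∂p₁ + f = p₁ ∂f/∂p₁` which defines the Legendre transform. -/
def LegendreEq (f g : SymFun k) : Prop :=
  plethysm g (dp₁ f) + f = p 1 * dp₁ f

open Classical in
/-- The Legendre transform `𝓛 f` of `f ∈ Λ_*`: the unique `g ∈ Λ_*` such that
`g ∘ ∂f/∂p₁ + f = p₁ ∂f/∂p₁`. (It is `0`, not an element of `Λ_*`, if there is no such `g`.) -/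
def legendre (f : SymFun k) : SymFun k :=
  if h : ∃! g : SymFun k, IsStar g ∧ LegendreEq f g then h.choose else 0

end SymFun

/-! ### Graded cyclic `𝕊`-modules and their characteristics -/

/-- A graded cyclic `𝕊`-module `V`: for each `n` a `ℤ`-graded vector space `V(n) = V((n+1))`, with
homogeneous components `X n i`, on which `Aut{0, 1, …, n}` acts. -/
structure CyclicSMod (k : Type u) [Field k] where
  X : ℕ → ℤ → Type v
  [addCommGroup : ∀ n i, AddCommGroup (X n i)]
  [module : ∀ n i, Module k (X n i)]
  ρ : ∀ n i, Representation k (Equiv.Perm (Fin (n + 1))) (X n i)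

attribute [instance] CyclicSMod.addCommGroup CyclicSMod.module

/-- The cycle index `ψ(σ) = p_{a₁} ⋯ p_{aₗ}`, where `a₁, …, aₗ` are the lengths of the cycles
of `σ` (fixed points included). -/
def cycleIndex (k : Type u) [Field k] {N : ℕ} (σ : Equiv.Perm (Fin N)) : SymFun k :=
  (σ.partition.parts.map fun a => (SymFun.p a.toPNat' : SymFun k)).prod

/-- The characteristic `ch_N(W) = (1/N!) ∑_σ Tr_W(σ) ψ(σ)` of a representation of `𝕊_N`. -/
def chRep {k : Type u} [Field k] {N : ℕ} {W : Type v} [AddCommGroup W] [Module k W]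
    (ρ : Representation k (Equiv.Perm (Fin N)) W) : SymFun k :=
  MvPowerSeries.C ((N.factorial : k)⁻¹) *
    ∑ σ : Equiv.Perm (Fin N), MvPowerSeries.C (LinearMap.trace k W (ρ σ)) * cycleIndex k σ

namespace CyclicSMod

variable {k : Type u} [Field k]

/-- `V(n)` has finite total dimension for each `n`. -/
def FiniteDim (V : CyclicSMod.{u, v} k) : Prop :=
  ∀ n, Module.Finite k (⨁ i, V.X n i)

/-- `V((n)) = 0` for `n ≤ 2`, that is, `V(0) = V(1) = 0`. -/
def VanishesLETwo (V : CyclicSMod.{u, v} k) : Prop :=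
  ∀ n ≤ 1, ∀ i, Subsingleton (V.X n i)

/-- The characteristic `∑ᵢ (-1)ⁱ ch_{n+1}(V(n)ᵢ)` of the component `V(n) = V((n+1))`. -/
def chComponent (V : CyclicSMod.{u, v} k) (n : ℕ) : SymFun k :=
  ∑ᶠ i : ℤ, (i.negOnePow : ℤ) • chRep (V.ρ n i)

/-- The characteristic `Ch(V) = ∑_{n ≥ 1} ch_n(V((n)))`. The sum is taken coefficientwise; it is
locally finite since `ch_n` is homogeneous of weight `n`, where `p_i` has weight `i`. -/
def Ch (V : CyclicSMod.{u, v} k) : SymFun k :=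
  fun d => ∑ᶠ n : ℕ, MvPowerSeries.coeff d (V.chComponent n)

/-- The linear dual, `(V*)(n)ᵢ = (V(n)₋ᵢ)*` with the contragredient action. -/
def dual (V : CyclicSMod.{u, v} k) : CyclicSMod.{u, max u v} k where
  X n i := Module.Dual k (V.X n (-i))
  ρ n i := (V.ρ n (-i)).dual

/-- The iterated suspension `Σʲ`, `(Σʲ V)(n)ᵢ = V(n)_{i-j}`. -/
def susp (j : ℤ) (V : CyclicSMod.{u, v} k) : CyclicSMod.{u, v} k where
  X n i := V.X n (i - j)
  ρ n i := V.ρ n (i - j)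

/-- A representation of `𝕊_N` tensored with the alternating character. -/
def signTwist {N : ℕ} {W : Type v} [AddCommGroup W] [Module k W]
    (ρ : Representation k (Equiv.Perm (Fin N)) W) :
    Representation k (Equiv.Perm (Fin N)) W where
  toFun σ := ((Equiv.Perm.sign σ : ℤ) : k) • ρ σ
  map_one' := by simp
  map_mul' σ τ := by
    ext x
    simp [smul_smul, mul_comm]

/-- The inverse `𝔰⁻¹` of the operadic suspension `(𝔰 V)((n)) = Σ^{2-n} sgn_n ⊗ V((n))`:
`(𝔰⁻¹ V)(n) = (𝔰⁻¹ V)((n+1)) = Σ^{n-1} sgn_{n+1} ⊗ V(n)`. -/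
def desusp (V : CyclicSMod.{u, v} k) : CyclicSMod.{u, v} k where
  X n i := V.X n (i - ((n : ℤ) - 1))
  ρ n i := signTwist (V.ρ n (i - ((n : ℤ) - 1)))

/-- The extension of `V` to finite sets: the degree `i` part of
`V((I)) = (⨁_{f : {0, …, n} ≃ I} V(n))_{𝕊_{n+1}}`, where `I` has `n + 1` elements. A coinvariant
class has exactly one representative `φ f` in the summand of each bijection `f`, and the classes
are given here by these compatible families; `n` is determined by the existence of `f`. -/
def onSet (V : CyclicSMod.{u, v} k) (I : Type) (i : ℤ) :
    Submodule k (∀ n : ℕ, (Fin (n + 1) ≃ I) → V.X n i) where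
  carrier := {φ | ∀ (n : ℕ) (g : Equiv.Perm (Fin (n + 1))) (f : Fin (n + 1) ≃ I),
    φ n (g.symm.trans f) = V.ρ n i g (φ n f)}
  add_mem' hφ hψ n g f := by simp [hφ n g f, hψ n g f]
  zero_mem' n g f := by simp
  smul_mem' c φ hφ n g f := by simp [hφ n g f]

/-- The action `V((I)) → V((J))` of a bijection `b : I ≃ J`. -/
def onSetMap (V : CyclicSMod.{u, v} k) {I J : Type} (b : I ≃ J) (i : ℤ) :
    V.onSet I i →ₗ[k] V.onSet J i where
  toFun φ := ⟨fun n f => φ.1 n (f.trans b.symm), fun n g f => φ.2 n g (f.trans b.symm)⟩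
  map_add' _ _ := rfl
  map_smul' _ _ := rfl

theorem onSetMap_trans (V : CyclicSMod.{u, v} k) {I J K : Type} (b : I ≃ J) (c : J ≃ K) (i : ℤ) :
    V.onSetMap (b.trans c) i = V.onSetMap c i ∘ₗ V.onSetMap b i := rfl

theorem onSetMap_refl (V : CyclicSMod.{u, v} k) (I : Type) (i : ℤ) :
    V.onSetMap (Equiv.refl I) i = LinearMap.id := rfl

end CyclicSMod

/-! ### Trees -/

/-- The flags at the vertex `x` of a tree with legs: the ends at `x` of the edges which contain
`x`, and the legs attached to `x`. -/
abbrev FlagsAt {n m : ℕ} (G : SimpleGraph (Fin m)) (leg : Fin (n + 1) → Fin m) (x : Fin m) :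
    Type :=
  {y : Fin m // G.Adj x y} ⊕ {j : Fin (n + 1) // leg j = x}

/-- A stable tree with vertex set `Fin m` and legs labelled by `{0, …, n}`: a tree, together with
the attachment of the legs to the vertices, each vertex having valence at least three. -/
structure LegTree (n m : ℕ) where
  graph : SimpleGraph (Fin m)
  isTree : graph.IsTree
  leg : Fin (n + 1) → Fin m
  stable : ∀ x, 3 ≤ Nat.card (FlagsAt graph leg x)

namespace LegTree

variable {n m : ℕ}

/-- The set of flags at the vertex `x`. -/
abbrev Flags (t : LegTree n m) (x : Fin m) : Type := FlagsAt t.graph t.leg x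

/-- The pair `(τ, σ)` is an isomorphism from the tree `t` to the tree `t'`: `τ` is an isomorphism
of the underlying trees which carries the leg `j` of `t` to the leg `σ j` of `t'`. -/
structure IsIso (τ : Equiv.Perm (Fin m)) (σ : Equiv.Perm (Fin (n + 1))) (t t' : LegTree n m) :
    Prop where
  adj : ∀ x y, t'.graph.Adj (τ x) (τ y) ↔ t.graph.Adj x y
  leg : ∀ j, t'.leg (σ j) = τ (t.leg j)

theorem IsIso.refl (t : LegTree n m) : IsIso (Equiv.refl _) (Equiv.refl _) t t :=
  ⟨fun _ _ => Iff.rfl, fun _ => rfl⟩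

theorem IsIso.trans {τ τ' : Equiv.Perm (Fin m)} {σ σ' : Equiv.Perm (Fin (n + 1))}
    {t t' t'' : LegTree n m} (h : IsIso τ σ t t') (h' : IsIso τ' σ' t' t'') :
    IsIso (τ.trans τ') (σ.trans σ') t t'' :=
  ⟨fun x y => (h'.adj _ _).trans (h.adj x y), fun j => by simp [h'.leg, h.leg]⟩

/-- The bijection on flags induced by an isomorphism of trees. -/
def IsIso.flags {τ : Equiv.Perm (Fin m)} {σ : Equiv.Perm (Fin (n + 1))} {t t' : LegTree n m}
    (h : IsIso τ σ t t') (x : Fin m) : t.Flags (τ.symm x) ≃ t'.Flags x :=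
  Equiv.sumCongr
    (Equiv.subtypeEquiv τ fun y => by simpa using (h.adj (τ.symm x) y).symm)
    (Equiv.subtypeEquiv σ fun j => by rw [h.leg, Equiv.eq_symm_apply])

/-- The tree `t` with the leg `σ j` renamed `j`. -/
def pull (σ : Equiv.Perm (Fin (n + 1))) (t : LegTree n m) : LegTree n m where
  graph := t.graph
  isTree := t.isTree
  leg := t.leg ∘ σ
  stable x := by
    refine (t.stable x).trans_eq (Nat.card_congr (Equiv.sumCongr (Equiv.refl _) ?_))
    exact (Equiv.subtypeEquiv σ fun j => by simp).symm

theorem pull_isIso (σ : Equiv.Perm (Fin (n + 1))) (t : LegTree n m) :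
    IsIso (Equiv.refl _) σ (t.pull σ) t :=
  ⟨fun _ _ => Iff.rfl, fun _ => rfl⟩

end LegTree

/-! ### The free cyclic operad `𝕋V` as a graded cyclic `𝕊`-module -/

/-- The Koszul sign of a permutation `τ` of `m` homogeneous factors of degrees `D 0, …, D (m-1)`:
each (unordered) pair of factors of odd degree whose order is reversed by `τ` contributes `-1`. -/
def koszulSign {m : ℕ} (D : Fin m → ℤ) (τ : Equiv.Perm (Fin m)) : ℤˣ :=
  ∏ z : Sym2 (Fin m), Sym2.lift
    ⟨fun x y => if Odd (D x) ∧ Odd (D y) ∧ ¬ (x < y ↔ τ x < τ y) then (-1 : ℤˣ) else 1, by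
      intro x y
      rcases eq_or_ne x y with rfl | hxy
      · rfl
      · have h1 : x < y ↔ ¬ y < x := by rw [not_lt]; exact ⟨le_of_lt, fun h => h.lt_of_ne hxy⟩
        have h2 : τ x < τ y ↔ ¬ τ y < τ x := by
          rw [not_lt]; exact ⟨le_of_lt, fun h => h.lt_of_ne (τ.injective.ne hxy)⟩
        have h3 : (x < y ↔ τ x < τ y) ↔ (y < x ↔ τ y < τ x) := by rw [h1, h2, not_iff_not]
        exact if_congr (by rw [h3]; tauto) rfl rfl⟩ z

theorem koszulSign_refl {m : ℕ} (D : Fin m → ℤ) : koszulSign D (Equiv.refl _) = 1 := by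
  refine Finset.prod_eq_one fun z _ => ?_
  induction z with | _ x y => simp

theorem koszulSign_trans {m : ℕ} (D : Fin m → ℤ) (τ τ' : Equiv.Perm (Fin m)) :
    koszulSign D (τ.trans τ') = koszulSign D τ * koszulSign (D ∘ τ.symm) τ' := by
  have hbij : Function.Bijective (Sym2.map τ) :=
    ⟨Sym2.map.injective τ.injective, fun z => ⟨Sym2.map τ.symm z, by simp [Sym2.map_map]⟩⟩
  have key : koszulSign (D ∘ τ.symm) τ' = _ := (Function.Bijective.prod_comp hbij _).symm
  rw [key]
  unfold koszulSign
  rw [← Finset.prod_mul_distrib]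
  refine Finset.prod_congr rfl fun z _ => ?_
  induction z with | _ x y =>
  simp only [Sym2.lift_mk, Sym2.map_mk, Equiv.trans_apply, Function.comp_apply,
    Equiv.symm_apply_apply]
  by_cases hx : Odd (D x) <;> by_cases hy : Odd (D y) <;> by_cases h1 : x < y <;>
    by_cases h2 : τ x < τ y <;> by_cases h3 : τ' (τ x) < τ' (τ y) <;> simp [hx, hy, h1, h2, h3]

namespace CyclicSMod

variable {k : Type u} [Field k]

/-- The degree `i` part of the graded tensor product `V((t)) = ⨂_x V((Flags x))` over the vertices
`x` of the tree `t`: the sum over all ways of distributing the degree over the vertices. -/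
abbrev onTree (V : CyclicSMod.{u, v} k) {n m : ℕ} (t : LegTree n m) (i : ℤ) : Type (max u v) :=
  ⨁ D : {D : Fin m → ℤ // ∑ x, D x = i}, ⨂[k] x, V.onSet (t.Flags x) (D.1 x)

/-- The map `V((t)) → V((t'))` on the summand of a degree distribution `D`, induced by an
isomorphism of trees: it permutes the tensor factors, with the Koszul sign. -/
def onTreeMapAux (V : CyclicSMod.{u, v} k) {n m : ℕ} {τ : Equiv.Perm (Fin m)}
    {σ : Equiv.Perm (Fin (n + 1))} {t t' : LegTree n m} (h : LegTree.IsIso τ σ t t')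
    (D : Fin m → ℤ) :
    (⨂[k] x, V.onSet (t.Flags x) (D x)) →ₗ[k]
      ⨂[k] x, V.onSet (t'.Flags x) (D (τ.symm x)) :=
  ((koszulSign D τ : ℤ) : k) •
    (PiTensorProduct.map (fun x => V.onSetMap (h.flags x) (D (τ.symm x))) ∘ₗ
      (PiTensorProduct.reindex k (fun x => V.onSet (t.Flags x) (D x)) τ).toLinearMap)

/-- The map `V((t)) → V((t'))` induced by an isomorphism of trees. -/
def onTreeMap (V : CyclicSMod.{u, v} k) {n m : ℕ} {τ : Equiv.Perm (Fin m)}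
    {σ : Equiv.Perm (Fin (n + 1))} {t t' : LegTree n m} (h : LegTree.IsIso τ σ t t') (i : ℤ) :
    V.onTree t i →ₗ[k] V.onTree t' i :=
  DirectSum.toModule k _ _ fun D =>
    DirectSum.lof k {D : Fin m → ℤ // ∑ x, D x = i}
        (fun D => ⨂[k] x, V.onSet (t'.Flags x) (D.1 x))
        ⟨D.1 ∘ τ.symm, (Equiv.sum_comp τ.symm D.1).trans D.2⟩ ∘ₗ
      V.onTreeMapAux h D.1

theorem onTreeMapAux_tprod (V : CyclicSMod.{u, v} k) {n m : ℕ} {τ : Equiv.Perm (Fin m)}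
    {σ : Equiv.Perm (Fin (n + 1))} {t t' : LegTree n m} (h : LegTree.IsIso τ σ t t')
    (D : Fin m → ℤ) (a : ∀ x, V.onSet (t.Flags x) (D x)) :
    V.onTreeMapAux h D (PiTensorProduct.tprod k a) =
      ((koszulSign D τ : ℤ) : k) • PiTensorProduct.tprod k
        (fun x => V.onSetMap (h.flags x) (D (τ.symm x)) (a (τ.symm x))) := by
  simp only [onTreeMapAux, LinearMap.smul_apply, LinearMap.comp_apply, LinearEquiv.coe_coe,
    PiTensorProduct.reindex_tprod, PiTensorProduct.map_tprod]

theorem onTreeMap_refl (V : CyclicSMod.{u, v} k) {n m : ℕ} (t : LegTree n m) (i : ℤ) :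
    V.onTreeMap (LegTree.IsIso.refl t) i = LinearMap.id := by
  refine DirectSum.linearMap_ext k fun D => PiTensorProduct.ext (MultilinearMap.ext fun a => ?_)
  simp only [LinearMap.compMultilinearMap_apply, LinearMap.comp_apply, onTreeMap,
    DirectSum.toModule_lof, onTreeMapAux_tprod, koszulSign_refl, LinearMap.id_apply]
  simp only [Units.val_one, Int.cast_one, one_smul]
  have hfl : ∀ x, (LegTree.IsIso.refl t).flags x = Equiv.refl (t.Flags x) := fun x => by
    ext y
    rcases y with y | y <;> rfl
  simp only [hfl]
  rfl

theorem onTreeMap_trans (V : CyclicSMod.{u, v} k) {n m : ℕ} {τ τ' : Equiv.Perm (Fin m)}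
    {σ σ' : Equiv.Perm (Fin (n + 1))} {t t' t'' : LegTree n m}
    (h : LegTree.IsIso τ σ t t') (h' : LegTree.IsIso τ' σ' t' t'') (i : ℤ) :
    V.onTreeMap (h.trans h') i = V.onTreeMap h' i ∘ₗ V.onTreeMap h i := by
  refine DirectSum.linearMap_ext k fun D => PiTensorProduct.ext (MultilinearMap.ext fun a => ?_)
  simp only [LinearMap.compMultilinearMap_apply, LinearMap.comp_apply, onTreeMap,
    DirectSum.toModule_lof, onTreeMapAux_tprod, map_smul, smul_smul]
  rw [koszulSign_trans]
  simp only [Units.val_mul, Int.cast_mul]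
  have hfl : ∀ x, (h.trans h').flags x = (h.flags (τ'.symm x)).trans (h'.flags x) := fun x => by
    ext y
    rcases y with y | y <;> rfl
  simp only [hfl]
  rfl

/-- The degree `i` part of `(𝕋V)(n) = (𝕋V)((n+1))`, the sum of `V((t))` over the isomorphism
classes of stable trees `t` with legs labelled by `{0, …, n}`. Its elements are given by their
components in `V((t))` for all such trees `t` with vertex set `{0, …, m-1}` for some `m`; the
components in isomorphic trees correspond to each other. (There are finitely many such trees, and
they have no nontrivial automorphisms fixing the legs.) -/
def treeSpace (V : CyclicSMod.{u, v} k) (n : ℕ) (i : ℤ) :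
    Submodule k (∀ (m : ℕ) (t : LegTree n m), V.onTree t i) where
  carrier := {Φ | ∀ (m : ℕ) (τ : Equiv.Perm (Fin m)) (t t' : LegTree n m)
    (h : LegTree.IsIso τ (Equiv.refl _) t t'), Φ m t' = V.onTreeMap h i (Φ m t)}
  add_mem' ha hb m τ t t' h := by simp [ha m τ t t' h, hb m τ t t' h]
  zero_mem' m τ t t' h := by simp
  smul_mem' c Φ hΦ m τ t t' h := by simp [hΦ m τ t t' h]

theorem onTreeMap_pull_comm (V : CyclicSMod.{u, v} k) {n : ℕ} {i : ℤ} (σ : Equiv.Perm (Fin (n + 1)))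
    (Φ : V.treeSpace n i) :
    (fun m t => V.onTreeMap (t.pull_isIso σ) i (Φ.1 m (t.pull σ))) ∈ V.treeSpace n i := by
  intro m τ t t' h
  have h' : LegTree.IsIso τ (Equiv.refl _) (t.pull σ) (t'.pull σ) :=
    ⟨h.adj, fun j => h.leg (σ j)⟩
  have e := Φ.2 m τ _ _ h'
  change V.onTreeMap (t'.pull_isIso σ) i (Φ.1 m (t'.pull σ)) =
    V.onTreeMap h i (V.onTreeMap (t.pull_isIso σ) i (Φ.1 m (t.pull σ)))
  rw [e, ← LinearMap.comp_apply, ← LinearMap.comp_apply, ← onTreeMap_trans, ← onTreeMap_trans]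
  rfl

/-- A permutation `σ` acts on `(𝕋V)(n)` by relabelling the legs of trees: the component of `σ Φ`
in `V((t))` comes from the component of `Φ` in `V((t'))`, where `t'` is such that relabelling its
legs by `σ` gives `t`. -/
def treeRep (V : CyclicSMod.{u, v} k) (n : ℕ) (i : ℤ) :
    Representation k (Equiv.Perm (Fin (n + 1))) (V.treeSpace n i) where
  toFun σ :=
    { toFun := fun Φ => ⟨fun m t => V.onTreeMap (t.pull_isIso σ) i (Φ.1 m (t.pull σ)),
        V.onTreeMap_pull_comm σ Φ⟩
      map_add' := fun Φ Ψ => Subtype.ext <| funext fun m => funext fun t =>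
        map_add (V.onTreeMap (t.pull_isIso σ) i) (Φ.1 m (t.pull σ)) (Ψ.1 m (t.pull σ))
      map_smul' := fun c Φ => Subtype.ext <| funext fun m => funext fun t =>
        map_smul (V.onTreeMap (t.pull_isIso σ) i) c (Φ.1 m (t.pull σ)) }
  map_one' := LinearMap.ext fun Φ => Subtype.ext <| funext fun m => funext fun t =>
    congrArg (fun L => L (Φ.1 m t)) (V.onTreeMap_refl t i)
  map_mul' σ σ' := LinearMap.ext fun Φ => Subtype.ext <| funext fun m => funext fun t =>
    congrArg (fun L => L (Φ.1 m (t.pull (σ * σ'))))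
      (V.onTreeMap_trans ((t.pull σ).pull_isIso σ') (t.pull_isIso σ) i)

/-- The free cyclic operad `𝕋V`, as a graded cyclic `𝕊`-module. -/
def tree (V : CyclicSMod.{u, v} k) : CyclicSMod.{u, max u v} k where
  X n i := V.treeSpace n i
  addCommGroup _ _ := Module.addCommMonoidToAddCommGroup k
  module n i := inferInstanceAs (Module k (V.treeSpace n i))
  ρ n i := V.treeRep n i

end CyclicSMod

/-! ### Differential graded cyclic operads -/

/-- Grafting a corolla with slots `0, …, n` into the slot `i` of a corolla: the position, in the
result, of the slot `s ≠ i` of the outer corolla. -/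
def outerSlot (n i s : ℕ) : ℕ := if s < i then s else s + n - 1

/-- The position, in the result of grafting into the slot `i`, of the slot `t ≠ 0` of the inner
corolla. -/
def innerSlot (i t : ℕ) : ℕ := i + t - 1

/-- `κ` is the permutation `π ∘ᵢ ρ`, where `m + n = r + 1`, `1 ≤ i ≤ m`, and `π`, `ρ`, `κ` are
permutations of `{1, …, m}`, `{1, …, n}`, `{1, …, r}`, extended by `0 ↦ 0`: `κ` carries the slots
of the composition into the slot `i` to the corresponding slots of the composition into `π i`. -/
def IsCircPerm {m n r : ℕ} (i : ℕ) (π : Equiv.Perm (Fin (m + 1))) (ρ : Equiv.Perm (Fin (n + 1)))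
    (κ : Equiv.Perm (Fin (r + 1))) (i' : ℕ) : Prop :=
  (∀ (s : Fin (m + 1)) (x : Fin (r + 1)), (s : ℕ) ≠ i → (x : ℕ) = outerSlot n i s →
    (κ x : ℕ) = outerSlot n i' (π s)) ∧
  (∀ (t : Fin (n + 1)) (x : Fin (r + 1)), t ≠ 0 → (x : ℕ) = innerSlot i t →
    (κ x : ℕ) = innerSlot i' (ρ t))

/-- A (non-unital) differential graded cyclic operad over `k`. Compositions are only indexed by the
arities `m, n, r` with `m + n = r + 1` and the degrees `p, q, s` with `p + q = s`; the index
`i : Fin m` stands for the slot `i + 1 ∈ {1, …, m}`, so that `comp _ i` is the operation `∘_{i+1}`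
from `A(m)ₚ ⊗ A(n)_q` to `A(m+n-1)_{p+q}`. -/
structure DGCyclicOperad (k : Type u) [Field k] extends CyclicSMod.{u, v} k where
  /-- the differential of the chain complex `A(n)` -/
  d : ∀ (n : ℕ) {i j : ℤ}, j + 1 = i → (X n i →ₗ[k] X n j)
  d_comp_d : ∀ (n : ℕ) {i j l : ℤ} (h : j + 1 = i) (h' : l + 1 = j) (a : X n i),
    d n h' (d n h a) = 0
  d_equivariant : ∀ (n : ℕ) {i j : ℤ} (h : j + 1 = i) (g : Equiv.Perm (Fin (n + 1))) (a : X n i),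
    d n h (ρ n i g a) = ρ n j g (d n h a)
  /-- the partial compositions -/
  comp : ∀ {m n r : ℕ}, m + n = r + 1 → Fin m → ∀ {p q s : ℤ}, p + q = s →
    (X m p →ₗ[k] X n q →ₗ[k] X r s)
  /-- the partial compositions are maps of chain complexes -/
  d_leibniz : ∀ {m n r : ℕ} (h : m + n = r + 1) (i : Fin m) {p q s p' q' s' : ℤ} (hs : p + q = s)
    (hp' : p' + 1 = p) (hq' : q' + 1 = q) (hs' : s' + 1 = s) (a : X m p) (b : X n q),
    d r hs' (comp h i hs a b) =
      comp h i (by lia : p' + q = s') (d m hp' a) b +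
        (p.negOnePow : ℤ) • comp h i (by lia : p + q' = s') a (d n hq' b)
  /-- `(π a) ∘_{π(i)} (ρ b) = (π ∘ᵢ ρ) (a ∘ᵢ b)` -/
  comp_equivariant : ∀ {m n r : ℕ} (h : m + n = r + 1) (i i' : Fin m) {p q s : ℤ} (hs : p + q = s)
    (π : Equiv.Perm (Fin (m + 1))) (η : Equiv.Perm (Fin (n + 1))) (κ : Equiv.Perm (Fin (r + 1))),
    π 0 = 0 → η 0 = 0 → κ 0 = 0 → π i.succ = i'.succ → IsCircPerm (i + 1) π η κ (i' + 1) →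
    ∀ (a : X m p) (b : X n q),
      comp h i' hs (ρ m p π a) (ρ n q η b) = ρ r s κ (comp h i hs a b)
  /-- `(a ∘ᵢ b) ∘_{j+l-1} c = (a ∘ⱼ c) ∘ᵢ b` for `1 ≤ i < j ≤ m`, where `b ∈ A(l)`, up to the
  Koszul sign of the exchange of `b` and `c` -/
  comp_parallel : ∀ {m l l' r r' N : ℕ} (h₁ : m + l = r + 1) (h₂ : r + l' = N + 1)
    (h₃ : m + l' = r' + 1) (h₄ : r' + l = N + 1) (i j : Fin m) (j' : Fin r) (i' : Fin r'),
    i < j → (j' : ℕ) + 1 = j + l → (i' : ℕ) = i →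
    ∀ {p q t s s' w : ℤ} (e₁ : p + q = s) (e₂ : s + t = w) (e₃ : p + t = s') (e₄ : s' + q = w)
      (a : X m p) (b : X l q) (c : X l' t),
      comp h₂ j' e₂ (comp h₁ i e₁ a b) c =
        ((q * t).negOnePow : ℤ) • comp h₄ i' e₄ (comp h₃ j e₃ a c) b
  /-- `(a ∘ᵢ b) ∘_{i+j-1} c = a ∘ᵢ (b ∘ⱼ c)` -/
  comp_assoc : ∀ {m l l' r r' N : ℕ} (h₁ : m + l = r + 1) (h₂ : r + l' = N + 1)
    (h₃ : l + l' = r' + 1) (h₄ : m + r' = N + 1) (i : Fin m) (j : Fin l) (j' : Fin r),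
    (j' : ℕ) = i + j →
    ∀ {p q t s s' w : ℤ} (e₁ : p + q = s) (e₂ : s + t = w) (e₃ : q + t = s') (e₄ : p + s' = w)
      (a : X m p) (b : X l q) (c : X l' t),
      comp h₂ j' e₂ (comp h₁ i e₁ a b) c = comp h₄ i e₄ a (comp h₃ j e₃ b c)
  /-- `(a ∘ₘ b)* = b* ∘₁ a*`, up to the Koszul sign, where `*` is the action of the cycle
  `(0 1 … n)` -/
  comp_cyclic : ∀ {m n r : ℕ} (h : m + n = r + 1) (h' : n + m = r + 1) (i : Fin m) (j : Fin n),
    (i : ℕ) + 1 = m → (j : ℕ) = 0 →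
    ∀ {p q s : ℤ} (hs : p + q = s) (hs' : q + p = s) (a : X m p) (b : X n q),
      ρ r s (finRotate (r + 1)) (comp h i hs a b) =
        ((p * q).negOnePow : ℤ) •
          comp h' j hs' (ρ n q (finRotate (n + 1)) b) (ρ m p (finRotate (m + 1)) a)

/-- The cobar operad `𝖡A = 𝕋 𝔰⁻¹ Σ⁻¹ A*` of a cyclic operad `A`, as a graded cyclic `𝕊`-module,
that is, up to its differential. Characteristics only see this structure. -/
def DGCyclicOperad.cobar {k : Type u} [Field k] (A : DGCyclicOperad.{u, v} k) :
    CyclicSMod.{u, max u v} k :=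
  ((A.toCyclicSMod.dual.susp (-1)).desusp).tree

end

/-! Write V for the generators 𝔰⁻¹Σ⁻¹A* (`cogen`), v for Ch(V), v' for ∂v/∂p₁, T for Ch(𝕋V), and ψ₂
for p₂ ∘ -. The contragredient has the traces of the inverse permutation, and the degree shifts
together with the sign character contribute -(-1)^(number of cycles). Hence v = -ω̃ Ch(A)
(`Ch_cogen`), so that f = ω̃(h₂ + Ch(A)) equals ½(p₁² - p₂) - v and ∂f/∂p₁ = p₁ - v'. After
expanding h₂ ∘ (p₁ - v'), the Legendre equation for h₂ + T becomes an identity about free cyclic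
operads alone, `plethysm_Ch_tree`: T ∘ (p₁ - v') = v + ½(ψ₂v' - v'²).

Both sides are compared as class functions: `ev f` takes at a permutation the value which f has
under the characteristic map. In these terms a plethysm f ∘ g at σ is an average over ρ ∈ 𝕊_n of
f(ρ) times a sum over equivariant maps q : (E, σ) → (Fin n, ρ), each weighted by the values of g at
the first return permutations of the fibres of q (`ev_plethysm`). The trace of σ on 𝕋V is an average
over vertex-labelled trees with an automorphism (τ, σ), so no isomorphism classes have to be chosen
(`trace_sections`). On V((t)) the Koszul signs combine with the parities so that the supertrace is a
product over the vertex orbits of supertraces of first return maps (`negOnePow_mul_koszulSign`,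
`finsum_trace_onTreeMap`). Together these express T(σ) as `treeSum`.

The value of T ∘ (p₁ - v') at σ is therefore a sum over trees with legs N and equivariant
surjections q : E → N. A leg with one preimage has the factor 1 coming from p₁. A leg x with several
preimages has a factor -v', which is minus the weight of a corolla whose flags are the points of
q⁻¹(x) and one edge end. Grafting all these corollas gives a stable tree with legs E and a marked
set of leaves, of sign (-1)^(number of marked orbits), and pruning the marked leaves recovers the
original data (`sum_graftSource`).

For a fixed tree with legs E one is left with the alternating sum over the admissible sets of marked
orbits. With at least three vertices these are all subsets of the nonempty set of leaf orbits, and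
the sum is 0. With one vertex only the empty set is admissible, which gives v. With two vertices
every proper subset is admissible, and summing over the two vertex permutations gives ½(ψ₂v' - v'²)
(`sum_graftTarget`).

Uniqueness of the Legendre transform holds because plethysm with a series p₁ + ⋯ is injective
(`plethysm_injective`). -/

noncomputable section


/-! ### Orbits of permutations -/

/-- The set of orbits of a permutation. -/
def Orb {α : Type*} (τ : Equiv.Perm α) : Type _ := Quotient (Equiv.Perm.SameCycle.setoid τ)

namespace Orb

variable {α β γ δ : Type*}

/-- The orbit of a point. -/
def mk (τ : Equiv.Perm α) (x : α) : Orb τ := Quotient.mk _ x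

instance [Finite α] (τ : Equiv.Perm α) : Finite (Orb τ) :=
  inferInstanceAs (Finite (Quotient _))

instance [Finite α] (τ : Equiv.Perm α) : Fintype (Orb τ) := Fintype.ofFinite _

instance (τ : Equiv.Perm α) : DecidableEq (Orb τ) := Classical.decEq _

/-- A representative of an orbit. -/
def out {τ : Equiv.Perm α} (O : Orb τ) : α := Quotient.out O

@[simp] theorem mk_out {τ : Equiv.Perm α} (O : Orb τ) : mk τ O.out = O := Quotient.out_eq O

theorem mk_surjective (τ : Equiv.Perm α) : Function.Surjective (mk τ) := fun O => ⟨O.out, O.mk_out⟩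

theorem mk_eq {τ : Equiv.Perm α} {x y : α} : mk τ x = mk τ y ↔ τ.SameCycle x y := Quotient.eq

@[simp] theorem mk_apply (τ : Equiv.Perm α) (x : α) : mk τ (τ x) = mk τ x :=
  mk_eq.2 (by simp [Equiv.Perm.SameCycle.refl])

@[simp] theorem mk_pow_apply (τ : Equiv.Perm α) (j : ℕ) (x : α) : mk τ ((τ ^ j) x) = mk τ x :=
  mk_eq.2 (by simp [Equiv.Perm.SameCycle.refl])

theorem exists_pow [Finite α] {τ : Equiv.Perm α} {x y : α} (h : mk τ x = mk τ y) :
    ∃ j : ℕ, (τ ^ j) x = y :=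
  (mk_eq.1 h).exists_nat_pow_eq

theorem minimalPeriod_pos [Finite α] (τ : Equiv.Perm α) (x : α) :
    0 < Function.minimalPeriod τ x :=
  Function.minimalPeriod_pos_of_mem_periodicPts (τ.injective.mem_periodicPts x)

/-- The number of elements of an orbit. -/
def len [Finite α] {τ : Equiv.Perm α} (O : Orb τ) : ℕ+ :=
  ⟨Function.minimalPeriod τ O.out, minimalPeriod_pos τ _⟩

/-- `len` is read off at a chosen representative; conjugating by a power of τ carries the period to
every other point of the orbit. -/
theorem pow_apply_eq_self_iff [Finite α] {τ : Equiv.Perm α} {x : α} {j : ℕ} :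
    (τ ^ j) x = x ↔ ((mk τ x).len : ℕ) ∣ j := by
  obtain ⟨i, hi⟩ := exists_pow (mk_out (mk τ x))
  have : (τ ^ j) x = x ↔ (τ ^ j) (mk τ x).out = (mk τ x).out := by
    conv_lhs => rw [← hi]
    rw [← Equiv.Perm.mul_apply, ← pow_add, add_comm, pow_add, Equiv.Perm.mul_apply]
    exact (τ ^ i).injective.eq_iff
  rw [this, ← Equiv.Perm.iterate_eq_pow]
  exact Function.isPeriodicPt_iff_minimalPeriod_dvd

theorem pow_len_apply [Finite α] (τ : Equiv.Perm α) (x : α) : (τ ^ ((mk τ x).len : ℕ)) x = x :=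
  pow_apply_eq_self_iff.2 dvd_rfl

theorem pow_apply_eq_iff [Finite α] {τ : Equiv.Perm α} {x : α} {i j : ℕ} :
    (τ ^ i) x = (τ ^ j) x ↔ i ≡ j [MOD (mk τ x).len] := by
  wlog h : i ≤ j generalizing i j
  · rw [eq_comm, this (le_of_not_ge h)]
    exact ⟨Nat.ModEq.symm, Nat.ModEq.symm⟩
  obtain ⟨l, rfl⟩ := Nat.exists_eq_add_of_le h
  rw [pow_add, Equiv.Perm.mul_apply, (τ ^ i).injective.eq_iff, eq_comm, pow_apply_eq_self_iff]
  constructor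
  · intro h
    simpa using Nat.ModEq.add_left i ((Nat.modEq_zero_iff_dvd.2 h).symm)
  · intro h
    exact Nat.modEq_zero_iff_dvd.1 (Nat.ModEq.add_left_cancel' i (by simpa using h.symm))

theorem card_fiber [Finite α] {τ : Equiv.Perm α} (O : Orb τ) :
    Nat.card {x // mk τ x = O} = O.len := by
  have : Function.Bijective (fun j : Fin (O.len : ℕ) =>
      (⟨(τ ^ (j : ℕ)) O.out, by simp⟩ : {x // mk τ x = O})) := by
    constructor
    · intro i j h
      have h' := pow_apply_eq_iff.1 (Subtype.ext_iff.1 h)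
      rw [mk_out] at h'
      exact Fin.ext (h'.eq_of_lt_of_lt i.2 j.2)
    · rintro ⟨x, rfl⟩
      obtain ⟨j, hj⟩ := exists_pow (mk_out (mk τ x))
      refine ⟨⟨j % (mk τ x).len, Nat.mod_lt _ (mk τ x).len.pos⟩, Subtype.ext ?_⟩
      refine Eq.trans ?_ hj
      rw [pow_apply_eq_iff, mk_out]
      exact Nat.mod_modEq _ _
  rw [← Nat.card_congr (Equiv.ofBijective _ this), Nat.card_fin]

theorem eq_len_iff [Finite α] {τ : Equiv.Perm α} {x : α} {n : ℕ+}
    (h : ∀ j : ℕ, (τ ^ j) x = x ↔ (n : ℕ) ∣ j) : (mk τ x).len = n :=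
  PNat.eq (Nat.dvd_antisymm (pow_apply_eq_self_iff.1 ((h n).2 dvd_rfl)) ((h _).1 (pow_len_apply τ x)))

theorem semiconj_pow {τ : Equiv.Perm α} {ρ : Equiv.Perm β} {π : α → β}
    (h : ∀ x, π (τ x) = ρ (π x)) (j : ℕ) (x : α) : π ((τ ^ j) x) = (ρ ^ j) (π x) := by
  induction j with
  | zero => rfl
  | succ j ih => rw [pow_succ', pow_succ', Equiv.Perm.mul_apply, Equiv.Perm.mul_apply, h, ih]

/-- The map on orbits induced by an equivariant map. -/
def map [Finite α] {τ : Equiv.Perm α} {ρ : Equiv.Perm β} (π : α → β)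
    (h : ∀ x, π (τ x) = ρ (π x)) : Orb τ → Orb ρ :=
  Quotient.map π fun x y hxy => by
    obtain ⟨j, hj⟩ := exists_pow (mk_eq.2 hxy)
    exact mk_eq.1 (by rw [← hj, semiconj_pow h, mk_pow_apply])

@[simp] theorem map_mk [Finite α] {τ : Equiv.Perm α} {ρ : Equiv.Perm β} (π : α → β)
    (h : ∀ x, π (τ x) = ρ (π x)) (x : α) : map π h (mk τ x) = mk ρ (π x) := rfl

/-- This divisibility makes the natural-number quotient in `fibExp` an exact one. -/
theorem len_map_dvd [Finite α] [Finite β] {τ : Equiv.Perm α} {ρ : Equiv.Perm β} (π : α → β)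
    (h : ∀ x, π (τ x) = ρ (π x)) (c : Orb τ) : ((map π h c).len : ℕ) ∣ c.len := by
  obtain ⟨x, rfl⟩ := mk_surjective τ c
  rw [map_mk, ← pow_apply_eq_self_iff, ← semiconj_pow h, pow_len_apply]

theorem len_map_of_injective [Finite α] [Finite β] {τ : Equiv.Perm α} {ρ : Equiv.Perm β} {π : α → β}
    (h : ∀ x, π (τ x) = ρ (π x)) (hπ : Function.Injective π) (c : Orb τ) :
    (map π h c).len = c.len := by
  obtain ⟨x, rfl⟩ := mk_surjective τ c
  exact eq_len_iff fun j => by rw [← semiconj_pow h, hπ.eq_iff, pow_apply_eq_self_iff]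

theorem map_injective [Finite α] {τ : Equiv.Perm α} {ρ : Equiv.Perm β} [Finite β] {π : α → β}
    (h : ∀ x, π (τ x) = ρ (π x)) (hπ : Function.Injective π) : Function.Injective (map π h) := by
  intro c c' hc
  obtain ⟨x, rfl⟩ := mk_surjective τ c
  obtain ⟨y, rfl⟩ := mk_surjective τ c'
  obtain ⟨j, hj⟩ := exists_pow hc
  rw [← semiconj_pow h] at hj
  rw [← hπ hj, mk_pow_apply]

theorem map_surjective [Finite α] {τ : Equiv.Perm α} {ρ : Equiv.Perm β} {π : α → β}
    (h : ∀ x, π (τ x) = ρ (π x)) (hπ : Function.Surjective π) : Function.Surjective (map π h) := by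
  intro c
  obtain ⟨x, rfl⟩ := mk_surjective ρ c
  obtain ⟨y, rfl⟩ := hπ x
  exact ⟨mk τ y, rfl⟩

end Orb

/-! ### Cycle exponents -/

section Exponents

open Orb Finsupp

variable {α β γ δ : Type*} [Finite α] [Finite β] [Finite γ] [Finite δ]

/-- The exponents of the cycle index of a permutation: the number of orbits of each length. -/
def cycExp (τ : Equiv.Perm α) : ℕ+ →₀ ℕ := ∑ O : Orb τ, single O.len 1

/-- The cycle exponents of the permutation induced on the fibre of an equivariant map over a point
of the orbit `O` by the first return to that point. -/
def fibExp {φ : Equiv.Perm α} {τ : Equiv.Perm β} (π : α → β) (h : ∀ x, π (φ x) = τ (π x))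
    (O : Orb τ) : ℕ+ →₀ ℕ :=
  ∑ c : Orb φ with map π h c = O, single ((c.len : ℕ) / O.len).toPNat' 1

/-- The weight `∑ n dₙ` of exponents of power sums. -/
def expWt (d : ℕ+ →₀ ℕ) : ℕ := d.sum fun n a => n * a

theorem expWt_add (d e : ℕ+ →₀ ℕ) : expWt (d + e) = expWt d + expWt e :=
  Finsupp.sum_add_index' (by simp) (by intros; ring)

@[simp] theorem expWt_single (n : ℕ+) (a : ℕ) : expWt (single n a) = n * a := by
  simp [expWt]

@[simp] theorem expWt_zero : expWt 0 = 0 := by simp [expWt]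

theorem expWt_sum {ι : Type*} (s : Finset ι) (f : ι → ℕ+ →₀ ℕ) :
    expWt (∑ i ∈ s, f i) = ∑ i ∈ s, expWt (f i) := by
  classical
  induction s using Finset.induction_on with
  | empty => simp
  | insert a s ha ih => rw [Finset.sum_insert ha, Finset.sum_insert ha, expWt_add, ih]

theorem expWt_eq_zero {d : ℕ+ →₀ ℕ} : expWt d = 0 ↔ d = 0 := by
  refine ⟨fun h => Finsupp.ext fun n => ?_, by rintro rfl; simp⟩
  by_contra hn
  have := Finset.sum_eq_zero_iff.1 h n (Finsupp.mem_support_iff.2 hn)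
  simp at this
  exact hn this

theorem expWt_cycExp (τ : Equiv.Perm α) : expWt (cycExp τ) = Nat.card α := by
  rw [cycExp, expWt_sum]
  simp only [expWt_single, mul_one]
  rw [← Nat.card_congr (Equiv.sigmaFiberEquiv (Orb.mk τ)), Nat.card_sigma]
  exact Finset.sum_congr rfl fun O _ => (card_fiber O).symm

theorem cycExp_congr {φ : Equiv.Perm α} {τ : Equiv.Perm β} (e : α ≃ β)
    (h : ∀ x, e (φ x) = τ (e x)) : cycExp φ = cycExp τ := by
  refine Fintype.sum_bijective (map e h) ⟨map_injective h e.injective,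
    map_surjective h e.surjective⟩ _ _ fun O => ?_
  rw [len_map_of_injective h e.injective]

/-- The fibre exponents do not change under base change along an injective map. -/
theorem fibExp_of_cartesian {φ : Equiv.Perm α} {τ : Equiv.Perm β} {φ' : Equiv.Perm γ}
    {τ' : Equiv.Perm δ} {π : α → β} (h : ∀ x, π (φ x) = τ (π x)) {π' : γ → δ}
    (h' : ∀ x, π' (φ' x) = τ' (π' x)) (θ : α → γ) (i : β → δ) (hθ : ∀ x, θ (φ x) = φ' (θ x))
    (hi : ∀ x, i (τ x) = τ' (i x)) (hθi : Function.Injective θ) (hii : Function.Injective i)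
    (hc : ∀ x, π' (θ x) = i (π x)) (hs : ∀ y b, π' y = i b → ∃ x, θ x = y) (O : Orb τ) :
    fibExp π' h' (map i hi O) = fibExp π h O := by
  symm
  have hmap : ∀ c, map π' h' (map θ hθ c) = map i hi (map π h c) := fun c => by
    obtain ⟨x, rfl⟩ := mk_surjective φ c
    simp [hc]
  refine Finset.sum_bij (fun c _ => map θ hθ c) ?_ ?_ ?_ ?_
  · intro c hcO
    rw [Finset.mem_filter] at hcO
    simp [hmap, hcO.2]
  · intro c _ c' _ hcc
    exact map_injective hθ hθi hcc
  · intro c hcO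
    rw [Finset.mem_filter] at hcO
    obtain ⟨y, rfl⟩ := mk_surjective φ' c
    obtain ⟨b, rfl⟩ := mk_surjective τ O
    obtain ⟨j, hj⟩ := exists_pow hcO.2
    rw [← semiconj_pow h'] at hj
    -- An orbit lying over the image of O has a point over i b, and by `hs` that point comes from α.
    obtain ⟨x, hx⟩ := hs _ _ hj
    refine ⟨mk φ x, ?_, by simp [hx]⟩
    rw [Finset.mem_filter]
    refine ⟨Finset.mem_univ _, map_injective hi hii ?_⟩
    rw [← hmap, map_mk, hx, mk_pow_apply]
    exact hcO.2
  · intro c _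
    rw [len_map_of_injective hθ hθi, len_map_of_injective hi hii]

/-- The fibre exponents are the exponents of the first return permutation. -/
theorem cycExp_eq_fibExp {φ : Equiv.Perm α} {τ : Equiv.Perm β} {π : α → β}
    (h : ∀ x, π (φ x) = τ (π x)) (b : β) (ψ : Equiv.Perm γ) (θ : γ → α)
    (hθi : Function.Injective θ) (hθ : ∀ x, θ (ψ x) = (φ ^ ((mk τ b).len : ℕ)) (θ x))
    (hr : ∀ x, π x = b ↔ ∃ y, θ y = x) : cycExp ψ = fibExp π h (mk τ b) := by
  have hθj : ∀ (j : ℕ) y, θ ((ψ ^ j) y) = (φ ^ ((mk τ b).len * j : ℕ)) (θ y) := fun j y => by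
    rw [semiconj_pow hθ, pow_mul]
  -- A first return orbit is sent to the orbit of φ which it generates. Every orbit over that of b
  -- meets the fibre over b, and its length is the length of the base orbit times that of the return
  -- orbit.
  let m : Orb ψ → Orb φ := Quotient.map θ fun x y hxy => by
    obtain ⟨j, hj⟩ := exists_pow (mk_eq.2 hxy)
    exact mk_eq.1 (by rw [← hj, hθj, mk_pow_apply])
  have hm : ∀ y, m (mk ψ y) = mk φ (θ y) := fun y => rfl
  have hb : ∀ y, π (θ y) = b := fun y => (hr _).2 ⟨y, rfl⟩
  refine Finset.sum_bij (fun c _ => m c) ?_ ?_ ?_ ?_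
  · intro c _
    obtain ⟨y, rfl⟩ := mk_surjective ψ c
    simp [hm, hb]
  · intro c _ c' _ hcc
    obtain ⟨y, rfl⟩ := mk_surjective ψ c
    obtain ⟨y', rfl⟩ := mk_surjective ψ c'
    obtain ⟨j, hj⟩ := exists_pow hcc
    -- Both points lie over b, so j is a multiple of the length of the base orbit and the power of φ
    -- is a power of the return map.
    have h1 : (τ ^ j) b = b := by
      have := congrArg π hj
      rwa [semiconj_pow h, hb, hb] at this
    obtain ⟨l, rfl⟩ := pow_apply_eq_self_iff.1 h1
    rw [← hθj] at hj
    rw [← hθi hj, mk_pow_apply]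
  · intro c hc
    obtain ⟨x, rfl⟩ := mk_surjective φ c
    obtain ⟨j, hj⟩ := exists_pow (Finset.mem_filter.1 hc).2
    rw [← semiconj_pow h] at hj
    obtain ⟨y, hy⟩ := (hr _).1 hj
    exact ⟨mk ψ y, Finset.mem_univ _, by rw [hm, hy, mk_pow_apply]⟩
  · intro c _
    obtain ⟨y, rfl⟩ := mk_surjective ψ c
    have hdvd : ((mk τ b).len : ℕ) ∣ (mk φ (θ y)).len := by
      have := len_map_dvd π h (mk φ (θ y))
      rwa [map_mk, hb] at this
    congr 1
    refine eq_len_iff fun j => ?_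
    rw [← hθi.eq_iff, hθj, pow_apply_eq_self_iff, hm]
    obtain ⟨l, hl⟩ := hdvd
    have hl0 : 0 < l := Nat.pos_of_ne_zero fun h0 => by
      have := (mk φ (θ y)).len.pos
      simp [hl, h0] at this
    have : (((mk φ (θ y)).len : ℕ) / (mk τ b).len).toPNat' = ⟨l, hl0⟩ := by
      apply PNat.eq
      rw [hl, Nat.mul_div_cancel_left _ (mk τ b).len.pos]
      simp [hl0]
    rw [this, hl, PNat.mk_coe, Nat.mul_dvd_mul_iff_left (mk τ b).len.pos]

/-! ### Equivariant maps and their values at orbit representatives. -/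

/-- The set of equivariant maps between two sets with permutations. -/
def EquivariantMap {α β : Type*} (σ : Equiv.Perm α) (ρ : Equiv.Perm β) : Type _ :=
  {q : α → β // ∀ e, q (σ e) = ρ (q e)}

instance {α β : Type*} [Finite α] [Finite β] (σ : Equiv.Perm α) (ρ : Equiv.Perm β) :
    Fintype (EquivariantMap σ ρ) :=
  @Fintype.ofFinite _ (inferInstanceAs (Finite {q : α → β // ∀ e, q (σ e) = ρ (q e)}))

/-- An equivariant map is given by its values at representatives of the orbits. -/
def equivariantEquiv (σ : Equiv.Perm α) (ρ : Equiv.Perm β) :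
    EquivariantMap σ ρ ≃ (∀ c : Orb σ, {x : β // (ρ ^ (c.len : ℕ)) x = x}) where
  toFun q c := ⟨q.1 c.out, by
    have := pow_len_apply σ c.out
    rw [mk_out] at this
    rw [← semiconj_pow q.2, this]⟩
  -- The value at a representative is transported along the power of σ leading to e. Another power
  -- differs by a multiple of the orbit length, which acts trivially on the chosen value.
  invFun x := ⟨fun e => (ρ ^ (exists_pow (mk_out (mk σ e))).choose) (x (mk σ e)).1, fun e => by
    have h1 := (exists_pow (mk_out (mk σ e))).choose_spec
    have h2 := (exists_pow (mk_out (mk σ (σ e)))).choose_spec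
    set i := (exists_pow (mk_out (mk σ e))).choose
    set j := (exists_pow (mk_out (mk σ (σ e)))).choose
    have h3 : (σ ^ j) (mk σ e).out = (σ ^ (i + 1)) (mk σ e).out := by
      rw [pow_succ', Equiv.Perm.mul_apply, h1]
      rw [mk_apply] at h2
      exact h2
    rw [pow_apply_eq_iff, mk_out] at h3
    rw [← Equiv.Perm.mul_apply, ← pow_succ']
    have key : ∀ c, c = mk σ e → (ρ ^ j) (x c).1 = (ρ ^ (i + 1)) (x (mk σ e)).1 := by
      rintro _ rfl
      exact pow_apply_eq_iff.2 (h3.of_dvd (pow_apply_eq_self_iff.1 (x (mk σ e)).2))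
    exact key _ (mk_apply σ e)⟩
  left_inv q := by
    refine Subtype.ext (funext fun e => ?_)
    change (ρ ^ (exists_pow (mk_out (mk σ e))).choose) (q.1 _) = _
    rw [← semiconj_pow q.2, (exists_pow (mk_out (mk σ e))).choose_spec]
  right_inv x := by
    funext c
    apply Subtype.ext
    change (ρ ^ (exists_pow (mk_out (mk σ c.out))).choose) (x (mk σ c.out)).1 = _
    have h1 := (exists_pow (mk_out (mk σ c.out))).choose_spec
    have key : ∀ c' (hc : c' = c) (i : ℕ), (σ ^ i) c'.out = c.out →
        (ρ ^ i) (x c').1 = (x c).1 := by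
      rintro _ rfl i hi
      rw [pow_apply_eq_self_iff, mk_out] at hi
      exact pow_apply_eq_self_iff.2 ((pow_apply_eq_self_iff.1 (x _).2).trans hi)
    exact key _ (mk_out c) _ h1

theorem equivariantEquiv_apply (σ : Equiv.Perm α) (ρ : Equiv.Perm β)
    (q : EquivariantMap σ ρ) (c : Orb σ) :
    mk ρ (equivariantEquiv σ ρ q c).1 = map q.1 q.2 c := by
  conv_rhs => rw [← mk_out c, map_mk]
  rfl

end Exponents

/-! ### Evaluation of symmetric functions at cycle exponents -/

namespace SymFun

open Finsupp MvPowerSeries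

variable {k : Type u} [Field k]

/-- The order `∏ n ^ dₙ dₙ!` of the centralizer of a permutation with `dₙ` cycles of length `n`. -/
def zee (d : ℕ+ →₀ ℕ) : ℕ := d.prod fun n a => (n : ℕ) ^ a * a.factorial

theorem zee_pos (d : ℕ+ →₀ ℕ) : 0 < zee d :=
  Finset.prod_pos fun n _ => Nat.mul_pos (pow_pos n.pos _) (Nat.factorial_pos _)

theorem zee_add_single (d : ℕ+ →₀ ℕ) (n : ℕ+) :
    zee (d + single n 1) = zee d * (n * (d n + 1)) := by
  classical
  have h : ∀ e : ℕ+ →₀ ℕ, e.support ⊆ insert n d.support →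
      zee e = (n : ℕ) ^ e n * (e n).factorial *
        ∏ m ∈ (insert n d.support).erase n, (m : ℕ) ^ e m * (e m).factorial := fun e he => by
    rw [zee, Finsupp.prod_of_support_subset _ he _ (by simp),
      ← Finset.mul_prod_erase _ _ (Finset.mem_insert_self n _)]
  rw [h d (Finset.subset_insert _ _), h (d + single n 1)]
  · have : ∀ m ∈ (insert n d.support).erase n, (d + single n 1 : ℕ+ →₀ ℕ) m = d m := fun m hm => by
      simp [(Finset.ne_of_mem_erase hm).symm]
    rw [Finset.prod_congr rfl fun m hm => by rw [this m hm]]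
    simp [Nat.factorial_succ, pow_succ]
    ring
  · refine Finsupp.support_add.trans (Finset.union_subset (Finset.subset_insert _ _) ?_)
    exact Finsupp.support_single_subset.trans (by simp)

/-- The value at a permutation with cycle exponents `d` of the class function which corresponds
to the symmetric function `f`. -/
def ev (f : SymFun k) (d : ℕ+ →₀ ℕ) : k := zee d * coeff d f

theorem ev_add (f g : SymFun k) (d : ℕ+ →₀ ℕ) : ev (f + g) d = ev f d + ev g d := by
  simp [ev, mul_add]

theorem ev_sub (f g : SymFun k) (d : ℕ+ →₀ ℕ) : ev (f - g) d = ev f d - ev g d := by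
  simp [ev, mul_sub]

theorem ev_C_mul (a : k) (f : SymFun k) (d : ℕ+ →₀ ℕ) : ev (C a * f) d = a * ev f d := by
  simp only [ev, coeff_C_mul]
  ring

theorem ev_sum {ι : Type*} (s : Finset ι) (f : ι → SymFun k) (d : ℕ+ →₀ ℕ) :
    ev (∑ i ∈ s, f i) d = ∑ i ∈ s, ev (f i) d := by
  simp [ev, Finset.mul_sum]

theorem ev_zero (f : SymFun k) : ev f 0 = constantCoeff f := by
  simp [ev, zee]

theorem ext_ev [CharZero k] {f g : SymFun k} (h : ∀ d, ev f d = ev g d) : f = g := by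
  refine MvPowerSeries.ext fun d => ?_
  exact mul_left_cancel₀ (Nat.cast_ne_zero.2 (zee_pos d).ne') (h d)

/-- Adding an n-cycle is the operator n ∂/∂p_n: the factor dₙ + 1 of the derivative is the one by
which `zee` grows. Statements about `ev` can thus be proved by removing one cycle at a time. -/
theorem ev_add_single (f : SymFun k) (d : ℕ+ →₀ ℕ) (n : ℕ+) :
    ev f (d + single n 1) = n * ev (pderiv k n f) d := by
  rw [ev, ev, zee_add_single, coeff_pderiv]
  push_cast
  ring

theorem ev_dp₁ (f : SymFun k) (d : ℕ+ →₀ ℕ) : ev (dp₁ f) d = ev f (d + single 1 1) := by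
  rw [ev_add_single]
  simp [dp₁]

theorem pderiv_prod {ι : Type*} [Fintype ι] [DecidableEq ι] (n : ℕ+) (f : ι → SymFun k) :
    pderiv k n (∏ i, f i) = ∑ i, ∏ j, Function.update f i (pderiv k n (f i)) j := by
  have key : ∀ s : Finset ι, pderiv k n (∏ i ∈ s, f i) =
      ∑ i ∈ s, pderiv k n (f i) * ∏ j ∈ s.erase i, f j := fun s => by
    induction s using Finset.induction_on with
    | empty => simp
    | insert a s ha ih =>
      rw [Finset.prod_insert ha, Derivation.leibniz, ih, Finset.sum_insert ha,
        Finset.erase_insert ha, smul_eq_mul, smul_eq_mul, Finset.mul_sum, add_comm, mul_comm]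
      congr 1
      refine Finset.sum_congr rfl fun i hi => ?_
      have hia : a ≠ i := fun h => ha (h ▸ hi)
      rw [Finset.erase_insert_of_ne hia,
        Finset.prod_insert fun h => ha (Finset.mem_of_mem_erase h)]
      ring
  rw [key]
  refine Finset.sum_congr rfl fun i _ => ?_
  rw [Finset.prod_update_of_mem (Finset.mem_univ i), Finset.sdiff_singleton_eq_erase]

/-- Induction on the number of cycles: the Leibniz rule for the derivative that removes the first
cycle chooses the factor receiving that cycle. -/
theorem ev_prod_fin {ι : Type*} [Fintype ι] [DecidableEq ι] {n : ℕ} (f : ι → SymFun k)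
    (ℓ : Fin n → ℕ+) :
    ev (∏ i, f i) (∑ c, single (ℓ c) 1) =
      ∑ r : Fin n → ι, ∏ i, ev (f i) (∑ c with r c = i, single (ℓ c) 1) := by
  induction n generalizing f with
  | zero => simp [ev_zero]
  | succ n ih =>
    rw [Fin.sum_univ_succ, add_comm, ev_add_single, pderiv_prod, ev_sum, Finset.mul_sum,
      ← (Fin.consEquiv fun _ : Fin (n + 1) => ι).sum_comp, Fintype.sum_prod_type]
    refine Finset.sum_congr rfl fun i _ => ?_
    rw [ih, Finset.mul_sum]
    refine Finset.sum_congr rfl fun r _ => ?_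
    rw [← Finset.mul_prod_erase _ _ (Finset.mem_univ i),
      ← Finset.mul_prod_erase _ _ (Finset.mem_univ i), ← mul_assoc]
    simp only [Finset.sum_filter, Fin.sum_univ_succ, Fin.consEquiv_apply, Fin.cons_zero,
      Fin.cons_succ, Function.update_self]
    congr 1
    · rw [if_pos trivial, ← ev_add_single, add_comm (∑ a, _)]
    · refine Finset.prod_congr rfl fun j hj => ?_
      have hj := Finset.ne_of_mem_erase hj
      rw [Function.update_of_ne hj, if_neg hj.symm, zero_add]

/-- The product rule: the value of a product at a family of cycles is the sum over all ways of
distributing the cycles among the factors. -/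
theorem ev_prod {ι C : Type*} [Fintype ι] [DecidableEq ι] [Fintype C] [DecidableEq C]
    (f : ι → SymFun k) (ℓ : C → ℕ+) :
    ev (∏ i, f i) (∑ c, single (ℓ c) 1) =
      ∑ r : C → ι, ∏ i, ev (f i) (∑ c with r c = i, single (ℓ c) 1) := by
  let e := Fintype.equivFin C
  have h := ev_prod_fin f (ℓ ∘ e.symm)
  simp only [Function.comp_apply, e.symm.sum_comp fun c => (single (ℓ c) 1 : ℕ+ →₀ ℕ)] at h
  rw [h, ← (e.arrowCongr (Equiv.refl ι)).sum_comp]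
  refine Finset.sum_congr rfl fun r _ => Finset.prod_congr rfl fun i _ => ?_
  congr 1
  rw [Finset.sum_filter, Finset.sum_filter, ← e.symm.sum_comp]
  rfl

theorem hasSubst_p_mul (n : ℕ+) : HasSubst (fun m : ℕ+ => (p (n * m) : SymFun k)) where
  const_coeff m := by simp [p]
  coeff_zero d := by
    classical
    refine Set.Finite.subset (d.support.finite_toSet.preimage (f := fun m => n * m)
      (mul_right_injective n).injOn) fun m hm => ?_
    rw [Set.mem_ofPred_eq, p, coeff_X, ite_ne_right_iff] at hm
    simp [hm.1]

theorem coeff_adams (n : ℕ+) (f : SymFun k) (d : ℕ+ →₀ ℕ) :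
    coeff (mapDomain (fun m => n * m) d) (adams n f) = coeff d f := by
  classical
  have hinj : Function.Injective (fun m : ℕ+ => n * m) := mul_right_injective n
  rw [adams, coeff_subst (hasSubst_p_mul n), finsum_eq_single _ d]
  · have : (d.prod fun s e => (p (n * s) : SymFun k) ^ e) =
        monomial (mapDomain (fun m => n * m) d) 1 := by
      rw [monomial_one_eq, prod_mapDomain_index_inj hinj]
      rfl
    rw [this, coeff_monomial_same, smul_eq_mul, mul_one]
  · intro e he
    have : (e.prod fun s e => (p (n * s) : SymFun k) ^ e) =
        monomial (mapDomain (fun m => n * m) e) 1 := by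
      rw [monomial_one_eq, prod_mapDomain_index_inj hinj]
      rfl
    rw [this, coeff_monomial_ne fun h => he (mapDomain_injective hinj h.symm), smul_zero]

theorem coeff_adams_eq_zero (n : ℕ+) (f : SymFun k) (d : ℕ+ →₀ ℕ) (m : ℕ+) (hm : ¬ n ∣ m)
    (hd : d m ≠ 0) : coeff d (adams n f) = 0 := by
  classical
  have hinj : Function.Injective (fun m : ℕ+ => n * m) := mul_right_injective n
  rw [adams, coeff_subst (hasSubst_p_mul n)]
  refine finsum_eq_zero_of_forall_eq_zero fun e => ?_
  have : (e.prod fun s e => (p (n * s) : SymFun k) ^ e) =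
      monomial (mapDomain (fun m => n * m) e) 1 := by
    rw [monomial_one_eq, prod_mapDomain_index_inj hinj]
    rfl
  rw [this, coeff_monomial_ne, smul_zero]
  rintro rfl
  refine hd (mapDomain_of_notMem_range _ _ ?_)
  rintro ⟨l, rfl⟩
  exact hm (dvd_mul_right n l)

theorem zee_mapDomain_mul (n : ℕ+) (d : ℕ+ →₀ ℕ) :
    zee (mapDomain (fun m => n * m) d) = n ^ (d.sum fun _ a => a) * zee d := by
  rw [zee, prod_mapDomain_index_inj (mul_right_injective n), zee, Finsupp.sum,
    ← Finset.prod_pow_eq_pow_sum, Finsupp.prod, Finsupp.prod, ← Finset.prod_mul_distrib]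
  refine Finset.prod_congr rfl fun m _ => ?_
  rw [PNat.mul_coe, mul_pow, mul_assoc]

/-- Substituting p_{nm} for p_m multiplies every cycle length by n, and `zee` acquires a factor n
for each cycle. This n is later the number of ways to place a cycle above an orbit of length n. -/
theorem ev_adams {C : Type*} (s : Finset C) (ℓ : C → ℕ+) (n : ℕ+) (f : SymFun k) :
    ev (adams n f) (∑ c ∈ s, single (ℓ c) 1) =
      (∏ c ∈ s, if (n : ℕ) ∣ ℓ c then (n : k) else 0) *
        ev f (∑ c ∈ s, single ((ℓ c : ℕ) / n).toPNat' 1) := by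
  classical
  by_cases h : ∀ c ∈ s, (n : ℕ) ∣ ℓ c
  · have h1 : ∀ c ∈ s, ℓ c = n * ((ℓ c : ℕ) / n).toPNat' := fun c hc => by
      obtain ⟨l, hl⟩ := h c hc
      have hl0 : 0 < l := Nat.pos_of_ne_zero fun h0 => by
        have := (ℓ c).pos
        simp [hl, h0] at this
      apply PNat.eq
      rw [PNat.mul_coe, hl, Nat.mul_div_cancel_left _ n.pos]
      simp [hl0]
    have h2 : ∑ c ∈ s, single (ℓ c) 1 = mapDomain (fun m => n * m)
        (∑ c ∈ s, single ((ℓ c : ℕ) / n).toPNat' 1) := by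
      rw [mapDomain_finsetSum]
      refine Finset.sum_congr rfl fun c hc => ?_
      rw [mapDomain_single, ← h1 c hc]
    have h3 : (∑ c ∈ s, single ((ℓ c : ℕ) / n).toPNat' 1 : ℕ+ →₀ ℕ).sum (fun _ a => a) =
        s.card := by
      rw [← Finsupp.sum_finsetSum_index (fun _ => rfl) (fun _ _ _ => rfl)]
      simp
    rw [h2, ev, coeff_adams, zee_mapDomain_mul, h3, Finset.prod_congr rfl fun c hc => if_pos (h c hc),
      Finset.prod_const, ev]
    push_cast
    ring
  · push Not at h
    obtain ⟨c, hc, hn⟩ := h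
    rw [Finset.prod_eq_zero hc (if_neg hn), zero_mul, ev,
      coeff_adams_eq_zero n f _ (ℓ c) (by rwa [PNat.dvd_iff]), mul_zero]
    rw [Finsupp.finsetSum_apply]
    refine (Finset.sum_pos' (fun _ _ => Nat.zero_le _) ⟨c, hc, ?_⟩).ne'
    simp

end SymFun

/-! ### Sums over equivariant maps. -/

/-- The product of the values of a class function at the first return permutations of the fibres
of an equivariant map, with one factor for each orbit of the base. -/
def orbWeight {k : Type u} [Field k] {α β : Type*} [Finite α] [Finite β] {φ : Equiv.Perm α}
    {τ : Equiv.Perm β} (f : SymFun k) (π : α → β) (h : ∀ x, π (φ x) = τ (π x)) : k :=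
  ∏ O : Orb τ, f.ev (fibExp π h O)

namespace Orb

variable {α β : Type*} [Finite α] [Finite β]

theorem card_fixed_in_orbit (ρ : Equiv.Perm β) (O : Orb ρ) (n : ℕ) :
    Nat.card {x : {x : β // (ρ ^ n) x = x} // mk ρ x.1 = O} =
      if (O.len : ℕ) ∣ n then (O.len : ℕ) else 0 := by
  split_ifs with h
  · rw [← card_fiber]
    refine Nat.card_congr ⟨fun x => ⟨x.1.1, x.2⟩, fun x => ⟨⟨x.1, ?_⟩, x.2⟩, fun _ => rfl,
      fun _ => rfl⟩
    rw [pow_apply_eq_self_iff, x.2]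
    exact h
  · rw [Nat.card_eq_zero]
    refine Or.inl ⟨fun x => h ?_⟩
    rw [← x.2, ← pow_apply_eq_self_iff]
    exact x.1.2

/-- To lift a map r of orbits, choose the image of each representative. A point of r c is a possible
image of the representative of c exactly if the length of r c divides that of c, and then all points
of r c are. -/
theorem sum_equivariantMap {k : Type u} [Field k] (σ : Equiv.Perm α) (ρ : Equiv.Perm β)
    (F : (Orb σ → Orb ρ) → k) :
    ∑ q : EquivariantMap σ ρ, F (map q.1 q.2) =
      ∑ r : Orb σ → Orb ρ, (∏ c, if ((r c).len : ℕ) ∣ c.len then ((r c).len : k) else 0) * F r := by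
  classical
  have := Fintype.ofFinite β
  rw [← (equivariantEquiv σ ρ).symm.sum_comp (fun q : EquivariantMap σ ρ => F (map q.1 q.2)),
    ← Finset.sum_fiberwise Finset.univ (fun x : ∀ c : Orb σ, {x : β // (ρ ^ (c.len : ℕ)) x = x} =>
      fun c => mk ρ (x c).1)]
  refine Finset.sum_congr rfl fun r _ => ?_
  have h1 : ∀ x ∈ Finset.univ.filter (fun x : ∀ c : Orb σ, {x : β // (ρ ^ (c.len : ℕ)) x = x} =>
      (fun c => mk ρ (x c).1) = r), F (map ((equivariantEquiv σ ρ).symm x).1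
        ((equivariantEquiv σ ρ).symm x).2) = F r := fun x hx => by
    congr 1
    rw [← (Finset.mem_filter.1 hx).2]
    funext c
    rw [← equivariantEquiv_apply, Equiv.apply_symm_apply]
  rw [Finset.sum_congr rfl h1, Finset.sum_const, nsmul_eq_mul]
  congr 1
  rw [← Fintype.card_subtype]
  have e : {x : ∀ c : Orb σ, {x : β // (ρ ^ (c.len : ℕ)) x = x} // (fun c => mk ρ (x c).1) = r} ≃
      ∀ c : Orb σ, {x : {x : β // (ρ ^ (c.len : ℕ)) x = x} // mk ρ x.1 = r c} :=
    ⟨fun x c => ⟨x.1 c, congrFun x.2 c⟩, fun x => ⟨fun c => (x c).1, funext fun c => (x c).2⟩,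
      fun _ => rfl, fun _ => rfl⟩
  rw [Fintype.card_congr e, Fintype.card_pi]
  push_cast
  refine Finset.prod_congr rfl fun c _ => ?_
  rw [← Nat.card_eq_fintype_card]
  refine (congrArg _ (card_fixed_in_orbit ρ (r c) c.len)).trans ?_
  split_ifs <;> simp

/-- The value at a permutation `σ` of the substitution instance of a cycle index: the sum over all
equivariant maps of the products of the values at the first return permutations. -/
theorem ev_prod_adams {k : Type u} [Field k] (σ : Equiv.Perm α) (ρ : Equiv.Perm β)
    (f : SymFun k) :
    (∏ O : Orb ρ, SymFun.adams O.len f).ev (cycExp σ) =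
      ∑ q : EquivariantMap σ ρ, orbWeight f q.1 q.2 := by
  classical
  rw [cycExp, SymFun.ev_prod]
  refine Eq.trans ?_ (sum_equivariantMap σ ρ fun r => ∏ O : Orb ρ, f.ev
    (∑ c with r c = O, Finsupp.single ((c.len : ℕ) / O.len).toPNat' 1)).symm
  refine Finset.sum_congr rfl fun r _ => ?_
  rw [← Finset.prod_fiberwise Finset.univ r, ← Finset.prod_mul_distrib]
  refine Finset.prod_congr rfl fun O _ => ?_
  rw [SymFun.ev_adams]
  congr 1
  refine Finset.prod_congr rfl fun c hc => ?_
  rw [(Finset.mem_filter.1 hc).2]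

end Orb

/-! ### Counting permutations with given cycle exponents -/

section Count

open Orb Finsupp

variable {α β γ δ : Type*} [Finite α] [Finite β] [Finite γ] [Finite δ]

/-- The fibre exponents form the cycle type of the first return permutation of the fibre over b, so
their weight is the size of this fibre. -/
theorem expWt_fibExp {φ : Equiv.Perm α} {τ : Equiv.Perm β} (π : α → β)
    (h : ∀ x, π (φ x) = τ (π x)) (b : β) :
    expWt (fibExp π h (mk τ b)) = Nat.card {x // π x = b} := by
  have hp : ∀ x, π ((φ ^ ((mk τ b).len : ℕ)) x) = b ↔ π x = b := fun x => by
    rw [semiconj_pow h]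
    exact ⟨fun e => (τ ^ _).injective (e.trans (pow_len_apply τ b).symm),
      fun e => by rw [e, pow_len_apply]⟩
  rw [← cycExp_eq_fibExp h b ((φ ^ ((mk τ b).len : ℕ)).subtypePerm (p := fun x => π x = b) hp) Subtype.val
    Subtype.val_injective (fun _ => rfl) fun x => by simp, expWt_cycExp]

theorem eq_single_of_expWt_eq_one {d : ℕ+ →₀ ℕ} (h : expWt d = 1) : d = single 1 1 := by
  have hd : d ≠ 0 := by
    rintro rfl
    simp at h
  obtain ⟨n, hn⟩ := Finsupp.ne_iff.1 hd
  have h1 : single n 1 ≤ d := Finsupp.single_le_iff.2 (Nat.one_le_iff_ne_zero.2 hn)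
  obtain ⟨e, rfl⟩ := exists_add_of_le h1
  rw [expWt_add, expWt_single, mul_one] at h
  have := n.pos
  have h2 : (n : ℕ) = 1 := by omega
  have h3 : expWt e = 0 := by omega
  rw [expWt_eq_zero.1 h3, add_zero, PNat.coe_eq_one_iff.1 h2]

/-- The orbits of a set which is the disjoint union of two invariant parts. -/
theorem Orb.bijective_sumElim {τ : Equiv.Perm α} {τ' : Equiv.Perm β} {ρ : Equiv.Perm γ}
    {i : α → γ} {i' : β → γ} (h : ∀ x, i (τ x) = ρ (i x)) (h' : ∀ x, i' (τ' x) = ρ (i' x))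
    (hb : Function.Bijective (Sum.elim i i')) :
    Function.Bijective (Sum.elim (Orb.map i h) (Orb.map i' h')) := by
  have hi : Function.Injective i := hb.1.comp Sum.inl_injective
  have hi' : Function.Injective i' := hb.1.comp Sum.inr_injective
  constructor
  · refine Function.Injective.sumElim (map_injective h hi) (map_injective h' hi') ?_
    intro c c' hc
    obtain ⟨x, rfl⟩ := mk_surjective τ c
    obtain ⟨y, rfl⟩ := mk_surjective τ' c'
    obtain ⟨j, hj⟩ := exists_pow hc
    rw [← semiconj_pow h] at hj
    exact Sum.inl_ne_inr (hb.1 (a₁ := Sum.inl _) (a₂ := Sum.inr _) hj)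
  · intro O
    obtain ⟨z, rfl⟩ := mk_surjective ρ O
    obtain ⟨x | y, rfl⟩ := hb.2 z
    · exact ⟨Sum.inl (mk τ x), rfl⟩
    · exact ⟨Sum.inr (mk τ' y), rfl⟩

theorem Orb.prod_eq_mul {M : Type*} [CommMonoid M] {τ : Equiv.Perm α} {τ' : Equiv.Perm β}
    {ρ : Equiv.Perm γ} {i : α → γ} {i' : β → γ} (h : ∀ x, i (τ x) = ρ (i x))
    (h' : ∀ x, i' (τ' x) = ρ (i' x)) (hb : Function.Bijective (Sum.elim i i')) (F : Orb ρ → M) :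
    ∏ O, F O = (∏ O, F (Orb.map i h O)) * ∏ O, F (Orb.map i' h' O) := by
  rw [← Fintype.prod_sumElim]
  refine (Fintype.prod_bijective _ (bijective_sumElim h h' hb) _ _ fun O => ?_).symm
  rcases O with O | O <;> rfl

theorem cycExp_sumCongr (σ : Equiv.Perm α) (τ : Equiv.Perm β) :
    cycExp (σ.sumCongr τ) = cycExp σ + cycExp τ := by
  have hb : Function.Bijective (Sum.elim (Sum.inl : α → α ⊕ β) Sum.inr) := by
    rw [Sum.elim_inl_inr]
    exact Function.bijective_id
  have h1 : ∀ x, (Sum.inl (σ x) : α ⊕ β) = σ.sumCongr τ (Sum.inl x) := fun _ => rfl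
  have h2 : ∀ x, (Sum.inr (τ x) : α ⊕ β) = σ.sumCongr τ (Sum.inr x) := fun _ => rfl
  -- `Multiplicative` turns the product formula into the sum formula for exponents.
  have := Orb.prod_eq_mul h1 h2 hb (fun O => Multiplicative.ofAdd (single O.len 1 : ℕ+ →₀ ℕ))
  simp only [len_map_of_injective h1 Sum.inl_injective,
    len_map_of_injective h2 Sum.inr_injective] at this
  exact this

/-- A disjoint union of rotations of the groups ℤ/n realizes any cycle type. Symmetric functions can
therefore be compared on permutations. -/
theorem exists_cycExp_eq (d : ℕ+ →₀ ℕ) :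
    ∃ σ : Equiv.Perm (Fin (expWt d)), cycExp σ = d := by
  suffices h : ∃ (α : Type) (_ : Finite α) (σ : Equiv.Perm α), cycExp σ = d by
    obtain ⟨α, _, σ, rfl⟩ := h
    rw [expWt_cycExp]
    refine ⟨(Finite.equivFin α).permCongr σ, (cycExp_congr (Finite.equivFin α) fun x => ?_).symm⟩
    simp
  have hadd : ∀ d e : ℕ+ →₀ ℕ, (∃ (α : Type) (_ : Finite α) (σ : Equiv.Perm α), cycExp σ = d) →
      (∃ (α : Type) (_ : Finite α) (σ : Equiv.Perm α), cycExp σ = e) →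
      ∃ (α : Type) (_ : Finite α) (σ : Equiv.Perm α), cycExp σ = d + e := by
    rintro _ _ ⟨α, _, σ, rfl⟩ ⟨β, _, τ, rfl⟩
    exact ⟨α ⊕ β, inferInstance, σ.sumCongr τ, cycExp_sumCongr σ τ⟩
  have hzero : ∃ (α : Type) (_ : Finite α) (σ : Equiv.Perm α), cycExp σ = 0 := by
    refine ⟨Empty, inferInstance, 1, ?_⟩
    rw [← expWt_eq_zero, expWt_cycExp]
    simp
  induction d using Finsupp.induction_linear with
  | zero => exact hzero
  | add d e hd he => exact hadd d e hd he
  | single n a =>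
    induction a with
    | zero => simpa using hzero
    | succ a ih =>
      rw [single_add]
      refine hadd _ _ ih ⟨ZMod n, ?_, Equiv.addRight (1 : ZMod n), ?_⟩
      · have : NeZero (n : ℕ) := ⟨n.pos.ne'⟩
        infer_instance
      · have : NeZero (n : ℕ) := ⟨n.pos.ne'⟩
        have hpow : ∀ (j : ℕ) (x : ZMod n), ((Equiv.addRight (1 : ZMod n)) ^ j) x = x + j := by
          intro j
          induction j with
          | zero => simp
          | succ j ih =>
            intro x
            rw [pow_succ', Equiv.Perm.mul_apply, ih]
            simp [add_assoc]
        have hmk : ∀ O : Orb (Equiv.addRight (1 : ZMod n)), O = mk _ 0 := fun O => by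
          obtain ⟨x, rfl⟩ := mk_surjective _ O
          rw [← mk_pow_apply _ x.val 0, hpow]
          simp
        rw [cycExp, Fintype.sum_eq_single (mk _ 0) fun O hO => absurd (hmk O) hO]
        congr 1
        refine eq_len_iff fun j => ?_
        rw [hpow, zero_add, ZMod.natCast_eq_zero_iff]

end Count

namespace SymFun

open Orb Finsupp MvPowerSeries

variable {k : Type u} [Field k] {α β : Type*} [Finite α] [Finite β]

theorem prod_eq_adams_prod (ρ : Equiv.Perm β) (a : ℕ+ → SymFun k) :
    ((cycExp ρ).prod fun n e => a n ^ e) = ∏ O : Orb ρ, a O.len := by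
  rw [cycExp, ← Finsupp.prod_finsetSum_index (by simp) (by intros; rw [pow_add])]
  simp

/-- A point outside the image has an empty fibre, and the factor of an empty fibre is the constant
term of f. -/
theorem orbWeight_eq_zero {σ : Equiv.Perm α} {ρ : Equiv.Perm β} {f : SymFun k}
    (hf : constantCoeff f = 0) (q : α → β) (h : ∀ x, q (σ x) = ρ (q x))
    (hq : ¬ Function.Surjective q) : orbWeight f q h = 0 := by
  rw [Function.Surjective] at hq
  push Not at hq
  obtain ⟨b, hb⟩ := hq
  refine Finset.prod_eq_zero (Finset.mem_univ (Orb.mk ρ b)) ?_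
  have : expWt (fibExp q h (Orb.mk ρ b)) = 0 := by
    rw [expWt_fibExp, Nat.card_eq_zero]
    exact Or.inl ⟨fun x => hb x.1 x.2⟩
  rw [expWt_eq_zero.1 this, ev_zero, hf]

theorem ev_p_one_of_expWt (d : ℕ+ →₀ ℕ) : ev (p 1 : SymFun k) d = if expWt d = 1 then 1 else 0 := by
  classical
  rw [ev, p, coeff_X]
  split_ifs with h1 h2 h2
  · subst h1
    simp [zee]
  · subst h1
    simp at h2
  · exact absurd (eq_single_of_expWt_eq_one h2) h1
  · simp

theorem adams_X (n : ℕ+) (m : ℕ+) : adams n (p m : SymFun k) = p (n * m) := by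
  rw [adams, p, subst_X (hasSubst_p_mul n)]

theorem ev_prod_p (ρ : Equiv.Perm β) (σ : Equiv.Perm α) :
    (∏ O : Orb ρ, (p O.len : SymFun k)).ev (cycExp σ) =
      if cycExp σ = cycExp ρ then (zee (cycExp σ) : k) else 0 := by
  classical
  have : ∏ O : Orb ρ, (p O.len : SymFun k) = monomial (cycExp ρ) 1 := by
    rw [monomial_one_eq, ← prod_eq_adams_prod]
    rfl
  rw [this, ev, coeff_monomial]
  split_ifs <;> simp

/-- The number of equivariant bijections between two sets with permutations. -/
theorem card_equivariant_equiv [CharZero k] (σ : Equiv.Perm α) (ρ : Equiv.Perm β) :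
    Nat.card {g : α ≃ β // ∀ x, g (σ x) = ρ (g x)} =
      if cycExp σ = cycExp ρ then zee (cycExp σ) else 0 := by
  classical
  -- With f = p₁ the weight of an equivariant map is the indicator of its bijectivity, while the
  -- product on the other side is the monomial of the cycle type of ρ.
  have h := Orb.ev_prod_adams σ ρ (p 1 : SymFun k)
  simp only [adams_X, mul_one, ev_prod_p] at h
  have hw : ∀ q : EquivariantMap σ ρ, orbWeight (p 1 : SymFun k) q.1 q.2 =
      if Function.Bijective q.1 then 1 else 0 := fun q => by
    have hb : Function.Bijective q.1 ↔ ∀ O, expWt (fibExp q.1 q.2 O) = 1 := by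
      constructor
      · intro hb O
        obtain ⟨b, rfl⟩ := mk_surjective ρ O
        rw [expWt_fibExp, Nat.card_eq_one_iff_exists]
        obtain ⟨x, hx⟩ := hb.2 b
        exact ⟨⟨x, hx⟩, fun y => Subtype.ext (hb.1 (y.2.trans hx.symm))⟩
      · intro hO
        have hc : ∀ b, ∃ x : {x // q.1 x = b}, ∀ y, y = x := fun b => by
          rw [← Nat.card_eq_one_iff_exists, ← expWt_fibExp q.1 q.2]
          exact hO _
        refine ⟨fun x y hxy => ?_, fun b => (hc b).imp' Subtype.val fun x _ => x.2⟩
        obtain ⟨z, hz⟩ := hc (q.1 y)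
        exact congrArg Subtype.val ((hz ⟨x, hxy⟩).trans (hz ⟨y, rfl⟩).symm)
    rw [orbWeight]
    split_ifs with hq
    · exact Finset.prod_eq_one fun O _ => by rw [ev_p_one_of_expWt, if_pos (hb.1 hq O)]
    · rw [hb] at hq
      push Not at hq
      obtain ⟨O, hO⟩ := hq
      exact Finset.prod_eq_zero (Finset.mem_univ O) (by rw [ev_p_one_of_expWt, if_neg hO])
  rw [Finset.sum_congr rfl fun q _ => hw q, Finset.sum_boole] at h
  have e : {g : α ≃ β // ∀ x, g (σ x) = ρ (g x)} ≃
      {q : EquivariantMap σ ρ // Function.Bijective q.1} :=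
    ⟨fun g => ⟨⟨g.1, g.2⟩, g.1.bijective⟩, fun q => ⟨Equiv.ofBijective _ q.2, q.1.2⟩,
      fun g => Subtype.ext (Equiv.ext fun x => rfl), fun q => rfl⟩
  have h' : (Nat.card {g : α ≃ β // ∀ x, g (σ x) = ρ (g x)} : k) =
      if cycExp σ = cycExp ρ then (zee (cycExp σ) : k) else 0 := by
    rw [h, Nat.card_congr e, Nat.card_eq_fintype_card, Fintype.card_subtype]
  split_ifs at h' ⊢ <;> exact_mod_cast h'

/-- Each g intertwines σ with exactly one ρ, namely gσg⁻¹. -/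
theorem sum_card_equivariant {N : ℕ} (σ : Equiv.Perm (Fin N)) :
    ∑ ρ : Equiv.Perm (Fin N),
      Nat.card {g : Equiv.Perm (Fin N) // ∀ x, g (σ x) = ρ (g x)} = N.factorial := by
  rw [← Nat.card_sigma]
  have e : (Σ ρ : Equiv.Perm (Fin N),
      {g : Equiv.Perm (Fin N) // ∀ x, g (σ x) = ρ (g x)}) ≃
        Equiv.Perm (Fin N) :=
    ⟨fun x => x.2.1, fun g => ⟨g * σ * g⁻¹, g, fun x => by simp⟩, fun ⟨ρ, g, hg⟩ => by
      have : g * σ * g⁻¹ = ρ := by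
        ext x
        simp [hg]
      subst this
      rfl, fun g => rfl⟩
  rw [Nat.card_congr e, Nat.card_eq_fintype_card, Fintype.card_perm, Fintype.card_fin]

/-- In the preceding sum each ρ with the cycle type of σ contributes `zee d` and every other ρ
contributes nothing. -/
theorem card_perm_cycExp (d : ℕ+ →₀ ℕ) (n : ℕ) (hd : expWt d = n) :
    Nat.card {σ : Equiv.Perm (Fin n) // cycExp σ = d} * zee d = n.factorial := by
  classical
  subst hd
  obtain ⟨σ, hσ⟩ := exists_cycExp_eq d
  have h1 := sum_card_equivariant σ
  simp only [card_equivariant_equiv (k := ℚ), Finset.sum_ite, Finset.sum_const_zero, add_zero,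
    Finset.sum_const, hσ] at h1
  rw [← h1, Nat.card_eq_fintype_card, Fintype.card_subtype, smul_eq_mul]
  simp only [eq_comm]

/-- Averages over the symmetric group as sums over cycle exponents. -/
theorem sum_perm_eq [CharZero k] (n : ℕ) (F : (ℕ+ →₀ ℕ) → k) :
    (n.factorial : k)⁻¹ * ∑ σ : Equiv.Perm (Fin n), F (cycExp σ) =
      ∑ᶠ d : {d : ℕ+ →₀ ℕ // expWt d = n}, (zee d.1 : k)⁻¹ * F d.1 := by
  classical
  have hs : ∀ σ : Equiv.Perm (Fin n), expWt (cycExp σ) = n := fun σ => by simp [expWt_cycExp]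
  let c : Equiv.Perm (Fin n) → {d : ℕ+ →₀ ℕ // expWt d = n} := fun σ => ⟨cycExp σ, hs σ⟩
  have hsurj : Function.Surjective c := by
    rintro ⟨d, rfl⟩
    obtain ⟨σ, hσ⟩ := exists_cycExp_eq d
    exact ⟨σ, Subtype.ext hσ⟩
  have : Finite {d : ℕ+ →₀ ℕ // expWt d = n} := Finite.of_surjective c hsurj
  have := Fintype.ofFinite {d : ℕ+ →₀ ℕ // expWt d = n}
  rw [finsum_eq_sum_of_fintype, ← Finset.sum_fiberwise Finset.univ c, Finset.mul_sum]
  refine Finset.sum_congr rfl fun d _ => ?_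
  have h1 : ∀ σ ∈ Finset.univ.filter (fun σ => c σ = d), F (cycExp σ) = F d.1 := fun σ hσ => by
    rw [← (Finset.mem_filter.1 hσ).2]
  have h2 := card_perm_cycExp d.1 n d.2
  rw [Finset.sum_congr rfl h1, Finset.sum_const, nsmul_eq_mul, ← h2, ← Fintype.card_subtype,
    ← Nat.card_eq_fintype_card]
  have h3 : Nat.card {σ // c σ = d} = Nat.card {σ : Equiv.Perm (Fin n) // cycExp σ = d.1} :=
    Nat.card_congr (Equiv.subtypeEquivRight fun σ => Subtype.ext_iff)
  have h4 : (Nat.card {σ : Equiv.Perm (Fin n) // cycExp σ = d.1} : k) ≠ 0 := by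
    intro h0
    rw [Nat.cast_eq_zero.1 h0, zero_mul] at h2
    exact (Nat.factorial_pos n).ne h2
  have h5 : (zee d.1 : k) ≠ 0 := Nat.cast_ne_zero.2 (zee_pos _).ne'
  rw [h3]
  push_cast
  field_simp

theorem ext_perm [CharZero k] {f g : SymFun k}
    (h : ∀ (N : ℕ) (σ : Equiv.Perm (Fin N)), ev f (cycExp σ) = ev g (cycExp σ)) : f = g :=
  ext_ev fun d => by
    obtain ⟨σ, hσ⟩ := exists_cycExp_eq d
    rw [← hσ, h]

/-! ### Plethysm -/

theorem constantCoeff_adams (n : ℕ+) (f : SymFun k) :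
    constantCoeff (adams n f) = constantCoeff f := by
  have := coeff_adams n f 0
  simpa using this

theorem hasSubst_adams {g : SymFun k} (hg : constantCoeff g = 0) :
    HasSubst (fun n : ℕ+ => adams n g) where
  const_coeff n := by simp [constantCoeff_adams, hg]
  coeff_zero d := by
    by_cases hd : d = 0
    · subst hd
      simp [constantCoeff_adams, hg]
    -- If p_m occurs in the monomial d, then only the finitely many divisors n of m allow d to occur
    -- in p_n ∘ g.
    · obtain ⟨m, hm⟩ := Finsupp.ne_iff.1 hd
      refine Set.Finite.subset (Set.finite_Iic m) fun n hn => ?_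
      by_contra hnm
      exact hn (coeff_adams_eq_zero n g d m (fun h => hnm (PNat.le_of_dvd h)) hm)

/-- The coefficients of f are grouped by weight n, and each weight is turned into an average over
𝕊_n. Weights n > |α| drop out: as g has no constant term only surjections α → Fin n count, and there
are none. -/
theorem ev_plethysm [CharZero k] {f g : SymFun k} (hg : constantCoeff g = 0) (σ : Equiv.Perm α) :
    ev (plethysm f g) (cycExp σ) = ∑ n ∈ Finset.range (Nat.card α + 1), (n.factorial : k)⁻¹ *
      ∑ ρ : Equiv.Perm (Fin n), ev f (cycExp ρ) *
        ∑ q : EquivariantMap σ ρ, orbWeight g q.1 q.2 := by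
  classical
  let G : (ℕ+ →₀ ℕ) → k := fun e => ev (e.prod fun n a => adams n g ^ a) (cycExp σ)
  have hG : ∀ (n : ℕ) (ρ : Equiv.Perm (Fin n)), G (cycExp ρ) =
      ∑ q : EquivariantMap σ ρ, orbWeight g q.1 q.2 := fun n ρ => by
    rw [← ev_prod_adams, ← prod_eq_adams_prod ρ fun n => adams n g]
  have hG0 : ∀ e, Nat.card α < expWt e → G e = 0 := fun e he => by
    obtain ⟨ρ, hρ⟩ := exists_cycExp_eq e
    rw [← hρ, hG]
    refine Finset.sum_eq_zero fun q _ => orbWeight_eq_zero hg _ _ fun hq => ?_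
    have := Nat.card_le_card_of_surjective _ hq
    rw [Nat.card_fin] at this
    omega
  have hfin : ∀ n, Finite {d : ℕ+ →₀ ℕ // expWt d = n} := fun n => by
    refine Finite.of_surjective (fun σ : Equiv.Perm (Fin n) =>
      (⟨cycExp σ, by simp [expWt_cycExp]⟩ : {d : ℕ+ →₀ ℕ // expWt d = n})) ?_
    rintro ⟨d, rfl⟩
    obtain ⟨σ, hσ⟩ := exists_cycExp_eq d
    exact ⟨σ, Subtype.ext hσ⟩
  have h1 : ∀ n : ℕ, (n.factorial : k)⁻¹ * ∑ ρ : Equiv.Perm (Fin n), ev f (cycExp ρ) *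
      ∑ q : EquivariantMap σ ρ, orbWeight g q.1 q.2 =
        ∑ᶠ d : {d : ℕ+ →₀ ℕ // expWt d = n}, coeff d.1 f * G d.1 := fun n => by
    simp only [← hG]
    rw [sum_perm_eq n fun d => ev f d * G d]
    refine finsum_congr fun d => ?_
    have h5 : (zee d.1 : k) ≠ 0 := Nat.cast_ne_zero.2 (zee_pos _).ne'
    rw [ev]
    field_simp
  simp only [h1]
  have hset : ∀ n, {d : ℕ+ →₀ ℕ | expWt d = n}.Finite := fun n => hfin n
  rw [ev, plethysm, coeff_subst (hasSubst_adams hg), ← smul_eq_mul, smul_finsum]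
  have h2 : ∀ d : ℕ+ →₀ ℕ, (zee (cycExp σ) : k) •
      (coeff d f • coeff (cycExp σ) (d.prod fun s e => adams s g ^ e)) = coeff d f * G d := by
    intro d
    simp only [G, ev, smul_eq_mul]
    ring
  simp only [h2]
  rw [finsum_eq_sum_of_support_subset (s := (Finset.range (Nat.card α + 1)).biUnion
    fun n => (hset n).toFinset), Finset.sum_biUnion]
  · refine Finset.sum_congr rfl fun n _ => ?_
    rw [← finsum_mem_eq_finite_toFinset_sum _ (hset n)]
    exact (finsum_set_coe_eq_finsum_mem (f := fun d => coeff d f * G d)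
      {d : ℕ+ →₀ ℕ | expWt d = n}).symm
  · intro a _ b _ hab
    rw [Function.onFun, Finset.disjoint_left]
    intro d hd hd'
    simp at hd hd'
    exact hab (hd.symm.trans hd')
  · intro d hd
    have : expWt d ≤ Nat.card α := by
      by_contra h
      exact hd (by simp [hG0 d (not_le.1 h)])
    simp
    omega

end SymFun

/-! ### Cycle indices and characteristics -/

open Orb Finsupp MvPowerSeries in
-- The partition of σ lists the nontrivial cycles and then a part 1 for each fixed point; the orbits
-- are split in the same way.
theorem cycExp_eq_parts {N : ℕ} (σ : Equiv.Perm (Fin N)) :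
    cycExp σ = (σ.partition.parts.map fun a => (single a.toPNat' 1 : ℕ+ →₀ ℕ)).sum := by
  classical
  rw [Equiv.Perm.parts_partition, Multiset.map_add, Multiset.sum_add, Multiset.map_replicate,
    Multiset.sum_replicate, Equiv.Perm.cycleType_def, Multiset.map_map, cycExp,
    ← Finset.sum_filter_add_sum_filter_not _ (fun O : Orb σ => σ O.out ≠ O.out)]
  have hlen : ∀ O : Orb σ, σ O.out ≠ O.out → (O.len : ℕ) = (σ.cycleOf O.out).support.card :=
    fun O hO => by
      rw [← card_fiber, Nat.card_eq_fintype_card, Fintype.card_subtype]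
      congr 1
      ext y
      rw [Equiv.Perm.mem_support_cycleOf_iff' hO, Finset.mem_filter, ← mk_eq, mk_out, eq_comm]
      simp
  congr 1
  · change _ = ∑ c ∈ σ.cycleFactorsFinset, (single c.support.card.toPNat' 1 : ℕ+ →₀ ℕ)
    refine Finset.sum_bij (fun O _ => σ.cycleOf O.out) ?_ ?_ ?_ ?_
    · intro O hO
      rw [Equiv.Perm.cycleOf_mem_cycleFactorsFinset_iff, Equiv.Perm.mem_support]
      exact (Finset.mem_filter.1 hO).2
    · intro O hO O' hO' h
      have h1 := (Equiv.Perm.sameCycle_iff_cycleOf_eq_of_mem_support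
        (Equiv.Perm.mem_support.2 (Finset.mem_filter.1 hO).2)
        (Equiv.Perm.mem_support.2 (Finset.mem_filter.1 hO').2)).2 h
      rw [← mk_out O, ← mk_out O']
      exact mk_eq.2 h1
    · intro c hc
      obtain ⟨a, ha⟩ := ((Equiv.Perm.mem_cycleFactorsFinset_iff.1 hc).1).nonempty_support
      have hca := Equiv.Perm.cycle_is_cycleOf ha hc
      have has : σ.SameCycle (mk σ a).out a := mk_eq.1 (mk_out _)
      refine ⟨mk σ a, ?_, by rw [hca, has.cycleOf_eq]⟩
      rw [Finset.mem_filter, ne_eq, has.apply_eq_self_iff]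
      refine ⟨Finset.mem_univ _, ?_⟩
      rw [hca] at ha
      exact Equiv.Perm.mem_support.1 (Equiv.Perm.support_cycleOf_le σ a ha)
    · intro O hO
      rw [← hlen O (Finset.mem_filter.1 hO).2, PNat.coe_toPNat']
  · have h1 : ∀ O ∈ Finset.univ.filter (fun O : Orb σ => ¬ σ O.out ≠ O.out),
        (single O.len 1 : ℕ+ →₀ ℕ) = single 1 1 := fun O hO => by
      have h := not_not.1 (Finset.mem_filter.1 hO).2
      have h2 : (σ ^ 1) O.out = O.out := by rw [pow_one, h]
      rw [pow_apply_eq_self_iff, mk_out, Nat.dvd_one, PNat.coe_eq_one_iff] at h2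
      rw [h2]
    rw [Finset.sum_congr rfl h1, Finset.sum_const, ← Finset.card_compl]
    congr 1
    refine Finset.card_bij (fun O _ => O.out) ?_ ?_ ?_
    · intro O hO
      rw [Finset.mem_compl, Equiv.Perm.mem_support]
      exact (Finset.mem_filter.1 hO).2
    · intro O _ O' _ h
      rw [← mk_out O, h, mk_out]
    · intro x hx
      rw [Finset.mem_compl, Equiv.Perm.mem_support, not_not] at hx
      have has : σ.SameCycle x (mk σ x).out := (mk_eq.1 (mk_out _)).symm
      refine ⟨mk σ x, ?_, (has.eq_of_left hx).symm⟩
      rw [Finset.mem_filter, not_not, ← has.apply_eq_self_iff]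
      exact ⟨Finset.mem_univ _, hx⟩

open MvPowerSeries in
theorem cycleIndex_eq (k : Type u) [Field k] {N : ℕ} (σ : Equiv.Perm (Fin N)) :
    cycleIndex k σ = monomial (cycExp σ) 1 := by
  rw [cycleIndex, cycExp_eq_parts]
  induction σ.partition.parts using Multiset.induction_on with
  | empty => simp
  | cons a s ih =>
    rw [Multiset.map_cons, Multiset.prod_cons, ih, Multiset.map_cons, Multiset.sum_cons, SymFun.p,
      X_def, monomial_mul_monomial, one_mul]

section

open Orb Finsupp MvPowerSeries SymFun

variable {k : Type u} [Field k] 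

theorem exists_conj_of_cycExp_eq {N : ℕ} {σ τ : Equiv.Perm (Fin N)} (h : cycExp σ = cycExp τ) :
    ∃ g : Equiv.Perm (Fin N), g * σ * g⁻¹ = τ := by
  have h1 := card_equivariant_equiv (k := ℚ) σ τ
  rw [if_pos h] at h1
  have h2 : 0 < Nat.card {g : Fin N ≃ Fin N // ∀ x, g (σ x) = τ (g x)} := h1 ▸ zee_pos _
  obtain ⟨g⟩ := (Nat.card_pos_iff.1 h2).1
  refine ⟨g.1, Equiv.ext fun x => ?_⟩
  rw [Equiv.Perm.mul_apply, Equiv.Perm.mul_apply, g.2]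
  exact congrArg τ (g.1.apply_symm_apply x)

theorem ev_chRep_of_ne {N : ℕ} {W : Type v} [AddCommGroup W] [Module k W]
    (ρ : Representation k (Equiv.Perm (Fin N)) W) (d : ℕ+ →₀ ℕ) (hd : expWt d ≠ N) :
    coeff d (chRep ρ) = 0 := by
  classical
  rw [chRep, coeff_C_mul, map_sum, Finset.sum_eq_zero, mul_zero]
  intro σ _
  rw [coeff_C_mul, cycleIndex_eq, coeff_monomial_ne, mul_zero]
  rintro rfl
  simp [expWt_cycExp] at hd

/-- The trace is constant on the conjugacy class of σ, which has N! / `zee` elements. -/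
theorem ev_chRep [CharZero k] {N : ℕ} {W : Type v} [AddCommGroup W] [Module k W]
    (ρ : Representation k (Equiv.Perm (Fin N)) W) (σ : Equiv.Perm (Fin N)) :
    ev (chRep ρ) (cycExp σ) = LinearMap.trace k W (ρ σ) := by
  classical
  have h1 : ∀ τ : Equiv.Perm (Fin N), cycExp τ = cycExp σ →
      LinearMap.trace k W (ρ τ) = LinearMap.trace k W (ρ σ) := fun τ h => by
    obtain ⟨g, rfl⟩ := exists_conj_of_cycExp_eq h
    rw [map_mul, LinearMap.trace_mul_comm, ← map_mul, inv_mul_cancel_left]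
  rw [chRep, ev_C_mul, ev_sum]
  have h2 : ∀ τ : Equiv.Perm (Fin N), ev (C (LinearMap.trace k W (ρ τ)) * cycleIndex k τ)
      (cycExp σ) = if cycExp τ = cycExp σ then
        LinearMap.trace k W (ρ σ) * zee (cycExp σ) else 0 := fun τ => by
    rw [ev_C_mul, cycleIndex_eq, ev, coeff_monomial]
    split_ifs with h h' h'
    · rw [h1 τ h.symm, mul_one]
    · exact absurd h.symm h'
    · exact absurd h'.symm h
    · simp
  have h3 := card_perm_cycExp (cycExp σ) N (by simp [expWt_cycExp])
  rw [Finset.sum_congr rfl fun τ _ => h2 τ, Finset.sum_ite, Finset.sum_const_zero, add_zero,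
    Finset.sum_const, nsmul_eq_mul, ← Fintype.card_subtype, ← Nat.card_eq_fintype_card, ← h3]
  have h4 := Nat.factorial_pos N
  rw [← h3] at h4
  have h5 : (Nat.card {τ : Equiv.Perm (Fin N) // cycExp τ = cycExp σ} : k) ≠ 0 :=
    Nat.cast_ne_zero.2 (Nat.pos_of_mul_pos_right h4).ne'
  have h6 : (zee (cycExp σ) : k) ≠ 0 := Nat.cast_ne_zero.2 (zee_pos _).ne'
  push_cast
  field_simp

end

/-! ### Finite-dimensional graded vector spaces -/

theorem directSum_finite_iff {k : Type u} [Field k] {ι : Type*} (M : ι → Type v)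
    [∀ i, AddCommGroup (M i)] [∀ i, Module k (M i)] :
    Module.Finite k (⨁ i, M i) ↔
      (∀ i, Module.Finite k (M i)) ∧ {i | ¬ Subsingleton (M i)}.Finite := by
  classical
  constructor
  · intro h
    refine ⟨fun i => Module.Finite.of_surjective (DirectSum.component k ι M i) fun x =>
      ⟨DirectSum.lof k ι M i x, DirectSum.component.lof_self k i x⟩, ?_⟩
    obtain ⟨S, hS⟩ := h.fg_top
    refine (S.biUnion fun x => x.support).finite_toSet.subset fun i hi => ?_
    by_contra hiS
    refine hi ⟨fun a b => ?_⟩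
    have : ∀ x : ⨁ i, M i, DirectSum.component k ι M i x = 0 := fun x => by
      have hx : x ∈ Submodule.span k (S : Set (⨁ i, M i)) := hS ▸ Submodule.mem_top
      induction hx using Submodule.span_induction with
      | mem y hy =>
        by_contra hne
        exact hiS (Finset.mem_coe.2 (Finset.mem_biUnion.2 ⟨y, hy, DFinsupp.mem_support_iff.2 hne⟩))
      | zero => simp
      | add y z _ _ hy hz => rw [map_add, hy, hz, add_zero]
      | smul c y _ hy => rw [map_smul, hy, smul_zero]
    have hz : ∀ a : M i, a = 0 := fun a => by
      rw [← this (DirectSum.lof k ι M i a), DirectSum.component.lof_self]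
    rw [hz a, hz b]
  · rintro ⟨h1, h2⟩
    let b := fun i => Module.finBasis k (M i)
    have : Finite (Σ i, Fin (Module.finrank k (M i))) := by
      have := h2.to_subtype
      refine Finite.of_injective (β := Σ i : {i | ¬ Subsingleton (M i)}, Fin (Module.finrank k (M i)))
        (fun x => ⟨⟨x.1, fun hs => ?_⟩, x.2⟩) ?_
      · have := Module.finrank_zero_of_subsingleton (R := k) (M := M x.1)
        exact absurd x.2.2 (by omega)
      · rintro ⟨i, x⟩ ⟨j, y⟩ h
        simp only [Sigma.mk.injEq, Subtype.mk.injEq] at h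
        obtain ⟨rfl, h⟩ := h
        exact congrArg _ (eq_of_heq h)
    exact Module.Finite.of_basis (DFinsupp.basis b)

/-! ### Characteristics as supertraces. -/

namespace CyclicSMod

open Orb Finsupp MvPowerSeries SymFun

variable {k : Type u} [Field k] {V : CyclicSMod.{u, v} k}

theorem FiniteDim.finite (hV : V.FiniteDim) (n : ℕ) (i : ℤ) : Module.Finite k (V.X n i) :=
  ((directSum_finite_iff _).1 (hV n)).1 i

theorem FiniteDim.finite_support (hV : V.FiniteDim) (n : ℕ) :
    {i | ¬ Subsingleton (V.X n i)}.Finite :=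
  ((directSum_finite_iff _).1 (hV n)).2

/-- The supertrace of a permutation on the component `V(n)`. -/
def strace (V : CyclicSMod.{u, v} k) (n : ℕ) (σ : Equiv.Perm (Fin (n + 1))) : k :=
  ∑ᶠ i : ℤ, ((i.negOnePow : ℤ) : k) * LinearMap.trace k _ (V.ρ n i σ)

theorem coeff_chComponent (hV : V.FiniteDim) (n : ℕ) (d : ℕ+ →₀ ℕ) :
    coeff d (V.chComponent n) = ∑ᶠ i : ℤ, ((i.negOnePow : ℤ) : k) * coeff d (chRep (V.ρ n i)) := by
  rw [chComponent, map_finsum]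
  · exact finsum_congr fun i => by rw [map_zsmul, zsmul_eq_mul]
  · refine (hV.finite_support n).subset fun i hi hs => hi ?_
    have : ∀ σ, LinearMap.trace k _ (V.ρ n i σ) = 0 := fun σ => by
      rw [Subsingleton.elim (V.ρ n i σ) 0, map_zero]
    simp [chRep, this]

theorem coeff_Ch (V : CyclicSMod.{u, v} k) (d : ℕ+ →₀ ℕ) :
    coeff d V.Ch = ∑ᶠ n : ℕ, coeff d (V.chComponent n) := rfl

theorem coeff_chComponent_eq_zero (hV : V.FiniteDim) (n : ℕ) (d : ℕ+ →₀ ℕ) (hd : expWt d ≠ n + 1) :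
    coeff d (V.chComponent n) = 0 := by
  rw [coeff_chComponent hV]
  exact finsum_eq_zero_of_forall_eq_zero fun i => by rw [ev_chRep_of_ne _ d hd, mul_zero]

/-- Only the component whose weight n + 1 is that of σ contributes to this coefficient. -/
theorem ev_Ch [CharZero k] (hV : V.FiniteDim) (n : ℕ) (σ : Equiv.Perm (Fin (n + 1))) :
    ev V.Ch (cycExp σ) = V.strace n σ := by
  have hσ : expWt (cycExp σ) = n + 1 := by simp [expWt_cycExp]
  rw [ev, coeff_Ch, finsum_eq_single _ n, coeff_chComponent hV, ← smul_eq_mul, smul_finsum]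
  · refine finsum_congr fun i => ?_
    rw [← ev_chRep, ev, smul_eq_mul]
    ring
  · intro m hm
    exact coeff_chComponent_eq_zero hV m _ (by omega)

theorem constantCoeff_Ch (hV : V.FiniteDim) : constantCoeff V.Ch = 0 := by
  rw [← coeff_zero_eq_constantCoeff_apply, coeff_Ch]
  exact finsum_eq_zero_of_forall_eq_zero fun n => coeff_chComponent_eq_zero hV n 0 (by simp)

/-- The coefficients of `Ch` of weight at most two vanish if `V((n)) = 0` for `n ≤ 2`. -/
theorem coeff_Ch_eq_zero (hV : V.FiniteDim) (h2 : V.VanishesLETwo) (d : ℕ+ →₀ ℕ) (hd : expWt d ≤ 2) :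
    coeff d V.Ch = 0 := by
  rw [coeff_Ch]
  refine finsum_eq_zero_of_forall_eq_zero fun n => ?_
  by_cases hn : expWt d = n + 1
  · rw [coeff_chComponent hV]
    refine finsum_eq_zero_of_forall_eq_zero fun i => ?_
    have := h2 n (by omega) i
    have : ∀ σ, LinearMap.trace k _ (V.ρ n i σ) = 0 := fun σ => by
      rw [Subsingleton.elim (V.ρ n i σ) 0, map_zero]
    simp [chRep, this]
  · exact coeff_chComponent_eq_zero hV n d hn

end CyclicSMod

/-! ### Uniqueness of Legendre transforms -/

namespace SymFun

open Orb Finsupp MvPowerSeries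

variable {k : Type u} [Field k] 

theorem orbWeight_eq_one {α β : Type*} [Finite α] [Finite β] {σ : Equiv.Perm α} {ρ : Equiv.Perm β}
    {f : SymFun k} (hf : ev f (single 1 1) = 1) (q : α → β) (h : ∀ x, q (σ x) = ρ (q x))
    (hq : Function.Bijective q) : orbWeight f q h = 1 := by
  refine Finset.prod_eq_one fun O _ => ?_
  obtain ⟨b, rfl⟩ := mk_surjective ρ O
  suffices h1 : expWt (fibExp q h (mk ρ b)) = 1 by rw [eq_single_of_expWt_eq_one h1, hf]
  rw [expWt_fibExp, Nat.card_eq_one_iff_exists]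
  obtain ⟨x, hx⟩ := hq.2 b
  exact ⟨⟨x, hx⟩, fun y => Subtype.ext (hq.1 (y.2.trans hx.symm))⟩

/-- Plethysm with a series `g = p₁ + ⋯` is injective. -/
theorem plethysm_injective [CharZero k] {g : SymFun k} (hg : constantCoeff g = 0)
    (hg1 : ev g (single 1 1) = 1) {f f' : SymFun k} (h : plethysm f g = plethysm f' g) :
    f = f' := by
  classical
  rw [← sub_eq_zero]
  have h0 : plethysm (f - f') g = 0 := by
    rw [plethysm, subst_sub (hasSubst_adams hg)]
    exact sub_eq_zero.2 h
  refine ext_perm fun N => ?_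
  induction N using Nat.strong_induction_on with
  | _ N ih =>
  intro σ
  have h1 := ev_plethysm (f := f - f') hg σ
  -- By induction only the term n = N survives. There the maps of nonzero weight are the bijections,
  -- of weight 1, and they single out the permutations conjugate to σ.
  rw [h0, Nat.card_fin, Finset.sum_range_succ, Finset.sum_eq_zero, zero_add] at h1
  · have h2 : ∀ ρ : Equiv.Perm (Fin N), ev (f - f') (cycExp ρ) *
        ∑ q : EquivariantMap σ ρ, orbWeight g q.1 q.2 = ev (f - f') (cycExp σ) *
          Nat.card {g : Equiv.Perm (Fin N) // ∀ x, g (σ x) = ρ (g x)} := fun ρ => by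
      have hw : ∀ q : EquivariantMap σ ρ, orbWeight g q.1 q.2 =
          if Function.Bijective q.1 then 1 else 0 := fun q => by
        split_ifs with hq
        · exact orbWeight_eq_one hg1 _ _ hq
        · exact orbWeight_eq_zero hg _ _ fun hs => hq ⟨Finite.injective_iff_surjective.2 hs, hs⟩
      rw [Finset.sum_congr rfl fun q _ => hw q, Finset.sum_boole, ← Fintype.card_subtype,
        ← Nat.card_eq_fintype_card]
      have e : {g : Equiv.Perm (Fin N) // ∀ x, g (σ x) = ρ (g x)} ≃
          {q : EquivariantMap σ ρ // Function.Bijective q.1} :=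
        ⟨fun g => ⟨⟨g.1, g.2⟩, g.1.bijective⟩, fun q => ⟨Equiv.ofBijective _ q.2, q.1.2⟩,
          fun g => Subtype.ext (Equiv.ext fun x => rfl), fun q => rfl⟩
      rw [← Nat.card_congr e, card_equivariant_equiv (k := k)]
      split_ifs with hc
      · rw [hc]
      · simp
    rw [Finset.sum_congr rfl fun ρ _ => h2 ρ, ← Finset.mul_sum] at h1
    have h3 := sum_card_equivariant σ
    rw [← Nat.cast_sum, h3] at h1
    have h4 : (N.factorial : k) ≠ 0 := Nat.cast_ne_zero.2 (Nat.factorial_pos N).ne'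
    have h5 : ev (0 : SymFun k) (cycExp σ) = 0 := by simp [ev]
    rw [h5] at h1 ⊢
    field_simp at h1
    exact h1.symm
  · intro n hn
    rw [Finset.sum_eq_zero, mul_zero]
    intro ρ _
    rw [ih n (Finset.mem_range.1 hn)]
    simp [ev]

end SymFun

/-! ### The trace on the invariants -/

theorem trace_pi_eq {k : Type u} [Field k] {ι : Type*} [Fintype ι] [DecidableEq ι]
    (M : ι → Type v) [∀ i, AddCommGroup (M i)] [∀ i, Module k (M i)]
    [∀ i, Module.Finite k (M i)] (f : (∀ i, M i) →ₗ[k] ∀ i, M i) :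
    LinearMap.trace k _ f =
      ∑ i, LinearMap.trace k _ (LinearMap.proj i ∘ₗ f ∘ₗ LinearMap.single k M i) := by
  have h : f = ∑ i, (f ∘ₗ LinearMap.single k M i) ∘ₗ LinearMap.proj i := by
    refine LinearMap.ext fun φ => ?_
    rw [LinearMap.sum_apply]
    simp only [LinearMap.comp_apply, LinearMap.proj_apply, ← map_sum]
    congr 1
    exact (LinearMap.sum_single_apply M φ).symm
  conv_lhs => rw [h, map_sum]
  exact Finset.sum_congr rfl fun i _ => LinearMap.trace_comp_comm' _ _

/-! ### Size and relabelling of stable trees. -/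

namespace SimpleGraph

/-- A tree with legs all of whose vertices have valence at least three has at least as many legs as
vertices. -/
theorem card_add_two_le_of_stable {V E : Type*} [Finite V] [Finite E] (G : SimpleGraph V) (hG : G.IsTree)
    (leg : E → V) (h : ∀ x, 3 ≤ Nat.card ({y // G.Adj x y} ⊕ {e // leg e = x})) :
    Nat.card V + 2 ≤ Nat.card E := by
  classical
  have := Fintype.ofFinite V
  have := Fintype.ofFinite E
  have h1 : ∑ x : V, G.degree x = 2 * G.edgeFinset.card := G.sum_degrees_eq_twice_card_edges
  have h2 := hG.card_edgeFinset
  have h3 : ∑ x : V, Nat.card {e // leg e = x} = Nat.card E := by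
    rw [← Nat.card_sigma, Nat.card_congr (Equiv.sigmaFiberEquiv leg)]
  -- The valences add up to 2(|V| - 1) + |E|, since a tree has |V| - 1 edges, and each of them is at
  -- least 3.
  have h4 : ∑ x : V, 3 ≤ ∑ x : V, (G.degree x + Nat.card {e // leg e = x}) := by
    refine Finset.sum_le_sum fun x _ => (h x).trans_eq ?_
    rw [Nat.card_sum]
    congr 1
    rw [← G.card_neighborSet_eq_degree, Nat.card_eq_fintype_card]
    rfl
  rw [Finset.sum_add_distrib, h1, h3] at h4
  simp only [Finset.sum_const, Finset.card_univ, smul_eq_mul] at h4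
  rw [Nat.card_eq_fintype_card (α := V)]
  omega

end SimpleGraph

namespace LegTree

variable {n m : ℕ}

theorem ext {t t' : LegTree n m} (hg : t.graph = t'.graph) (hl : t.leg = t'.leg) : t = t' := by
  cases t
  cases t'
  cases hg
  cases hl
  rfl

/-- The bound is not sharp; it only serves to make `AllTrees` a finite index set containing every
tree. -/
theorem lt_of_tree (t : LegTree n m) : m < n + 2 := by
  have := t.graph.card_add_two_le_of_stable t.isTree t.leg t.stable
  simp only [Nat.card_fin] at this
  omega

instance : Finite (LegTree n m) :=
  Finite.of_injective (fun t => (t.graph, t.leg)) fun _ _ h =>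
    ext (congrArg Prod.fst h) (congrArg Prod.snd h)

instance : Fintype (LegTree n m) := Fintype.ofFinite _

/-- The tree `t` with the vertex `τ x` renamed `x`. -/
def relabel (τ : Equiv.Perm (Fin m)) (t : LegTree n m) : LegTree n m where
  graph := t.graph.comap τ
  isTree := (SimpleGraph.Iso.isTree_iff (SimpleGraph.Iso.comap τ t.graph)).2 t.isTree
  leg := τ.symm ∘ t.leg
  stable x := by
    refine (t.stable (τ x)).trans_eq (Nat.card_congr (Equiv.sumCongr ?_ ?_))
    · exact (Equiv.subtypeEquiv τ fun y => by simp).symm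
    · exact Equiv.subtypeEquivRight fun j => by simp [Equiv.symm_apply_eq]

theorem relabel_isIso (τ : Equiv.Perm (Fin m)) (t : LegTree n m) :
    IsIso τ (Equiv.refl _) (t.relabel τ) t :=
  ⟨fun _ _ => Iff.rfl, fun j => by simp [relabel]⟩

theorem IsIso.relabel_eq {τ τ' : Equiv.Perm (Fin m)} {t t' : LegTree n m}
    (h : IsIso τ' (Equiv.refl _) t t') : t'.relabel (τ.trans τ') = t.relabel τ := by
  refine ext ?_ ?_
  · ext x y
    exact h.adj _ _
  · funext j
    have := h.leg j
    simp only [Equiv.refl_apply] at this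
    simp [relabel, this]

/-- The labellings for which relabelling legs and vertices gives back t are the automorphisms of t
over σ. These index the diagonal blocks in the trace below. -/
theorem relabel_pull_eq_iff {τ : Equiv.Perm (Fin m)} {σ : Equiv.Perm (Fin (n + 1))}
    {t : LegTree n m} : (t.pull σ).relabel τ = t ↔ IsIso τ σ t t := by
  constructor
  · intro h
    have h1 := ((t.pull σ).relabel_isIso τ).trans (t.pull_isIso σ)
    rw [h] at h1
    exact h1
  · intro h
    refine ext ?_ ?_
    · ext x y
      exact h.adj _ _
    · funext j
      simp [relabel, pull, h.leg]

end LegTree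

/-! ### Representations of the groupoid of trees -/

/-- All trees with legs labelled by `{0, …, n}`. -/
abbrev AllTrees (n : ℕ) : Type := Σ m : Fin (n + 2), LegTree n m

/-- The tree `t` among all trees. -/
def LegTree.toAll {n m : ℕ} (t : LegTree n m) : AllTrees n := ⟨⟨m, t.lt_of_tree⟩, t⟩

/-- A functor from the groupoid of trees with `n + 1` legs to vector spaces. -/
structure TreeFunctor (k : Type u) [Field k] (n : ℕ) where
  X : ∀ m : ℕ, LegTree n m → Type v
  [addCommGroup : ∀ m t, AddCommGroup (X m t)]
  [module : ∀ m t, Module k (X m t)]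
  map : ∀ {m : ℕ} {τ : Equiv.Perm (Fin m)} {σ : Equiv.Perm (Fin (n + 1))} {t t' : LegTree n m},
    LegTree.IsIso τ σ t t' → (X m t →ₗ[k] X m t')
  map_trans : ∀ {m : ℕ} {τ τ' : Equiv.Perm (Fin m)} {σ σ' : Equiv.Perm (Fin (n + 1))}
    {t t' t'' : LegTree n m} (h : LegTree.IsIso τ σ t t') (h' : LegTree.IsIso τ' σ' t' t''),
    map (h.trans h') = map h' ∘ₗ map h

namespace TreeFunctor

attribute [instance] TreeFunctor.addCommGroup TreeFunctor.module

variable {k : Type u} [Field k] {n m : ℕ} (M : TreeFunctor.{u, v} k n)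

theorem map_congr {τ τ' : Equiv.Perm (Fin m)} {σ : Equiv.Perm (Fin (n + 1))}
    {t₁ t₂ t' : LegTree n m} (hτ : τ = τ') (ht : t₁ = t₂) (h₁ : LegTree.IsIso τ σ t₁ t')
    (h₂ : LegTree.IsIso τ' σ t₂ t') (Φ : ∀ t : LegTree n m, M.X m t) :
    M.map h₁ (Φ t₁) = M.map h₂ (Φ t₂) := by
  subst hτ ht
  rfl

theorem map_map {τ τ' : Equiv.Perm (Fin m)} {σ σ' : Equiv.Perm (Fin (n + 1))}
    {t t' t'' : LegTree n m} (h : LegTree.IsIso τ σ t t') (h' : LegTree.IsIso τ' σ' t' t'')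
    (a : M.X m t) : M.map h' (M.map h a) = M.map (h.trans h') a := by
  rw [map_trans]
  rfl

/-- The families of vectors which are compatible with the isomorphisms that fix the legs. -/
def sections : Submodule k (∀ (m : ℕ) (t : LegTree n m), M.X m t) where
  carrier := {Φ | ∀ (m : ℕ) (τ : Equiv.Perm (Fin m)) (t t' : LegTree n m)
    (h : LegTree.IsIso τ (Equiv.refl _) t t'), Φ m t' = M.map h (Φ m t)}
  add_mem' ha hb m τ t t' h := by simp [ha m τ t t' h, hb m τ t t' h]
  zero_mem' m τ t t' h := by simp
  smul_mem' c Φ hΦ m τ t t' h := by simp [hΦ m τ t t' h]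

/-- Restriction of a family indexed by all trees to the trees with a given number of vertices. -/
def restrictFamily (Φ : ∀ s : AllTrees n, M.X s.1 s.2) (m : ℕ) (t : LegTree n m) :
    M.X m t := Φ t.toAll

/-- The components of a section. -/
def incl : M.sections →ₗ[k] ∀ s : AllTrees n, M.X s.1 s.2 where
  toFun Φ s := Φ.1 s.1 s.2
  map_add' _ _ := rfl
  map_smul' _ _ := rfl

theorem incl_injective : Function.Injective M.incl := by
  intro Φ Ψ h
  refine Subtype.ext (funext fun m => funext fun t => ?_)
  exact congrFun h t.toAll

/-- A component of the average of a family over the vertex labellings. -/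
def avgComponent (t : LegTree n m) : (∀ s : AllTrees n, M.X s.1 s.2) →ₗ[k] M.X m t :=
  (m.factorial : k)⁻¹ • ∑ τ : Equiv.Perm (Fin m),
    M.map (t.relabel_isIso τ) ∘ₗ (LinearMap.proj (t.relabel τ).toAll)

theorem avgComponent_apply (t : LegTree n m) (Φ : ∀ s : AllTrees n, M.X s.1 s.2) :
    M.avgComponent t Φ = (m.factorial : k)⁻¹ • ∑ τ : Equiv.Perm (Fin m),
      M.map (t.relabel_isIso τ) (M.restrictFamily Φ m (t.relabel τ)) := by
  rw [avgComponent, LinearMap.smul_apply, LinearMap.sum_apply]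
  rfl

/-- The average of a family over the vertex labellings. -/
def avg : (∀ s : AllTrees n, M.X s.1 s.2) →ₗ[k] M.sections :=
  LinearMap.codRestrict M.sections
    (LinearMap.pi fun m => LinearMap.pi fun t : LegTree n m => M.avgComponent t) <| by
      intro Φ m τ' t t' h
      change M.avgComponent t' Φ = M.map h (M.avgComponent t Φ)
      rw [avgComponent_apply, avgComponent_apply, map_smul, map_sum]
      congr 1
      -- Relabelling t' by τ followed by τ' is relabelling t by τ, so the two averages run over the
      -- same trees.
      rw [← Equiv.sum_comp (Equiv.mulLeft τ')]
      refine Finset.sum_congr rfl fun τ _ => ?_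
      rw [map_map]
      exact M.map_congr rfl h.relabel_eq _ _ _

theorem avg_apply (t : LegTree n m) (Φ : ∀ s : AllTrees n, M.X s.1 s.2) :
    (M.avg Φ).1 m t = (m.factorial : k)⁻¹ • ∑ τ : Equiv.Perm (Fin m),
      M.map (t.relabel_isIso τ) (M.restrictFamily Φ m (t.relabel τ)) :=
  M.avgComponent_apply t Φ

/-- All terms of the average of a section coincide. The sections are thus a retract of the product
over all labelled trees, where traces can be computed block by block. -/
theorem avg_incl [CharZero k] (Φ : M.sections) : M.avg (M.incl Φ) = Φ := by
  refine Subtype.ext (funext fun m => funext fun t => ?_)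
  rw [avg_apply]
  have : ∀ τ : Equiv.Perm (Fin m), M.map (t.relabel_isIso τ)
      (M.restrictFamily (M.incl Φ) m (t.relabel τ)) = Φ.1 m t := fun τ => (Φ.2 m τ _ _ (t.relabel_isIso τ)).symm
  rw [Finset.sum_congr rfl fun τ _ => this τ, Finset.sum_const, Finset.card_univ,
    Fintype.card_perm, Fintype.card_fin, ← Nat.cast_smul_eq_nsmul k, smul_smul,
    inv_mul_cancel₀ (Nat.cast_ne_zero.2 (Nat.factorial_pos m).ne'), one_smul]

/-- Relabelling the legs in a family indexed by all trees. -/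
def act (σ : Equiv.Perm (Fin (n + 1))) :
    (∀ s : AllTrees n, M.X s.1 s.2) →ₗ[k] ∀ s : AllTrees n, M.X s.1 s.2 where
  toFun Φ s := M.map (s.2.pull_isIso σ) (Φ ⟨s.1, s.2.pull σ⟩)
  map_add' _ _ := funext fun s => map_add (M.map (s.2.pull_isIso σ)) _ _
  map_smul' _ _ := funext fun s => map_smul (M.map (s.2.pull_isIso σ)) _ _

open Classical in
/-- The trace of a relabelling of the legs on the space of sections. -/
theorem trace_sections [CharZero k] [∀ m t, Module.Finite k (M.X m t)]
    (σ : Equiv.Perm (Fin (n + 1))) (A : M.sections →ₗ[k] M.sections)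
    (hA : ∀ Φ m t, (A Φ).1 m t = M.map (t.pull_isIso σ) (Φ.1 m (t.pull σ))) :
    LinearMap.trace k _ A = ∑ s : AllTrees n, ((s.1 : ℕ).factorial : k)⁻¹ *
      ∑ τ : Equiv.Perm (Fin s.1), if h : LegTree.IsIso τ σ s.2 s.2 then
        LinearMap.trace k _ (M.map h) else 0 := by
  have : Module.Finite k M.sections := Module.Finite.of_injective _ M.incl_injective
  -- Cyclicity of the trace now moves the computation to the product over all trees.
  have h1 : A = M.avg ∘ₗ (M.act σ ∘ₗ M.incl) := by
    refine LinearMap.ext fun Φ => ?_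
    have : M.act σ (M.incl Φ) = M.incl (A Φ) := funext fun s => (hA Φ _ _).symm
    rw [LinearMap.comp_apply, LinearMap.comp_apply, this, avg_incl]
  rw [h1, LinearMap.trace_comp_comm', trace_pi_eq]
  refine Finset.sum_congr rfl fun s _ => ?_
  have h2 : LinearMap.proj s ∘ₗ ((M.act σ ∘ₗ M.incl) ∘ₗ M.avg) ∘ₗ
      LinearMap.single k (fun s : AllTrees n => M.X s.1 s.2) s = ((s.1 : ℕ).factorial : k)⁻¹ •
        ∑ τ : Equiv.Perm (Fin s.1), if h : LegTree.IsIso τ σ s.2 s.2 then M.map h else 0 := by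
    obtain ⟨⟨m, hm⟩, t⟩ := s
    refine LinearMap.ext fun v => ?_
    change M.map (t.pull_isIso σ) ((M.avg (Pi.single _ v)).1 m (t.pull σ)) = _
    rw [avg_apply, map_smul, map_sum, LinearMap.smul_apply, LinearMap.sum_apply]
    congr 1
    refine Finset.sum_congr rfl fun τ _ => ?_
    rw [map_map]
    -- A family supported at t contributes to the block of t only through the labellings that carry
    -- the relabelled tree back to t.
    have key : ∀ (t' : LegTree n m) (h' : LegTree.IsIso τ σ t' t),
        M.map h' (M.restrictFamily (Pi.single ⟨⟨m, hm⟩, t⟩ v) m t') =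
          (if h : t' = t then M.map (h ▸ h' : LegTree.IsIso τ σ t t) else 0) v := by
      intro t' h'
      split_ifs with h
      · subst h
        congr 1
        exact Pi.single_eq_same (M := fun s : AllTrees n => M.X s.1 s.2) _ v
      · have : M.restrictFamily (Pi.single ⟨⟨m, hm⟩, t⟩ v) m t' = 0 := by
          refine Pi.single_eq_of_ne (M := fun s : AllTrees n => M.X s.1 s.2) ?_ v
          intro he
          simp only [LegTree.toAll, Sigma.mk.injEq, heq_eq_eq, true_and] at he
          exact h he
        rw [this, map_zero]
        rfl
    refine (key _ _).trans ?_
    by_cases h : LegTree.IsIso τ σ t t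
    · rw [dif_pos h, dif_pos (LegTree.relabel_pull_eq_iff.2 h)]
    · rw [dif_neg h, dif_neg fun h' => h (LegTree.relabel_pull_eq_iff.1 h')]
  rw [h2, map_smul, map_sum, smul_eq_mul]
  congr 1
  refine Finset.sum_congr rfl fun τ _ => ?_
  split_ifs <;> simp

end TreeFunctor

/-- The vector spaces `V((t))`, as a functor on the groupoid of trees. -/
def CyclicSMod.treeFunctor {k : Type u} [Field k] (V : CyclicSMod.{u, v} k) (n : ℕ) (i : ℤ) :
    TreeFunctor.{u, max u v} k n where
  X _ t := V.onTree t i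
  addCommGroup _ _ := Module.addCommMonoidToAddCommGroup k
  module _ t := inferInstanceAs (Module k (V.onTree t i))
  map h := V.onTreeMap h i
  map_trans h h' := V.onTreeMap_trans h h' i

open Classical in
theorem CyclicSMod.trace_tree {k : Type u} [Field k] [CharZero k] (V : CyclicSMod.{u, v} k)
    (n : ℕ) (i : ℤ) (σ : Equiv.Perm (Fin (n + 1)))
    (hfin : ∀ (m : ℕ) (t : LegTree n m), Module.Finite k (V.onTree t i)) :
    LinearMap.trace k _ (V.tree.ρ n i σ) = ∑ s : AllTrees n, ((s.1 : ℕ).factorial : k)⁻¹ *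
      ∑ τ : Equiv.Perm (Fin s.1), if h : LegTree.IsIso τ σ s.2 s.2 then
        LinearMap.trace k _ (V.onTreeMap h i) else 0 := by
  have : ∀ m t, Module.Finite k ((V.treeFunctor n i).X m t) := hfin
  exact (V.treeFunctor n i).trace_sections σ (V.tree.ρ n i σ) fun _ _ _ => rfl

/-! ### The spaces attached to finite sets. -/

namespace CyclicSMod

variable {k : Type u} [Field k] (V : CyclicSMod.{u, v} k)

/-- The components of `V((I))`, for a choice of a bijection from `{0, …, n}` to `I`. -/
def onSetEquiv {I : Type} {n : ℕ} (f : Fin (n + 1) ≃ I) (i : ℤ) : V.onSet I i ≃ₗ[k] V.X n i where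
  toFun φ := φ.1 n f
  map_add' _ _ := rfl
  map_smul' _ _ := rfl
  -- The value 0 is never taken: an enumeration f' of I forces n' = n.
  invFun a := ⟨fun n' f' => if h : n = n' then
      h ▸ V.ρ n i (f.trans (h ▸ f').symm) a else 0, fun n' g f' => by
    have hn : n = n' := by simpa using Fintype.card_congr (f.trans f'.symm)
    subst hn
    change (if h : n = n then _ else _) = V.ρ n i g (if h : n = n then _ else _)
    rw [dif_pos rfl, dif_pos rfl, ← Module.End.mul_apply, ← map_mul]
    rfl⟩
  left_inv φ := by
    refine Subtype.ext (funext fun n' => funext fun f' => ?_)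
    have hn : n = n' := by simpa using Fintype.card_congr (f.trans f'.symm)
    subst hn
    change (if h : n = n then _ else _) = _
    rw [dif_pos rfl, ← φ.2]
    exact congrArg (φ.1 n) (Equiv.ext fun x => by simp)
  right_inv a := by
    change (if h : n = n then _ else _) = _
    rw [dif_pos rfl]
    have : f.trans f.symm = 1 := by
      ext x
      simp
    change V.ρ n i (f.trans f.symm) a = a
    rw [this, map_one]
    rfl

theorem onSetEquiv_onSetMap {I : Type} {n : ℕ} (f : Fin (n + 1) ≃ I) (b : I ≃ I) (i : ℤ)
    (φ : V.onSet I i) : V.onSetEquiv f i (V.onSetMap b i φ) =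
      V.ρ n i ((f.trans b).trans f.symm) (V.onSetEquiv f i φ) := by
  change φ.1 n (f.trans b.symm) = V.ρ n i _ (φ.1 n f)
  rw [← φ.2]
  exact congrArg (φ.1 n) (Equiv.ext fun x => by simp)

theorem trace_onSetMap {I : Type} {n : ℕ} (f : Fin (n + 1) ≃ I) (b : I ≃ I) (i : ℤ) :
    LinearMap.trace k _ (V.onSetMap b i) =
      LinearMap.trace k _ (V.ρ n i ((f.trans b).trans f.symm)) := by
  rw [← LinearMap.trace_conj' _ (V.onSetEquiv f i)]
  congr 1
  refine LinearMap.ext fun a => ?_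
  rw [LinearEquiv.conj_apply, LinearMap.comp_apply, LinearMap.comp_apply, LinearEquiv.coe_coe,
    onSetEquiv_onSetMap]
  simp

variable {V}

theorem exists_equiv_fin_succ (I : Type) [Finite I] [Nonempty I] : ∃ n, Nonempty (Fin (n + 1) ≃ I) := by
  obtain ⟨n, ⟨e⟩⟩ := Finite.exists_equiv_fin I
  obtain _ | n := n
  · exact isEmptyElim (e (Classical.arbitrary I))
  · exact ⟨n, ⟨e.symm⟩⟩

theorem FiniteDim.onSet (hV : V.FiniteDim) (I : Type) [Finite I] [Nonempty I] :
    Module.Finite k (⨁ i, V.onSet I i) := by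
  obtain ⟨n, ⟨f⟩⟩ := exists_equiv_fin_succ I
  rw [directSum_finite_iff]
  constructor
  · intro i
    have := hV.finite n i
    exact Module.Finite.equiv (V.onSetEquiv f i).symm
  · refine (hV.finite_support n).subset fun i hi hs => hi ?_
    exact (V.onSetEquiv f i).toEquiv.subsingleton

theorem finsum_trace_onSetMap [CharZero k] (hV : V.FiniteDim) {I : Type} [Finite I] [Nonempty I]
    (b : Equiv.Perm I) :
    ∑ᶠ i : ℤ, ((i.negOnePow : ℤ) : k) * LinearMap.trace k _ (V.onSetMap b i) =
      SymFun.ev V.Ch (cycExp b) := by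
  obtain ⟨n, ⟨f⟩⟩ := exists_equiv_fin_succ I
  rw [cycExp_congr (φ := b) (τ := ((f.trans b).trans f.symm : Equiv.Perm (Fin (n + 1)))) f.symm
    fun x => by simp, ev_Ch hV, strace]
  exact finsum_congr fun i => by rw [V.trace_onSetMap f]

end CyclicSMod

/-! ### Bases of direct sums -/

section DFinsuppBasis

variable {k : Type u} [Field k] {ι : Type*} {M : ι → Type*} [∀ i, AddCommMonoid (M i)]
  [∀ i, Module k (M i)] {η : ι → Type*}

theorem dfinsuppBasis_repr (b : ∀ i, Module.Basis (η i) k (M i)) (f : Π₀ i, M i) (a : Σ i, η i) :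
    (DFinsupp.basis b).repr f a = (b a.1).repr (f a.1) a.2 := rfl

theorem dfinsuppBasis_apply [DecidableEq ι] (b : ∀ i, Module.Basis (η i) k (M i)) (a : Σ i, η i) :
    DFinsupp.basis b a = DFinsupp.single a.1 (b a.1 a.2) := by
  classical
  refine (DFinsupp.basis b).repr.injective (Finsupp.ext fun c => ?_)
  rw [Module.Basis.repr_self, dfinsuppBasis_repr]
  obtain ⟨i, a⟩ := a
  obtain ⟨j, c⟩ := c
  by_cases h : i = j
  · subst h
    simp [Finsupp.single_apply]
  · rw [DFinsupp.single_eq_of_ne (Ne.symm h), map_zero, Finsupp.single_apply, if_neg]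
    · rfl
    · intro h'
      exact h (congrArg Sigma.fst h')

end DFinsuppBasis

theorem sum_eq_finsum_fiber {k : Type u} [Field k] {B ι : Type*} [Fintype B] (d : B → ι)
    [∀ i, Fintype {b // d b = i}] (F : B → k) :
    ∑ b, F b = ∑ᶠ i, ∑ b : {b // d b = i}, F b.1 := by
  classical
  have h : ∀ i, ∑ b : {b // d b = i}, F b.1 = ∑ b with d b = i, F b := fun i =>
    (Finset.sum_subtype _ (by simp) _).symm
  simp only [h]
  rw [finsum_eq_sum_of_support_subset (s := Finset.univ.image d)]
  · exact (Finset.sum_fiberwise_of_maps_to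
      (fun b _ => Finset.mem_image_of_mem _ (Finset.mem_univ b)) _).symm
  intro i hi
  by_contra hne
  refine hi (Finset.sum_eq_zero fun b hb => ?_)
  exact absurd (Finset.mem_image.2 ⟨b, Finset.mem_univ b, (Finset.mem_filter.1 hb).2⟩) hne

/-! ### Graded tensor products -/

section GradedTensor

variable {k : Type u} [Field k] {m : ℕ} (U : Fin m → ℤ → Type v)
  [∀ x j, AddCommMonoid (U x j)] [∀ x j, Module k (U x j)]

/-- The degree `i` part of a graded tensor product. -/
abbrev GradedTensor (k : Type u) [Field k] {m : ℕ} (U : Fin m → ℤ → Type v)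
    [∀ x j, AddCommMonoid (U x j)] [∀ x j, Module k (U x j)] (i : ℤ) : Type (max u v) :=
  ⨁ D : {D : Fin m → ℤ // ∑ x, D x = i}, ⨂[k] x, U x (D.1 x)

variable {U}

/-- The endomorphism of a graded tensor product which permutes the factors by `τ`, with the Koszul
sign, and applies the maps `g`. -/
def gradedTensorMap (τ : Equiv.Perm (Fin m)) (g : ∀ x j, U (τ.symm x) j →ₗ[k] U x j) (i : ℤ) :
    GradedTensor k U i →ₗ[k] GradedTensor k U i :=
  DirectSum.toModule k _ _ fun D =>
    DirectSum.lof k {D : Fin m → ℤ // ∑ x, D x = i} (fun D => ⨂[k] x, U x (D.1 x))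
        ⟨D.1 ∘ τ.symm, (Equiv.sum_comp τ.symm D.1).trans D.2⟩ ∘ₗ
      (((koszulSign D.1 τ : ℤ) : k) •
        (PiTensorProduct.map (fun x => g x (D.1 (τ.symm x))) ∘ₗ
          (PiTensorProduct.reindex k (fun x => U x (D.1 x)) τ).toLinearMap))

variable {κ : Fin m → ℤ → Type*} (b : ∀ x j, Module.Basis (κ x j) k (U x j))

/-- The basis of a graded tensor product given by homogeneous bases of the factors. -/
def gradedTensorBasis (i : ℤ) :
    Module.Basis {β : ∀ x, Σ j, κ x j // ∑ x, (β x).1 = i} k (GradedTensor k U i) :=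
  (DFinsupp.basis fun D : {D : Fin m → ℤ // ∑ x, D x = i} =>
    Basis.piTensorProduct fun x => b x (D.1 x)).reindex
      { toFun := fun s => ⟨fun x => ⟨s.1.1 x, s.2 x⟩, s.1.2⟩
        invFun := fun β => ⟨⟨fun x => (β.1 x).1, β.2⟩, fun x => (β.1 x).2⟩
        left_inv := fun _ => rfl
        right_inv := fun _ => rfl }

theorem gradedTensorBasis_apply (i : ℤ) (β : {β : ∀ x, Σ j, κ x j // ∑ x, (β x).1 = i}) :
    gradedTensorBasis b i β = DirectSum.lof k {D : Fin m → ℤ // ∑ x, D x = i}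
      (fun D => ⨂[k] x, U x (D.1 x)) ⟨fun x => (β.1 x).1, β.2⟩
        (PiTensorProduct.tprod k fun x => b x (β.1 x).1 (β.1 x).2) := by
  rw [gradedTensorBasis, Module.Basis.reindex_apply]
  refine (dfinsuppBasis_apply _ _).trans ?_
  rw [Basis.piTensorProduct_apply]
  rfl

/-- Each factor is expanded in the sum of all its degrees. A mismatch between the degrees of the
tensor and of the basis vector then shows up as a vanishing factor, and the formula needs no case
distinction. -/
theorem gradedTensorBasis_repr_lof_tprod (i : ℤ) (D : {D : Fin m → ℤ // ∑ x, D x = i})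
    (w : ∀ x, U x (D.1 x)) (β : {β : ∀ x, Σ j, κ x j // ∑ x, (β x).1 = i}) :
    (gradedTensorBasis b i).repr (DirectSum.lof k {D : Fin m → ℤ // ∑ x, D x = i}
      (fun D => ⨂[k] x, U x (D.1 x)) D (PiTensorProduct.tprod k w)) β =
        ∏ x, (DFinsupp.basis (b x)).repr (DFinsupp.single (D.1 x) (w x)) (β.1 x) := by
  rw [gradedTensorBasis, Module.Basis.repr_reindex_apply]
  simp only [dfinsuppBasis_repr]
  refine (dfinsuppBasis_repr _ _ _).trans ?_
  by_cases h : D = ⟨fun x => (β.1 x).1, β.2⟩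
  · obtain ⟨β, hβ⟩ := β
    subst h
    refine Eq.trans ?_ (Eq.trans (Basis.piTensorProduct_repr_tprod_apply
      (fun x => b x (β x).1) w fun x => (β x).2) ?_)
    · congr 1
      exact congrArg _ (DFinsupp.single_eq_same (β := fun D : {D : Fin m → ℤ // ∑ x, D x = i} =>
        ⨂[k] x, U x (D.1 x)))
    · refine Finset.prod_congr rfl fun x _ => ?_
      rw [DFinsupp.single_eq_same]
  · have h1 : ∃ x, D.1 x ≠ (β.1 x).1 := by
      by_contra hne
      push Not at hne
      exact h (Subtype.ext (funext hne))
    obtain ⟨x, hx⟩ := h1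
    rw [Finset.prod_eq_zero (Finset.mem_univ x)]
    · have : DirectSum.lof k {D : Fin m → ℤ // ∑ x, D x = i} (fun D => ⨂[k] x, U x (D.1 x)) D
          (PiTensorProduct.tprod k w) ⟨fun x => (β.1 x).1, β.2⟩ = 0 :=
        DFinsupp.single_eq_of_ne (Ne.symm h)
      refine Eq.trans (congrArg (fun z => (Basis.piTensorProduct
        fun x => b x (β.1 x).1).repr z fun x => (β.1 x).2) this) ?_
      rw [map_zero]
      rfl
    · rw [DFinsupp.single_eq_of_ne (Ne.symm hx), map_zero]
      rfl

/-- The entries of the matrix of a homogeneous map. -/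
def gradedEntry {A B : ℤ → Type v} [∀ j, AddCommMonoid (A j)] [∀ j, Module k (A j)]
    [∀ j, AddCommMonoid (B j)] [∀ j, Module k (B j)] {κA κB : ℤ → Type*}
    (a : ∀ j, Module.Basis (κA j) k (A j)) (b : ∀ j, Module.Basis (κB j) k (B j))
    (g : ∀ j, A j →ₗ[k] B j) (β' : Σ j, κB j) (β : Σ j, κA j) : k :=
  (DFinsupp.basis b).repr (DFinsupp.single β.1 (g β.1 (a β.1 β.2))) β'

theorem gradedTensorMap_entry (τ : Equiv.Perm (Fin m)) (g : ∀ x j, U (τ.symm x) j →ₗ[k] U x j)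
    (i : ℤ) (β : {β : ∀ x, Σ j, κ x j // ∑ x, (β x).1 = i}) :
    (gradedTensorBasis b i).repr (gradedTensorMap τ g i (gradedTensorBasis b i β)) β =
      ((koszulSign (fun x => (β.1 x).1) τ : ℤ) : k) *
        ∏ x, gradedEntry (b (τ.symm x)) (b x) (g x) (β.1 x) (β.1 (τ.symm x)) := by
  rw [gradedTensorBasis_apply, gradedTensorMap, DirectSum.toModule_lof, LinearMap.comp_apply,
    LinearMap.smul_apply, LinearMap.comp_apply, LinearEquiv.coe_coe, PiTensorProduct.reindex_tprod,
    PiTensorProduct.map_tprod, map_smul, map_smul, Finsupp.smul_apply, smul_eq_mul]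
  congr 1
  exact gradedTensorBasis_repr_lof_tprod b i ⟨fun x => (β.1 (τ.symm x)).1, _⟩ _ β

/-- The supertrace of a permutation of the factors of a graded tensor product. -/
theorem finsum_trace_gradedTensorMap [∀ x, Fintype (Σ j, κ x j)] (τ : Equiv.Perm (Fin m))
    (g : ∀ x j, U (τ.symm x) j →ₗ[k] U x j) :
    ∑ᶠ i : ℤ, ((i.negOnePow : ℤ) : k) * LinearMap.trace k _ (gradedTensorMap τ g i) =
      ∑ β : ∀ x, Σ j, κ x j, (((∑ x, (β x).1).negOnePow : ℤ) : k) *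
        (((koszulSign (fun x => (β x).1) τ : ℤ) : k) *
          ∏ x, gradedEntry (b (τ.symm x)) (b x) (g x) (β x) (β (τ.symm x))) := by
  classical
  rw [sum_eq_finsum_fiber fun β : ∀ x, Σ j, κ x j => ∑ x, (β x).1]
  refine finsum_congr fun i => ?_
  rw [LinearMap.trace_eq_matrix_trace k (gradedTensorBasis b i), Matrix.trace, Finset.mul_sum]
  refine Finset.sum_congr rfl fun β _ => ?_
  rw [Matrix.diag_apply, LinearMap.toMatrix_apply, gradedTensorMap_entry, β.2]

end GradedTensor

/-! ### Finite-dimensionality of the free cyclic operad. -/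

namespace CyclicSMod

variable {k : Type u} [Field k] {V : CyclicSMod.{u, v} k}

theorem nonempty_flags {n m : ℕ} (t : LegTree n m) (x : Fin m) : Nonempty (t.Flags x) := by
  exact (Nat.card_pos_iff.1 (lt_of_lt_of_le (by norm_num) (t.stable x))).1

/-- The index of a homogeneous basis of `V((Flags x))`. -/
abbrev FlagIndex (V : CyclicSMod.{u, v} k) {n m : ℕ} (t : LegTree n m) (x : Fin m) (j : ℤ) :=
  Module.Free.ChooseBasisIndex k (V.onSet (t.Flags x) j)

theorem FiniteDim.finite_flagIndex (hV : V.FiniteDim) {n m : ℕ} (t : LegTree n m) (x : Fin m) :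
    Finite (Σ j, V.FlagIndex t x j) := by
  have := nonempty_flags t x
  have : Module.Finite k (Π₀ j, V.onSet (t.Flags x) j) := hV.onSet (t.Flags x)
  exact Module.Finite.finite_basis
    (DFinsupp.basis fun j => Module.Free.chooseBasis k (V.onSet (t.Flags x) j))

theorem FiniteDim.onTree (hV : V.FiniteDim) {n m : ℕ} (t : LegTree n m) (i : ℤ) :
    Module.Finite k (V.onTree t i) := by
  have := hV.finite_flagIndex t
  exact Module.Finite.of_basis (gradedTensorBasis
    (fun x j => Module.Free.chooseBasis k (V.onSet (t.Flags x) j)) i)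

theorem FiniteDim.finite_support_onTree (hV : V.FiniteDim) {n m : ℕ} (t : LegTree n m) :
    {i | ¬ Subsingleton (V.onTree t i)}.Finite := by
  have := hV.finite_flagIndex t
  refine (Set.finite_range fun β : ∀ x, Σ j, V.FlagIndex t x j => ∑ x, (β x).1).subset
    fun i hi => ?_
  by_contra hne
  refine hi ?_
  have : IsEmpty {β : ∀ x, Σ j, V.FlagIndex t x j // ∑ x, (β x).1 = i} :=
    ⟨fun β => hne ⟨β.1, β.2⟩⟩
  exact (gradedTensorBasis (fun x j => Module.Free.chooseBasis k (V.onSet (t.Flags x) j))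
    i).repr.toEquiv.subsingleton

/-- Sections embed into the product over the finitely many labelled trees, and each V((t)) is a
tensor product of spaces of finite total dimension. -/
theorem FiniteDim.tree (hV : V.FiniteDim) : V.tree.FiniteDim := by
  intro n
  rw [directSum_finite_iff]
  have h0 : ∀ (m : ℕ) (t : LegTree n m) (i : ℤ), Module.Finite k ((V.treeFunctor n i).X m t) :=
    fun m t i => hV.onTree t i
  constructor
  · intro i
    exact Module.Finite.of_injective _ (V.treeFunctor n i).incl_injective
  · refine (Set.finite_iUnion fun s : AllTrees n => hV.finite_support_onTree s.2).subset
      fun i hi => ?_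
    by_contra hne
    simp only [Set.mem_iUnion, Set.mem_ofPred_eq, not_exists, not_not] at hne
    refine hi ⟨fun Φ Ψ => (V.treeFunctor n i).incl_injective (funext fun s => ?_)⟩
    exact (hne s).elim _ _

end CyclicSMod

/-! ### Signs -/

theorem prod_sym2_filter_not_isDiag {ι M : Type*} [LinearOrder ι] [CommMonoid M] (s : Finset ι)
    (p : Sym2 ι → M) :
    ∏ i ∈ s.sym2 with ¬ i.IsDiag, p i = ∏ i ∈ s.offDiag with i.1 < i.2, p s(i.1, i.2) :=
  Finset.sum_sym2_filter_not_isDiag (M := Additive M) s p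

/-- If all factors are odd, every inversion counts, and the sign of σ is the parity of the number of
inversions. -/
theorem koszulSign_one {s : ℕ} (σ : Equiv.Perm (Fin s)) :
    koszulSign (fun _ => 1) σ = Equiv.Perm.sign σ := by
  classical
  rw [Equiv.Perm.sign_eq_prod_prod_Iio, koszulSign, ← Finset.prod_filter_mul_prod_filter_not
    Finset.univ (fun z : Sym2 (Fin s) => ¬ z.IsDiag)]
  have h1 : ∀ z ∈ (Finset.univ : Finset (Sym2 (Fin s))).filter (fun z => ¬ ¬ z.IsDiag), z.IsDiag :=
    fun z hz => not_not.1 (Finset.mem_filter.1 hz).2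
  rw [Finset.prod_eq_one (s := Finset.filter (fun z => ¬ ¬ _) _), mul_one, ← Finset.sym2_univ,
    prod_sym2_filter_not_isDiag, Finset.prod_sigma']
  · refine Finset.prod_bij' (fun z _ => ⟨z.2, z.1⟩) (fun z _ => (z.2, z.1)) ?_ ?_ ?_ ?_ ?_
    · rintro ⟨a, b⟩ h
      simpa using (Finset.mem_filter.1 h).2
    · rintro ⟨a, b⟩ h
      have : b < a := by simpa using h
      simp [this, this.ne]
    · intros; rfl
    · intros; rfl
    · rintro ⟨a, b⟩ h
      have : a < b := by simpa using (Finset.mem_filter.1 h).2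
      simp only [Sym2.lift_mk, this, true_iff, odd_one, true_and]
      by_cases h' : σ a < σ b <;> simp [h']
  · intro z hz
    have := h1 z hz
    induction z with | _ x y =>
    rw [Sym2.mk_isDiag_iff] at this
    subst this
    simp

/-- The Koszul sign is the sign of the permutation of the factors of odd degree. -/
theorem koszulSign_eq_sign {m : ℕ} {D : Fin m → ℤ} {τ : Equiv.Perm (Fin m)}
    (h : ∀ x, D (τ x) = D x) :
    koszulSign D τ = Equiv.Perm.sign (τ.subtypePerm (p := fun x => Odd (D x)) (by simp [h])) := by
  classical
  set τ' := τ.subtypePerm (p := fun x => Odd (D x)) (by simp [h])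
  let e := Fintype.orderIsoFinOfCardEq {x // Odd (D x)} rfl
  rw [← Equiv.Perm.sign_permCongr e.symm.toEquiv τ', ← koszulSign_one]
  symm
  -- Pairs containing a point of even degree contribute 1, and the increasing enumeration e of the
  -- points of odd degree preserves inversions.
  refine Fintype.prod_of_injective (Sym2.map fun x => ((e x : {x // Odd (D x)}) : Fin m))
    (Sym2.map.injective (Subtype.val_injective.comp e.injective)) _ _ ?_ ?_
  · intro z hz
    induction z with | _ x y =>
    rw [Sym2.lift_mk]
    refine if_neg ?_
    rintro ⟨hx, hy, -⟩
    exact hz ⟨s(e.symm ⟨x, hx⟩, e.symm ⟨y, hy⟩), by simp⟩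
  · intro z
    induction z with | _ x y =>
    simp only [Sym2.lift_mk, Sym2.map_mk]
    have h1 : Odd (D (e x)) := (e x).2
    have h2 : Odd (D (e y)) := (e y).2
    have h3 : ((e x : {x // Odd (D x)}) : Fin m) < e y ↔ x < y := by simp
    have h4 : τ (e x) < τ (e y) ↔
      (e.symm.toEquiv.permCongr τ') x < (e.symm.toEquiv.permCongr τ') y := by
      have : ∀ x, τ (e x) = (e (e.symm.toEquiv.permCongr τ' x) : {x // Odd (D x)}) := fun x => by
        simp [Equiv.permCongr_apply, τ']
      rw [this, this, Subtype.coe_lt_coe, e.lt_iff_lt]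
    exact if_congr (by simp only [h1, h2, true_and, odd_one, h3, h4]) rfl rfl

theorem card_parts_partition {N : ℕ} (σ : Equiv.Perm (Fin N)) :
    Multiset.card σ.partition.parts = Nat.card (Orb σ) := by
  have h := congrArg (fun d : ℕ+ →₀ ℕ => d.sum fun _ a => a) (cycExp_eq_parts σ)
  have hadd : ∀ s : Multiset (ℕ+ →₀ ℕ), s.sum.sum (fun _ a => a) =
      (s.map fun d => d.sum fun _ a => a).sum := fun s => by
    induction s using Multiset.induction_on with
    | empty => simp
    | cons a s ih =>
      rw [Multiset.sum_cons, Multiset.map_cons, Multiset.sum_cons, ← ih,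
        Finsupp.sum_add_index' (by simp) (by simp)]
  simp only [hadd, cycExp, Multiset.map_map, Function.comp_def, Finsupp.sum_single_index,
    Finset.sum] at h
  simpa using h.symm

/-- A cycle of length l has sign (-1)^(l-1); multiplied by (-1)^l it contributes one factor -1, for
fixed points as well. -/
theorem neg_one_pow_card_mul_sign {α : Type*} [Fintype α] [DecidableEq α] (σ : Equiv.Perm α) :
    (-1) ^ Fintype.card α * Equiv.Perm.sign σ = (-1) ^ Nat.card (Orb σ) := by
  let e := Fintype.equivFin α
  have h1 : Nat.card (Orb σ) = Nat.card (Orb (e.permCongr σ)) := by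
    refine Nat.card_congr (Equiv.ofBijective (Orb.map e (ρ := e.permCongr σ) (by simp)) ⟨?_, ?_⟩)
    · exact Orb.map_injective _ e.injective
    · exact Orb.map_surjective _ e.surjective
  rw [h1, ← Equiv.Perm.sign_permCongr e σ, ← card_parts_partition, Equiv.Perm.parts_partition,
    Multiset.card_add, Multiset.card_replicate, Equiv.Perm.sign_of_cycleType]
  have h2 : (e.permCongr σ).support.card ≤ Fintype.card (Fin (Fintype.card α)) :=
    Finset.card_le_univ _
  rw [Equiv.Perm.sum_cycleType, ← pow_add, ← add_assoc, add_comm (Multiset.card _), pow_add,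
    pow_add _ (_ - _)]
  congr 1
  rw [Fintype.card_fin] at h2
  generalize (e.permCongr σ).support.card = a at h2 ⊢
  have h3 : Fintype.card (Fin (Fintype.card α)) = Fintype.card α := Fintype.card_fin _
  generalize Fintype.card (Fin (Fintype.card α)) = c at h3 ⊢
  subst h3
  obtain ⟨l, hl⟩ := Nat.exists_eq_add_of_le h2
  rw [hl, Nat.add_sub_cancel_left, show ∀ a b : ℕ, a + b + a = b + 2 * a by intros; ring, pow_add,
    pow_mul]
  simp

theorem negOnePow_sum {ι : Type*} (s : Finset ι) (D : ι → ℤ) :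
    (∑ x ∈ s, D x).negOnePow = ∏ x ∈ s, (D x).negOnePow := by
  classical
  induction s using Finset.induction_on with
  | empty => simp
  | insert a s ha ih => rw [Finset.sum_insert ha, Finset.prod_insert ha, Int.negOnePow_add, ih]

theorem prod_negOnePow_eq {ι : Type*} (s : Finset ι) (D : ι → ℤ)
    [DecidablePred fun x => Odd (D x)] :
    ∏ x ∈ s, (D x).negOnePow = (-1) ^ (s.filter fun x => Odd (D x)).card := by
  rw [← Finset.prod_const, Finset.prod_filter]
  refine Finset.prod_congr rfl fun x _ => ?_
  split_ifs with h
  · exact Int.negOnePow_odd _ h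
  · exact Int.negOnePow_even _ (Int.not_odd_iff_even.1 h)

/-- The super-analogue of the sign of a permutation counts the orbits of odd degree. -/
theorem negOnePow_mul_koszulSign {m : ℕ} {D : Fin m → ℤ} {τ : Equiv.Perm (Fin m)}
    (h : ∀ x, D (τ x) = D x) :
    (∑ x, D x).negOnePow * koszulSign D τ = ∏ O : Orb τ, (D O.out).negOnePow := by
  classical
  have hpow : ∀ (j : ℕ) x, D ((τ ^ j) x) = D x := fun j x => by
    induction j with
    | zero => rfl
    | succ j ih => rw [pow_succ', Equiv.Perm.mul_apply, h, ih]
  -- The parity of the total degree counts the points of odd degree, and the Koszul sign is the sign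
  -- of τ on these points. Their product counts the orbits of odd points, by the preceding cycle
  -- count.
  rw [koszulSign_eq_sign h, negOnePow_sum, prod_negOnePow_eq, prod_negOnePow_eq,
    ← Fintype.card_subtype, neg_one_pow_card_mul_sign, ← Fintype.card_subtype,
    ← Nat.card_eq_fintype_card]
  congr 1
  set τ' := τ.subtypePerm (p := fun x => Odd (D x)) (by simp [h])
  have hτ : ∀ x : {x // Odd (D x)}, ((τ' x : {x // Odd (D x)}) : Fin m) = τ x := fun _ => rfl
  refine Nat.card_congr (Equiv.ofBijective (fun O => ⟨Orb.map Subtype.val hτ O, ?_⟩) ⟨?_, ?_⟩)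
  · obtain ⟨x, rfl⟩ := Orb.mk_surjective _ O
    rw [Orb.map_mk]
    obtain ⟨j, hj⟩ := Orb.exists_pow (Orb.mk_out (Orb.mk τ x.1)).symm
    rw [← hj, hpow]
    exact x.2
  · exact fun O O' hO => Orb.map_injective hτ Subtype.val_injective (Subtype.ext_iff.1 hO)
  · rintro ⟨O, hO⟩
    exact ⟨Orb.mk τ' ⟨O.out, hO⟩, Subtype.ext (by simp)⟩

/-! ### Sums over labellings of the points of a permutation -/

section OrbitSum

variable {k : Type*} [Field k] {Y : Type*} [Fintype Y] [DecidableEq Y]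

/-- The entries of a matrix power are sums over paths. The weight G of the two endpoints is
arbitrary so that the induction can absorb the last step into it. -/
theorem sum_prod_path (T : Matrix Y Y k) (j : ℕ) (G : Y → Y → k) :
    ∑ b : Fin (j + 1) → Y, G (b (Fin.last j)) (b 0) * ∏ i : Fin j, T (b i.succ) (b i.castSucc) =
      ∑ y, ∑ y', G y' y * (T ^ j) y' y := by
  induction j generalizing G with
  | zero =>
    rw [← (Equiv.funUnique (Fin 1) Y).symm.sum_comp]
    simp [Matrix.one_apply]
  | succ j ih =>
    have h := ih fun y' y => ∑ z, G z y * T z y'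
    rw [← (Fin.snocEquiv fun _ => Y).sum_comp, Fintype.sum_prod_type, Finset.sum_comm]
    refine Eq.trans (Finset.sum_congr rfl fun b _ => ?_) (h.trans ?_)
    · rw [Finset.sum_mul]
      refine Finset.sum_congr rfl fun z _ => ?_
      rw [Fin.prod_univ_castSucc]
      have h0 : Fin.snocEquiv (fun _ => Y) (z, b) 0 = b 0 :=
        Fin.snoc_castSucc (α := fun _ => Y) z b 0
      have h1 : ∀ i : Fin (j + 1), Fin.snocEquiv (fun _ => Y) (z, b) i.castSucc = b i := fun i =>
        Fin.snoc_castSucc (α := fun _ => Y) z b i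
      have h2 : Fin.snocEquiv (fun _ => Y) (z, b) (Fin.last (j + 1)) = z :=
        Fin.snoc_last (α := fun _ => Y) z b
      simp only [Fin.succ_last, ← Fin.castSucc_succ, h0, h1, h2]
      ring
    · refine Finset.sum_congr rfl fun y _ => ?_
      simp only [pow_succ', Matrix.mul_apply, Finset.sum_mul, Finset.mul_sum]
      rw [Finset.sum_comm]
      refine Finset.sum_congr rfl fun z _ => Finset.sum_congr rfl fun y' _ => ?_
      ring

/-- A closed path is a path whose endpoint weight G contains the closing step. -/
theorem sum_prod_cycle (T : Matrix Y Y k) (r : ℕ) (w : Y → k) :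
    ∑ b : Fin (r + 1) → Y, w (b 0) * ∏ i, T (b (i + 1)) (b i) =
      ∑ y, w y * (T ^ (r + 1)) y y := by
  refine Eq.trans (Finset.sum_congr rfl fun b _ => ?_)
    ((sum_prod_path T r fun y' y => w y * T y y').trans ?_)
  · rw [Fin.prod_univ_castSucc]
    simp only [Fin.coeSucc_eq_succ, Fin.last_add_one]
    ring
  · refine Finset.sum_congr rfl fun y _ => ?_
    rw [pow_succ', Matrix.mul_apply, Finset.mul_sum]
    exact Finset.sum_congr rfl fun y' _ => mul_assoc _ _ _

variable {X : Type*} [Fintype X]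

/-- Enumeration of the points of the orbits of a permutation. -/
def Orb.pointsEquiv (τ : Equiv.Perm X) : (Σ O : Orb τ, Fin ((O.len : ℕ) - 1 + 1)) ≃ X :=
  Equiv.ofBijective (fun s => (τ ^ (s.2 : ℕ)) s.1.out) <| by
    have hl : ∀ O : Orb τ, (O.len : ℕ) - 1 + 1 = O.len := fun O => Nat.sub_add_cancel O.len.pos
    constructor
    · rintro ⟨O, i⟩ ⟨O', j⟩ h
      have hO : O = O' := by simpa using congrArg (Orb.mk τ) h
      subst hO
      have h' := Orb.pow_apply_eq_iff.1 h
      rw [Orb.mk_out] at h'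
      have := Nat.ModEq.eq_of_lt_of_lt h' (i.2.trans_eq (hl O)) (j.2.trans_eq (hl O))
      exact congrArg (Sigma.mk O) (Fin.ext this)
    · intro x
      obtain ⟨j, hj⟩ := Orb.exists_pow (Orb.mk_out (Orb.mk τ x))
      refine ⟨⟨Orb.mk τ x, ⟨j % (Orb.mk τ x).len, ?_⟩⟩, ?_⟩
      · rw [hl]
        exact Nat.mod_lt _ (Orb.mk τ x).len.pos
      · refine Eq.trans ?_ hj
        refine Orb.pow_apply_eq_iff.2 ?_
        rw [Orb.mk_out]
        exact Nat.mod_modEq _ _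

theorem Orb.apply_pointsEquiv (τ : Equiv.Perm X) (O : Orb τ) (i : Fin ((O.len : ℕ) - 1 + 1)) :
    τ (Orb.pointsEquiv τ ⟨O, i⟩) = Orb.pointsEquiv τ ⟨O, i + 1⟩ := by
  change τ ((τ ^ (i : ℕ)) O.out) = (τ ^ ((i + 1 : Fin _) : ℕ)) O.out
  have hl : (O.len : ℕ) - 1 + 1 = O.len := Nat.sub_add_cancel O.len.pos
  rw [← Equiv.Perm.mul_apply, ← pow_succ', Orb.pow_apply_eq_iff, Orb.mk_out, Fin.val_add]
  change _ ≡ ((i : ℕ) + _) % ((O.len : ℕ) - 1 + 1) [MOD _]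
  generalize (i : ℕ) = a
  rw [Fin.val_one', hl]
  simp [Nat.ModEq]

variable [DecidableEq X]

/-- The sum over all labellings of the points of a product of matrix entries is the product over
the orbits of the (weighted) traces of the powers of the matrix. -/
theorem sum_prod_orbits (T : Matrix Y Y k) (τ : Equiv.Perm X) (w : Orb τ → Y → k) :
    ∑ b : X → Y, (∏ O : Orb τ, w O (b O.out)) * ∏ x, T (b (τ x)) (b x) =
      ∏ O : Orb τ, ∑ y, w O y * (T ^ (O.len : ℕ)) y y := by
  classical
  have hl : ∀ O : Orb τ, (O.len : ℕ) - 1 + 1 = O.len := fun O => Nat.sub_add_cancel O.len.pos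
  let e : (∀ O : Orb τ, Fin ((O.len : ℕ) - 1 + 1) → Y) ≃ (X → Y) :=
    (Equiv.piCurry fun _ _ => Y).symm.trans (Equiv.arrowCongr (Orb.pointsEquiv τ) (Equiv.refl Y))
  have he : ∀ c O i, e c (Orb.pointsEquiv τ ⟨O, i⟩) = c O i := fun c O i => by
    change Sigma.uncurry c ((Orb.pointsEquiv τ).symm (Orb.pointsEquiv τ ⟨O, i⟩)) = _
    rw [Equiv.symm_apply_apply]
    rfl
  have h0 : ∀ O : Orb τ, O.out = Orb.pointsEquiv τ ⟨O, 0⟩ := fun O => rfl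
  rw [← e.sum_comp]
  have h1 : ∀ c, (∏ O : Orb τ, w O (e c O.out)) * ∏ x, T (e c (τ x)) (e c x) =
      ∏ O : Orb τ, (w O (c O 0) * ∏ i, T (c O (i + 1)) (c O i)) := fun c => by
    rw [Finset.prod_mul_distrib, ← (Orb.pointsEquiv τ).prod_comp, Fintype.prod_sigma]
    congr 1
    · exact Finset.prod_congr rfl fun O _ => by rw [h0, he]
    · exact Finset.prod_congr rfl fun O _ => Finset.prod_congr rfl fun i _ => by
        rw [Orb.apply_pointsEquiv, he, he]
  rw [Finset.sum_congr rfl fun c _ => h1 c]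
  symm
  refine Eq.trans (Finset.prod_congr rfl fun O _ => ?_) (Fintype.prod_sum fun (O : Orb τ)
    (c : Fin ((O.len : ℕ) - 1 + 1) → Y) => w O (c 0) * ∏ i, T (c (i + 1)) (c i))
  rw [sum_prod_cycle, hl]

/-- A version of `sum_prod_orbits` for sections of a family of types. -/
theorem sum_prod_orbits_sections {K : X → Type*} [∀ x, Fintype (K x)] [∀ x, DecidableEq (K x)]
    (τ : Equiv.Perm X) (T : Matrix (Σ x, K x) (Σ x, K x) k)
    (hT : ∀ y' y, T y' y ≠ 0 → y'.1 = τ y.1) (w : ∀ x, K x → k) :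
    ∑ b : ∀ x, K x, (∏ O : Orb τ, w O.out (b O.out)) * ∏ x, T ⟨τ x, b (τ x)⟩ ⟨x, b x⟩ =
      ∏ O : Orb τ, ∑ y, w O.out y * (T ^ (O.len : ℕ)) ⟨O.out, y⟩ ⟨O.out, y⟩ := by
  classical
  -- The weight is extended by zero away from the representative of the orbit. A labelling with
  -- nonzero term then lies over x at every x: this holds at representatives, and T propagates it
  -- along τ.
  have h := sum_prod_orbits T τ fun O y => if h : y.1 = O.out then w y.1 y.2 else 0
  refine Eq.trans ?_ (h.trans (Finset.prod_congr rfl fun O _ => ?_))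
  · refine Fintype.sum_of_injective (fun b x => (⟨x, b x⟩ : Σ x, K x)) (fun b b' hb => ?_) _ _ ?_ ?_
    · funext x
      simpa using congrFun hb x
    · intro b hb
      by_contra hne
      refine hb ?_
      have h1 : ∀ x, (b (τ x)).1 = τ (b x).1 := fun x =>
        hT _ _ (Finset.prod_ne_zero_iff.1 (right_ne_zero_of_mul hne) x (Finset.mem_univ x))
      have h2 : ∀ O : Orb τ, (b O.out).1 = O.out := fun O => by
        by_contra h'
        refine Finset.prod_ne_zero_iff.1 (left_ne_zero_of_mul hne) O (Finset.mem_univ O) ?_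
        rw [dif_neg h']
      have h3 : ∀ x, (b x).1 = x := fun x => by
        obtain ⟨j, hj⟩ := Orb.exists_pow (Orb.mk_out (Orb.mk τ x))
        have := Orb.semiconj_pow (π := fun x => (b x).1) h1 j (Orb.mk τ x).out
        rw [hj] at this
        rw [this, h2, hj]
      refine ⟨fun x => h3 x ▸ (b x).2, funext fun x => ?_⟩
      have hcast : ∀ (z : Σ x, K x) (h : z.1 = x), (⟨x, h ▸ z.2⟩ : Σ x, K x) = z := by
        rintro z rfl
        rfl
      exact hcast (b x) (h3 x)
    · intro b
      simp
  · rw [Fintype.sum_sigma, Finset.sum_eq_single O.out]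
    · simp
    · intro x _ hx
      exact Finset.sum_eq_zero fun y _ => by rw [dif_neg hx, zero_mul]
    · simp

end OrbitSum

/-! ### Stable trees with arbitrary sets of vertices and legs -/

/-- A stable tree with vertices `V` and legs `E`. -/
@[ext] structure STree (E V : Type) where
  graph : SimpleGraph V
  isTree : graph.IsTree
  leg : E → V
  stable : ∀ x, 3 ≤ Nat.card ({y // graph.Adj x y} ⊕ {e // leg e = x})

namespace STree

variable {E V : Type}

/-- Automorphisms of trees, acting on the vertices by `τ` and on the legs by `σ`. -/
structure IsAut (t : STree E V) (τ : Equiv.Perm V) (σ : Equiv.Perm E) : Prop where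
  adj : ∀ x y, t.graph.Adj (τ x) (τ y) ↔ t.graph.Adj x y
  leg : ∀ e, t.leg (σ e) = τ (t.leg e)

/-- The set of all flags of a tree. -/
abbrev Flag (t : STree E V) : Type := {p : V × V // t.graph.Adj p.1 p.2} ⊕ E

/-- The vertex of a flag. -/
def base (t : STree E V) : t.Flag → V := Sum.elim (fun p => p.1.1) t.leg

/-- The permutation of the flags induced by an automorphism. -/
def IsAut.perm {t : STree E V} {τ : Equiv.Perm V} {σ : Equiv.Perm E} (h : t.IsAut τ σ) :
    Equiv.Perm t.Flag :=
  Equiv.sumCongr (Equiv.subtypeEquiv (Equiv.prodCongr τ τ) fun p => (h.adj p.1 p.2).symm) σ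

theorem IsAut.base_perm {t : STree E V} {τ : Equiv.Perm V} {σ : Equiv.Perm E} (h : t.IsAut τ σ)
    (x : t.Flag) : t.base (h.perm x) = τ (t.base x) := by
  obtain x | x := x
  · rfl
  · exact h.leg x

end STree

namespace LegTree

variable {n m : ℕ} {t : LegTree n m} {τ : Equiv.Perm (Fin m)} {σ : Equiv.Perm (Fin (n + 1))}

/-- A tree, as a tree with arbitrary sets of vertices and legs. -/
def equivSTree (n m : ℕ) : LegTree n m ≃ STree (Fin (n + 1)) (Fin m) where
  toFun t := ⟨t.graph, t.isTree, t.leg, t.stable⟩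
  invFun t := ⟨t.graph, t.isTree, t.leg, t.stable⟩
  left_inv _ := rfl
  right_inv _ := rfl

theorem isAut_equivSTree : (equivSTree n m t).IsAut τ σ ↔ IsIso τ σ t t :=
  ⟨fun h => ⟨h.1, h.2⟩, fun h => ⟨h.1, h.2⟩⟩

theorem IsIso.pow (h : IsIso τ σ t t) (l : ℕ) : IsIso (τ ^ l) (σ ^ l) t t := by
  induction l with
  | zero => exact IsIso.refl t
  | succ l ih =>
    rw [pow_succ', pow_succ']
    exact ih.trans h

/-- The bijection between the flags at two vertices induced by an automorphism. -/
def IsIso.flagEquiv (h : IsIso τ σ t t) {x x' : Fin m} (hx : τ x = x') : t.Flags x ≃ t.Flags x' :=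
  Equiv.sumCongr
    (Equiv.subtypeEquiv τ fun y => by rw [← hx]; exact (h.adj x y).symm)
    (Equiv.subtypeEquiv σ fun j => by rw [h.leg, ← hx, τ.injective.eq_iff])

end LegTree

/-! ### Matrices of homogeneous maps and of tree automorphisms. -/

section GradedEntry

variable {k : Type u} [Field k] {A B C : ℤ → Type v}
  [∀ j, AddCommMonoid (A j)] [∀ j, Module k (A j)] [∀ j, AddCommMonoid (B j)]
  [∀ j, Module k (B j)] [∀ j, AddCommMonoid (C j)] [∀ j, Module k (C j)]
  {κA κB κC : ℤ → Type*} (a : ∀ j, Module.Basis (κA j) k (A j))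
  (b : ∀ j, Module.Basis (κB j) k (B j)) (c : ∀ j, Module.Basis (κC j) k (C j))

theorem gradedEntry_eq_zero (g : ∀ j, A j →ₗ[k] B j) {β' : Σ j, κB j} {β : Σ j, κA j}
    (h : β'.1 ≠ β.1) : gradedEntry a b g β' β = 0 := by
  rw [gradedEntry, dfinsuppBasis_repr, DFinsupp.single_eq_of_ne h, map_zero]
  rfl

theorem gradedEntry_comp [Fintype (Σ j, κB j)] (g : ∀ j, A j →ₗ[k] B j) (g' : ∀ j, B j →ₗ[k] C j)
    (γ : Σ j, κC j) (α : Σ j, κA j) :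
    ∑ β, gradedEntry b c g' γ β * gradedEntry a b g β α =
      gradedEntry a c (fun j => g' j ∘ₗ g j) γ α := by
  have h1 : ∀ j v, DFinsupp.mapRange.linearMap g' (DFinsupp.single j v) =
      DFinsupp.single j (g' j v) := fun j v => by simp
  rw [gradedEntry, LinearMap.comp_apply, ← h1,
    ← (DFinsupp.basis b).sum_repr (DFinsupp.single α.1 (g α.1 (a α.1 α.2))), map_sum, map_sum,
    Finsupp.finsetSum_apply]
  refine Finset.sum_congr rfl fun β _ => ?_
  rw [map_smul, map_smul, Finsupp.smul_apply, dfinsuppBasis_apply, h1, smul_eq_mul, mul_comm]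
  rfl

/-- The diagonal entries weighted by parity are grouped by degree into the traces of the homogeneous
pieces. -/
theorem sum_negOnePow_gradedEntry [Fintype (Σ j, κA j)] (g : ∀ j, A j →ₗ[k] A j) :
    ∑ α : Σ j, κA j, ((α.1.negOnePow : ℤ) : k) * gradedEntry a a g α α =
      ∑ᶠ j : ℤ, ((j.negOnePow : ℤ) : k) * LinearMap.trace k _ (g j) := by
  classical
  rw [sum_eq_finsum_fiber Sigma.fst]
  refine finsum_congr fun j => ?_
  have : Fintype (κA j) := Fintype.ofInjective (Sigma.mk j) sigma_mk_injective
  rw [LinearMap.trace_eq_matrix_trace k (a j), Matrix.trace, Finset.mul_sum,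
    ← (Equiv.sigmaSubtype j).symm.sum_comp]
  refine Finset.sum_congr rfl fun α _ => ?_
  rw [Matrix.diag_apply, LinearMap.toMatrix_apply, gradedEntry, dfinsuppBasis_repr]
  congr 3
  exact DFinsupp.single_eq_same

end GradedEntry

namespace CyclicSMod

variable {k : Type u} [Field k] {V : CyclicSMod.{u, v} k} {n m : ℕ} {t : LegTree n m}
  {τ : Equiv.Perm (Fin m)} {σ : Equiv.Perm (Fin (n + 1))}

/-- The matrix of the map between the spaces of two vertices induced by an automorphism. -/
def flagEntry (V : CyclicSMod.{u, v} k) (h : LegTree.IsIso τ σ t t) {x x' : Fin m}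
    (hx : τ x = x') : (Σ j, V.FlagIndex t x' j) → (Σ j, V.FlagIndex t x j) → k :=
  gradedEntry (fun j => Module.Free.chooseBasis k (V.onSet (t.Flags x) j))
    (fun j => Module.Free.chooseBasis k (V.onSet (t.Flags x') j))
    (fun j => V.onSetMap (h.flagEquiv hx) j)

theorem flagEntry_comp {τ' : Equiv.Perm (Fin m)} {σ' : Equiv.Perm (Fin (n + 1))}
    (h : LegTree.IsIso τ σ t t) (h' : LegTree.IsIso τ' σ' t t) {x x' x'' : Fin m}
    [Fintype (Σ j, V.FlagIndex t x' j)] (hx : τ x = x') (hx' : τ' x' = x'')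
    (hx'' : (τ.trans τ') x = x'') (γ : Σ j, V.FlagIndex t x'' j) (α : Σ j, V.FlagIndex t x j) :
    ∑ β, V.flagEntry h' hx' γ β * V.flagEntry h hx β α = V.flagEntry (h.trans h') hx'' γ α := by
  have hfl : (h.trans h').flagEquiv hx'' = (h.flagEquiv hx).trans (h'.flagEquiv hx') := by
    ext y
    rcases y with y | y <;> rfl
  have hm : (fun j => V.onSetMap ((h.trans h').flagEquiv hx'') j) =
      fun j => V.onSetMap (h'.flagEquiv hx') j ∘ₗ V.onSetMap (h.flagEquiv hx) j := by
    rw [hfl]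
    rfl
  refine (gradedEntry_comp (fun j => Module.Free.chooseBasis k (V.onSet (t.Flags x) j))
    (fun j => Module.Free.chooseBasis k (V.onSet (t.Flags x') j)) _ _ _ _ _).trans ?_
  rw [flagEntry, hm]

open Classical in
/-- The matrix of an automorphism of a tree on the sum of the spaces of the vertices. -/
def flagMatrix (V : CyclicSMod.{u, v} k) (h : LegTree.IsIso τ σ t t) :
    Matrix (Σ x, Σ j, V.FlagIndex t x j) (Σ x, Σ j, V.FlagIndex t x j) k := fun y' y =>
  if hx : τ y.1 = y'.1 then V.flagEntry h hx y'.2 y.2 else 0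

theorem flagMatrix_mul [∀ x, Fintype (Σ j, V.FlagIndex t x j)] {τ' : Equiv.Perm (Fin m)}
    {σ' : Equiv.Perm (Fin (n + 1))}
    (h : LegTree.IsIso τ σ t t) (h' : LegTree.IsIso τ' σ' t t) :
    V.flagMatrix h' * V.flagMatrix h = V.flagMatrix (h.trans h') := by
  classical
  ext y'' y
  rw [Matrix.mul_apply, Fintype.sum_sigma, Finset.sum_eq_single (τ y.1)]
  · have h1 : ∀ z, V.flagMatrix h ⟨τ y.1, z⟩ y = V.flagEntry h rfl z y.2 := fun z => dif_pos rfl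
    simp only [h1]
    by_cases hx : τ' (τ y.1) = y''.1
    · have h2 : ∀ z, V.flagMatrix h' y'' ⟨τ y.1, z⟩ = V.flagEntry h' hx y''.2 z :=
        fun z => dif_pos hx
      have h3 : V.flagMatrix (h.trans h') y'' y = V.flagEntry (h.trans h') hx y''.2 y.2 :=
        dif_pos hx
      simp only [h2, h3]
      exact flagEntry_comp h h' rfl hx hx _ _
    · have h2 : ∀ z, V.flagMatrix h' y'' ⟨τ y.1, z⟩ = 0 := fun z => dif_neg hx
      have h3 : V.flagMatrix (h.trans h') y'' y = 0 := dif_neg hx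
      simp only [h2, h3, zero_mul, Finset.sum_const_zero]
  · intro x _ hx
    refine Finset.sum_eq_zero fun z _ => ?_
    rw [mul_eq_zero]
    right
    exact dif_neg fun h => hx h.symm
  · simp

/-- At the length of the orbit of x, the diagonal block of the power at x is the matrix of the first
return to x. Orbit lengths are positive, so positive exponents are enough. -/
theorem flagMatrix_pow [∀ x, Fintype (Σ j, V.FlagIndex t x j)]
    [DecidableEq (Σ x, Σ j, V.FlagIndex t x j)] (h : LegTree.IsIso τ σ t t) (l : ℕ) :
    V.flagMatrix h ^ (l + 1) = V.flagMatrix (h.pow (l + 1)) := by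
  have hc : ∀ {τ₁ τ₂ : Equiv.Perm (Fin m)} {σ₁ σ₂ : Equiv.Perm (Fin (n + 1))}
      (h₁ : LegTree.IsIso τ₁ σ₁ t t) (h₂ : LegTree.IsIso τ₂ σ₂ t t), τ₁ = τ₂ → σ₁ = σ₂ →
      V.flagMatrix h₁ = V.flagMatrix h₂ := by
    rintro _ _ _ _ _ _ rfl rfl
    rfl
  induction l with
  | zero => rw [pow_one]; exact hc _ _ (pow_one _).symm (pow_one _).symm
  | succ l ih =>
    rw [pow_succ', ih, flagMatrix_mul]
    exact hc _ _ (pow_succ' _ _).symm (pow_succ' _ _).symm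

/-- The supertrace of an automorphism of a tree on `V((t))`. -/
theorem finsum_trace_onTreeMap [CharZero k] (hV : V.FiniteDim) (h : LegTree.IsIso τ σ t t) :
    ∑ᶠ i : ℤ, ((i.negOnePow : ℤ) : k) * LinearMap.trace k _ (V.onTreeMap h i) =
      orbWeight V.Ch (LegTree.equivSTree n m t).base (LegTree.isAut_equivSTree.2 h).base_perm := by
  classical
  have := hV.finite_flagIndex t
  have := fun x => Fintype.ofFinite (Σ j, V.FlagIndex t x j)
  let bas : ∀ x j, Module.Basis (V.FlagIndex t x j) k (V.onSet (t.Flags x) j) :=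
    fun x j => Module.Free.chooseBasis k (V.onSet (t.Flags x) j)
  have hfl : ∀ x, h.flags x = h.flagEquiv (τ.apply_symm_apply x) := fun x => rfl
  refine (finsum_trace_gradedTensorMap bas τ fun x j => V.onSetMap (h.flags x) j).trans ?_
  have hT : ∀ y' y, V.flagMatrix h y' y ≠ 0 → y'.1 = τ y.1 := fun y' y hy => by
    by_contra hne
    exact hy (dif_neg fun h => hne h.symm)
  have hD : ∀ y' y, V.flagMatrix h y' y ≠ 0 → y'.2.1 = y.2.1 := fun y' y hy => by
    by_contra hne
    refine hy ?_
    rw [flagMatrix]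
    split_ifs
    · exact gradedEntry_eq_zero _ _ _ hne
    · rfl
  -- The supertrace is a sum over labellings of the vertices by basis vectors, which factors over
  -- the vertex orbits once the sign does.
  refine Eq.trans ?_ ((sum_prod_orbits_sections τ (V.flagMatrix h) hT
    fun x y => ((y.1.negOnePow : ℤ) : k)).trans ?_)
  · refine Finset.sum_congr rfl fun β _ => ?_
    have h1 : ∏ x, gradedEntry (bas (τ.symm x)) (bas x) (fun j => V.onSetMap (h.flags x) j) (β x)
        (β (τ.symm x)) = ∏ x, V.flagMatrix h ⟨τ x, β (τ x)⟩ ⟨x, β x⟩ := by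
      rw [← τ.symm.prod_comp fun x => V.flagMatrix h ⟨τ x, β (τ x)⟩ ⟨x, β x⟩]
      refine Finset.prod_congr rfl fun x _ => ?_
      have hg : ∀ x', x' = x → gradedEntry (bas (τ.symm x)) (bas x)
          (fun j => V.onSetMap (h.flags x) j) (β x) (β (τ.symm x)) =
          V.flagMatrix h ⟨x', β x'⟩ ⟨τ.symm x, β (τ.symm x)⟩ := by
        rintro _ rfl
        rw [flagMatrix, dif_pos (τ.apply_symm_apply _)]
        simp only [hfl]
        rfl
      exact hg _ (τ.apply_symm_apply x)
    rw [h1, ← mul_assoc]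
    by_cases h2 : ∏ x, V.flagMatrix h ⟨τ x, β (τ x)⟩ ⟨x, β x⟩ = 0
    · rw [h2, mul_zero, mul_zero]
    -- Nonzero matrix entries preserve degrees, so the degree is constant on orbits, as the sign
    -- formula requires.
    · have h3 : ∀ x, (β (τ x)).1 = (β x).1 := fun x =>
        hD _ _ (Finset.prod_ne_zero_iff.1 h2 x (Finset.mem_univ x))
      congr 1
      have := negOnePow_mul_koszulSign (D := fun x => (β x).1) h3
      have := congrArg (fun z : ℤˣ => ((z : ℤ) : k)) this
      simpa using this
  · refine Finset.prod_congr rfl fun O => ?_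
    intro _
    have hl : (O.len : ℕ) = O.len - 1 + 1 := (Nat.sub_add_cancel O.len.pos).symm
    have hx : (τ ^ (O.len : ℕ)) O.out = O.out := by
      have := Orb.pow_len_apply τ O.out
      rwa [Orb.mk_out] at this
    have hp : V.flagMatrix h ^ (O.len : ℕ) = V.flagMatrix (h.pow O.len) := by
      generalize (O.len : ℕ) = l at hl
      rw [hl, flagMatrix_pow]
    have := nonempty_flags t O.out
    rw [hp]
    have h1 : ∀ y, V.flagMatrix (h.pow O.len) ⟨O.out, y⟩ ⟨O.out, y⟩ =
        gradedEntry (bas O.out) (bas O.out)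
          (fun j => V.onSetMap ((h.pow O.len).flagEquiv hx) j) y y := fun y => dif_pos hx
    simp only [h1]
    rw [sum_negOnePow_gradedEntry, finsum_trace_onSetMap hV]
    congr 1
    -- The flags at x are the fibre over x of the map from all flags to vertices, and the
    -- automorphism raised to the orbit length acts on them as the first return.
    have h2 := cycExp_eq_fibExp (LegTree.isAut_equivSTree.2 h).base_perm O.out
      ((h.pow O.len).flagEquiv hx)
      (Sum.map (fun y => ⟨(O.out, y.1), y.2⟩) fun e => e.1) ?_ ?_ ?_
    · rw [h2, Orb.mk_out]
    · refine Function.Injective.sumMap (fun y y' hy => ?_) Subtype.val_injective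
      exact Subtype.ext (congrArg (fun p => p.1.2) hy)
    · rw [Orb.mk_out]
      have hj : ∀ (j : ℕ) (x : (LegTree.equivSTree n m t).Flag),
          ((LegTree.isAut_equivSTree.2 h).perm ^ j) x =
            (LegTree.isAut_equivSTree.2 (h.pow j)).perm x := fun j => by
        induction j with
        | zero =>
          rintro (x | x) <;> rfl
        | succ j ih =>
          intro x
          rw [pow_succ', Equiv.Perm.mul_apply, ih]
          obtain x | x := x
          · exact congrArg Sum.inl (Subtype.ext (Prod.ext
              (DFunLike.congr_fun (pow_succ' τ j) x.1.1).symm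
              (DFunLike.congr_fun (pow_succ' τ j) x.1.2).symm))
          · exact congrArg Sum.inr (DFunLike.congr_fun (pow_succ' σ j) x).symm
      intro x
      rw [hj]
      obtain x | x := x
      · exact congrArg Sum.inl (Subtype.ext (Prod.ext hx.symm rfl))
      · rfl
    · rintro (x | x)
      · constructor
        · intro hb
          exact ⟨Sum.inl ⟨x.1.2, by rw [← hb]; exact x.2⟩,
            congrArg Sum.inl (Subtype.ext (Prod.ext hb.symm rfl))⟩
        · rintro ⟨y | y, hy⟩
          · rw [← Sum.inl.inj hy]
            rfl
          · cases hy
      · constructor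
        · intro hb
          exact ⟨Sum.inr ⟨x, hb⟩, rfl⟩
        · rintro ⟨y | y, hy⟩
          · cases hy
          · rw [← Sum.inr.inj hy]
            exact y.2

end CyclicSMod

/-! ### The character of the free cyclic operad as a sum over trees. -/

namespace STree

variable {E V : Type}

instance [Finite E] [Finite V] : Fintype (STree E V) :=
  @Fintype.ofFinite _ <| Finite.of_injective (fun t : STree E V => (t.graph, t.leg)) fun _ _ h =>
    STree.ext (congrArg Prod.fst h) (congrArg Prod.snd h)

/-- The contribution of an automorphism of a tree to the character of the free cyclic operad. -/
def weight {k : Type u} [Field k] [Finite E] [Finite V] (f : SymFun k) (t : STree E V)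
    {τ : Equiv.Perm V} {σ : Equiv.Perm E} (h : t.IsAut τ σ) : k :=
  orbWeight f t.base h.base_perm

theorem card_le [Finite E] [Finite V] (t : STree E V) : Nat.card V ≤ Nat.card E :=
  (Nat.le_add_right _ 2).trans
    (SimpleGraph.card_add_two_le_of_stable t.graph t.isTree t.leg t.stable)

end STree

open Classical in
/-- The value at `σ` of the characteristic of the free cyclic operad, in terms of the characteristic
`f` of its generators. -/
def treeSum {k : Type u} [Field k] {E : Type} [Finite E] (f : SymFun k) (σ : Equiv.Perm E) : k :=
  ∑ m ∈ Finset.range (Nat.card E + 1), (m.factorial : k)⁻¹ * ∑ τ : Equiv.Perm (Fin m),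
    ∑ t : STree E (Fin m), if h : t.IsAut τ σ then t.weight f h else 0

/-- The average over labelled trees is taken in each degree; exchanging it with the finite
alternating sum over degrees leaves the supertrace of each automorphism on V((t)). -/
theorem CyclicSMod.ev_Ch_tree {k : Type u} [Field k] [CharZero k] {V : CyclicSMod.{u, v} k}
    (hV : V.FiniteDim) (n : ℕ) (σ : Equiv.Perm (Fin (n + 1))) :
    V.tree.Ch.ev (cycExp σ) = treeSum V.Ch σ := by
  classical
  have hfin : ∀ (m : ℕ) (t : LegTree n m) {τ : Equiv.Perm (Fin m)} (h : LegTree.IsIso τ σ t t),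
      (Function.support fun i : ℤ =>
        ((i.negOnePow : ℤ) : k) * LinearMap.trace k _ (V.onTreeMap h i)).Finite := fun m t τ h => by
    refine (hV.finite_support_onTree t).subset fun i hi hs => hi ?_
    have : V.onTreeMap h i = 0 := LinearMap.ext fun _ => hs.elim _ _
    simp only [this, map_zero, mul_zero]
  have hdist : ∀ (m : ℕ) (t : LegTree n m) (τ : Equiv.Perm (Fin m)),
      (Function.support fun i : ℤ => ((i.negOnePow : ℤ) : k) *
        (if h : LegTree.IsIso τ σ t t then LinearMap.trace k _ (V.onTreeMap h i) else 0)).Finite :=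
      fun m t τ => by
    by_cases h : LegTree.IsIso τ σ t t
    · simpa only [dif_pos h] using hfin m t h
    · simp [dif_neg h]
  rw [ev_Ch hV.tree, strace]
  have h1 : ∀ i : ℤ, ((i.negOnePow : ℤ) : k) * LinearMap.trace k _ (V.tree.ρ n i σ) =
      ∑ s : AllTrees n, ∑ τ : Equiv.Perm (Fin s.1), ((s.1 : ℕ).factorial : k)⁻¹ *
        (((i.negOnePow : ℤ) : k) * (if h : LegTree.IsIso τ σ s.2 s.2 then
          LinearMap.trace k _ (V.onTreeMap h i) else 0)) := fun i => by
    rw [V.trace_tree n i σ fun m t => hV.onTree t i]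
    simp only [Finset.mul_sum]
    refine Finset.sum_congr rfl fun s _ => Finset.sum_congr rfl fun τ _ => ?_
    ring
  rw [finsum_congr h1, finsum_sum_comm]
  · have h2 : ∀ s : AllTrees n, (∑ᶠ i : ℤ, ∑ τ : Equiv.Perm (Fin s.1),
        ((s.1 : ℕ).factorial : k)⁻¹ * (((i.negOnePow : ℤ) : k) *
          (if h : LegTree.IsIso τ σ s.2 s.2 then LinearMap.trace k _ (V.onTreeMap h i) else 0))) =
        ((s.1 : ℕ).factorial : k)⁻¹ * ∑ τ : Equiv.Perm (Fin s.1),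
          (if h : (LegTree.equivSTree n s.1 s.2).IsAut τ σ then
            (LegTree.equivSTree n s.1 s.2).weight V.Ch h else 0) := fun s => by
      rw [finsum_sum_comm, Finset.mul_sum]
      · refine Finset.sum_congr rfl fun τ _ => ?_
        have hs := smul_finsum ((s.1 : ℕ).factorial : k)⁻¹ fun i : ℤ => ((i.negOnePow : ℤ) : k) *
          (if h : LegTree.IsIso τ σ s.2 s.2 then LinearMap.trace k _ (V.onTreeMap h i) else 0)
        simp only [smul_eq_mul] at hs
        rw [← hs]
        congr 1
        by_cases h : LegTree.IsIso τ σ s.2 s.2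
        · rw [dif_pos (LegTree.isAut_equivSTree.2 h)]
          simp only [dif_pos h]
          exact finsum_trace_onTreeMap hV h
        · rw [dif_neg fun h' => h (LegTree.isAut_equivSTree.1 h')]
          simp only [dif_neg h, mul_zero, finsum_zero]
      · intro τ _
        refine (hdist s.1 s.2 τ).subset fun i hi h0 => hi ?_
        simp only at h0
        simp only [h0, mul_zero]
    rw [Finset.sum_congr rfl fun s _ => h2 s, Fintype.sum_sigma, treeSum, Nat.card_fin,
      Finset.sum_range]
    refine Finset.sum_congr rfl fun m _ => ?_
    refine (Finset.mul_sum _ _ ((m : ℕ).factorial : k)⁻¹).symm.trans ?_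
    rw [Finset.sum_comm]
    exact congrArg _ <| Equiv.sum_comp (M := k) (LegTree.equivSTree n m) fun t =>
      ∑ τ : Equiv.Perm (Fin m), (if h : t.IsAut τ σ then t.weight V.Ch h else 0 : k)
  · intro s _
    refine (Set.finite_iUnion fun τ => hdist s.1 s.2 τ).subset fun i hi => ?_
    by_contra h0
    simp only [Set.mem_iUnion, Function.mem_support, not_exists, not_not] at h0
    refine hi ?_
    simp only [h0, mul_zero, Finset.sum_const_zero]

/-! ### Grafting corollas onto the legs of a tree -/

/-- Points with at least two preimages. -/
def IsMult {E N : Type} (q : E → N) (x : N) : Prop := ∃ e e', e ≠ e' ∧ q e = x ∧ q e' = x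

/-- The tree `H`, with legs `E`, is obtained from the tree `G`, with legs `N`, by grafting onto each
leg `x` a corolla with legs `q⁻¹(x)`, except for the legs with only one preimage, which are just
renamed. The vertices of `G` are mapped to vertices of `H` by `α`, and `j x` is the vertex of the
new corolla, or else the vertex to which the leg `x` is attached. -/
structure IsGraft {E N V W : Type} (G : SimpleGraph V) (l : N → V) (q : E → N)
    (H : SimpleGraph W) (l' : E → W) (α : V → W) (j : N → W) : Prop where
  inj : Function.Injective α
  surj : Function.Surjective q
  triv : ∀ x, ¬ IsMult q x → j x = α (l x)
  ne : ∀ x, IsMult q x → ∀ y, α y ≠ j x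
  inj' : ∀ x x', IsMult q x → IsMult q x' → j x = j x' → x = x'
  cover : ∀ z, (∃ y, α y = z) ∨ ∃ x, IsMult q x ∧ j x = z
  leg : ∀ e, l' e = j (q e)
  adj : ∀ y y', H.Adj (α y) (α y') ↔ G.Adj y y'
  adj' : ∀ x, IsMult q x → ∀ z, H.Adj (j x) z ↔ z = α (l x)

namespace IsGraft

variable {E N V W : Type} {G : SimpleGraph V} {l : N → V} {q : E → N} {H : SimpleGraph W}
  {l' : E → W} {α : V → W} {j : N → W} (h : IsGraft G l q H l' α j)
include h

theorem bijective : Function.Bijective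
    (Sum.elim α fun x : {x // IsMult q x} => j x) := by
  constructor
  · rintro (y | x) (y' | x') he
    · exact congrArg Sum.inl (h.inj he)
    · exact absurd he (h.ne _ x'.2 _)
    · exact absurd he.symm (h.ne _ x.2 _)
    · exact congrArg Sum.inr (Subtype.ext (h.inj' _ _ x.2 x'.2 he))
  · intro z
    obtain ⟨y, hy⟩ | ⟨x, hx, hz⟩ := h.cover z
    · exact ⟨Sum.inl y, hy⟩
    · exact ⟨Sum.inr ⟨x, hx⟩, hz⟩

theorem nonempty (hW : Nonempty W) : Nonempty V := by
  obtain ⟨z⟩ := hW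
  obtain ⟨y, -⟩ | ⟨x, -, -⟩ := h.cover z
  · exact ⟨y⟩
  · exact ⟨l x⟩

/-- Contracting each corolla to the vertex that carries its leg lets walks in H be pushed back to G.
-/
theorem exists_retraction : ∃ r : W → V, (∀ y, r (α y) = y) ∧
    ∀ x, IsMult q x → r (j x) = l x := by
  let e := Equiv.ofBijective _ h.bijective
  refine ⟨fun z => Sum.elim id (fun x => l x.1) (e.symm z), fun y => ?_, fun x hx => ?_⟩
  · change Sum.elim id (fun x => l x.1) (e.symm (α y)) = y
    rw [show e.symm (α y) = Sum.inl y from (Equiv.symm_apply_eq e).2 rfl]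
    rfl
  · change Sum.elim id (fun x => l x.1) (e.symm (j x)) = l x
    rw [show e.symm (j x) = Sum.inr ⟨x, hx⟩ from (Equiv.symm_apply_eq e).2 rfl]
    rfl

theorem connected_iff : G.Connected ↔ H.Connected := by
  constructor
  · intro hG
    have hα : ∀ y y', H.Reachable (α y) (α y') := fun y y' =>
      (hG.preconnected y y').map ⟨α, fun h' => (h.adj _ _).2 h'⟩
    have hz : ∀ z, ∃ y, H.Reachable z (α y) := fun z => by
      obtain ⟨y, rfl⟩ | ⟨x, hx, rfl⟩ := h.cover z
      · exact ⟨y, .refl _⟩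
      · exact ⟨l x, ((h.adj' x hx _).2 rfl).reachable⟩
    have := hG.nonempty
    have := this.map α
    refine ⟨fun z z' => ?_⟩
    obtain ⟨y, hy⟩ := hz z
    obtain ⟨y', hy'⟩ := hz z'
    exact (hy.trans (hα y y')).trans hy'.symm
  · intro hH
    obtain ⟨r, hr, hr'⟩ := h.exists_retraction
    have := h.nonempty hH.nonempty
    have hadj : ∀ z z', H.Adj z z' → G.Reachable (r z) (r z') := fun z z' hz => by
      obtain ⟨y, rfl⟩ | ⟨x, hx, rfl⟩ := h.cover z
      · obtain ⟨y', rfl⟩ | ⟨x', hx', rfl⟩ := h.cover z'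
        · rw [hr, hr]
          exact ((h.adj _ _).1 hz).reachable
        · rw [h.inj ((h.adj' _ hx' _).1 hz.symm), hr, hr' _ hx']
      · rw [(h.adj' _ hx _).1 hz, hr, hr' _ hx]
    have hw : ∀ z z', H.Walk z z' → G.Reachable (r z) (r z') := fun z z' w => by
      induction w with
      | nil => exact .refl _
      | cons hz _ ih => exact (hadj _ _ hz).trans ih
    refine ⟨fun y y' => ?_⟩
    obtain ⟨w⟩ := hH.preconnected (α y) (α y')
    simpa [hr] using hw _ _ w

/-- Each corolla adds one edge, namely the one by which it is attached. Since it also adds one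
vertex, the numerical criterion for a tree holds for G and H simultaneously. -/
theorem card_edgeSet [Finite V] [Finite W] [Finite N] :
    Nat.card H.edgeSet = Nat.card G.edgeSet + Nat.card {x // IsMult q x} := by
  have hmem : ∀ e ∈ G.edgeSet, Sym2.map α e ∈ H.edgeSet := fun e he => by
    induction e with | _ y y' => exact (h.adj _ _).2 he
  rw [← Nat.card_sum]
  symm
  refine Nat.card_congr (Equiv.ofBijective (Sum.elim (fun e : G.edgeSet =>
    (⟨Sym2.map α e, hmem e e.2⟩ : H.edgeSet)) fun x : {x // IsMult q x} =>
      ⟨s(j x, α (l x)), (h.adj' _ x.2 _).2 rfl⟩) ⟨?_, ?_⟩)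
  · have hmix : ∀ (e : Sym2 V) (x : {x // IsMult q x}), Sym2.map α e ≠ s(j x, α (l x)) := by
      intro e x he
      have h1 : j x ∈ Sym2.map α e := by rw [he]; exact Sym2.mem_mk_left _ _
      obtain ⟨y, -, hy⟩ := Sym2.mem_map.1 h1
      exact h.ne _ x.2 _ hy
    rintro (e | x) (e' | x') he
    · exact congrArg Sum.inl (Subtype.ext (Sym2.map.injective h.inj (Subtype.ext_iff.1 he)))
    · exact absurd (Subtype.ext_iff.1 he) (hmix e x')
    · exact absurd (Subtype.ext_iff.1 he).symm (hmix e' x)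
    · have h1 : s(j x, α (l x)) = s(j x', α (l x')) := Subtype.ext_iff.1 he
      rw [Sym2.eq_iff] at h1
      obtain ⟨h1, -⟩ | ⟨h1, -⟩ := h1
      · exact congrArg Sum.inr (Subtype.ext (h.inj' _ _ x.2 x'.2 h1))
      · exact absurd h1.symm (h.ne _ x.2 _)
  · rintro ⟨e, he⟩
    induction e with | _ z z' =>
    have he' : H.Adj z z' := he
    obtain ⟨y, rfl⟩ | ⟨x, hx, rfl⟩ := h.cover z
    · obtain ⟨y', rfl⟩ | ⟨x', hx', rfl⟩ := h.cover z'
      · exact ⟨Sum.inl ⟨s(y, y'), (h.adj _ _).1 he'⟩, rfl⟩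
      · refine ⟨Sum.inr ⟨x', hx'⟩, Subtype.ext ?_⟩
        change s(j x', α (l x')) = s(α y, j x')
        rw [(h.adj' _ hx' _).1 he'.symm]
        exact Sym2.eq_swap
    · refine ⟨Sum.inr ⟨x, hx⟩, Subtype.ext ?_⟩
      change s(j x, α (l x)) = s(j x, z')
      rw [(h.adj' _ hx _).1 he']

theorem card_vertices [Finite V] [Finite N] :
    Nat.card W = Nat.card V + Nat.card {x // IsMult q x} := by
  rw [← Nat.card_sum]
  exact (Nat.card_congr (Equiv.ofBijective _ h.bijective)).symm

theorem isTree_iff [Finite V] [Finite W] [Finite N] : G.IsTree ↔ H.IsTree := by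
  rw [SimpleGraph.isTree_iff_connected_and_card, SimpleGraph.isTree_iff_connected_and_card,
    h.connected_iff, h.card_edgeSet, h.card_vertices]
  refine and_congr_right fun _ => ?_
  omega

open Classical in
/-- The embedding of flags. -/
def flagMap (f : {p : V × V // G.Adj p.1 p.2} ⊕ N) : {p : W × W // H.Adj p.1 p.2} ⊕ E :=
  match f with
  | .inl p => .inl ⟨(α p.1.1, α p.1.2), (h.adj _ _).2 p.2⟩
  | .inr x => if hx : IsMult q x then .inl ⟨(α (l x), j x), ((h.adj' x hx _).2 rfl).symm⟩
    -- Here x has a single preimage, so the choice is forced.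
    else .inr (h.surj x).choose

theorem flagMap_mult {x : N} (hx : IsMult q x) :
    h.flagMap (.inr x) = .inl ⟨(α (l x), j x), ((h.adj' x hx _).2 rfl).symm⟩ := dif_pos hx

theorem flagMap_triv {x : N} (hx : ¬ IsMult q x) {e : E} (he : q e = x) :
    h.flagMap (.inr x) = .inr e := by
  rw [flagMap, dif_neg hx]
  have h1 := (h.surj x).choose_spec
  by_contra hne
  exact hx ⟨_, e, fun h' => hne (congrArg Sum.inr h'), h1, he⟩

theorem base_flagMap (f : {p : V × V // G.Adj p.1 p.2} ⊕ N) :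
    Sum.elim (fun p => p.1.1) l' (h.flagMap f) = α (Sum.elim (fun p => p.1.1) l f) := by
  obtain p | x := f
  · rfl
  · by_cases hx : IsMult q x
    · rw [h.flagMap_mult hx]
      rfl
    · obtain ⟨e, he⟩ := h.surj x
      rw [h.flagMap_triv hx he]
      change l' e = α (l x)
      rw [h.leg, he, h.triv x hx]

theorem flagMap_injective : Function.Injective h.flagMap := by
  have h1 : ∀ p x, h.flagMap (.inl p) ≠ h.flagMap (.inr x) := fun p x he => by
    by_cases hx : IsMult q x
    · rw [h.flagMap_mult hx] at he
      exact h.ne x hx _ (congrArg (fun p => p.1.2) (Sum.inl.inj he))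
    · obtain ⟨e, he'⟩ := h.surj x
      rw [h.flagMap_triv hx he'] at he
      cases he
  rintro (p | x) (p' | x') he
  · have h2 := congrArg (fun p => p.1) (Sum.inl.inj he)
    exact congrArg Sum.inl (Subtype.ext (Prod.ext (h.inj (congrArg Prod.fst h2))
      (h.inj (congrArg Prod.snd h2))))
  · exact absurd he (h1 _ _)
  · exact absurd he.symm (h1 _ _)
  · obtain ⟨e, rfl⟩ := h.surj x
    obtain ⟨e', rfl⟩ := h.surj x'
    by_cases hx : IsMult q (q e) <;> by_cases hx' : IsMult q (q e')
    · rw [h.flagMap_mult hx, h.flagMap_mult hx'] at he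
      exact congrArg Sum.inr (h.inj' _ _ hx hx' (congrArg (fun p => p.1.2) (Sum.inl.inj he)))
    · rw [h.flagMap_mult hx, h.flagMap_triv hx' rfl] at he
      cases he
    · rw [h.flagMap_mult hx', h.flagMap_triv hx rfl] at he
      cases he
    · rw [h.flagMap_triv hx rfl, h.flagMap_triv hx' rfl] at he
      rw [Sum.inr.inj he]

theorem exists_flagMap_eq {y : V} {f : {p : W × W // H.Adj p.1 p.2} ⊕ E}
    (hf : Sum.elim (fun p => p.1.1) l' f = α y) : ∃ f', h.flagMap f' = f := by
  obtain ⟨⟨z, z'⟩, hz⟩ | e := f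
  · obtain rfl : z = α y := hf
    obtain ⟨y', rfl⟩ | ⟨x, hx, rfl⟩ := h.cover z'
    · exact ⟨.inl ⟨(y, y'), (h.adj _ _).1 hz⟩, rfl⟩
    · refine ⟨.inr x, ?_⟩
      rw [h.flagMap_mult hx]
      have := (h.adj' x hx _).1 (hz : H.Adj (α y) (j x)).symm
      exact congrArg Sum.inl (Subtype.ext (Prod.ext this.symm rfl))
  · refine ⟨.inr (q e), h.flagMap_triv (fun hx => ?_) rfl⟩
    change l' e = α y at hf
    exact h.ne _ hx y (by rw [← hf, h.leg])

omit h in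
theorem card_flags {E V : Type} (G : SimpleGraph V) (l : E → V) (y : V) :
    Nat.card ({y' // G.Adj y y'} ⊕ {x // l x = y}) =
      Nat.card {f : {p : V × V // G.Adj p.1 p.2} ⊕ E // Sum.elim (fun p => p.1.1) l f = y} :=
  Nat.card_congr
    { toFun := Sum.elim (fun y' => ⟨.inl ⟨(y, y'.1), y'.2⟩, rfl⟩) fun x => ⟨.inr x.1, x.2⟩
      invFun := fun f => match f with
        | ⟨.inl p, hp⟩ => .inl ⟨p.1.2, hp ▸ p.2⟩
        | ⟨.inr x, hx⟩ => .inr ⟨x, hx⟩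
      left_inv := by rintro (y | x) <;> rfl
      right_inv := by
        rintro ⟨⟨⟨y, y'⟩, hy⟩ | x, hf⟩
        · obtain rfl : y = _ := hf
          rfl
        · rfl }

/-- The valence of an old vertex does not change: a leg becomes the end of an edge if a corolla is
grafted there, and stays a leg otherwise. -/
theorem card_flags_eq (y : V) :
    Nat.card ({z // H.Adj (α y) z} ⊕ {e // l' e = α y}) =
      Nat.card ({y' // G.Adj y y'} ⊕ {x // l x = y}) := by
  rw [card_flags, card_flags]
  symm
  refine Nat.card_congr (Equiv.ofBijective (fun f => ⟨h.flagMap f.1, ?_⟩) ⟨?_, ?_⟩)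
  · rw [h.base_flagMap, f.2]
  · exact fun f f' hf => Subtype.ext (h.flagMap_injective (Subtype.ext_iff.1 hf))
  · rintro ⟨f, hf⟩
    obtain ⟨f', rfl⟩ := h.exists_flagMap_eq hf
    refine ⟨⟨f', h.inj ?_⟩, rfl⟩
    rw [← h.base_flagMap, hf]

theorem stable_iff [Finite E] [Finite W] :
    (∀ y, 3 ≤ Nat.card ({y' // G.Adj y y'} ⊕ {x // l x = y})) ↔
      ∀ z, 3 ≤ Nat.card ({z' // H.Adj z z'} ⊕ {e // l' e = z}) := by
  constructor
  · intro hG z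
    obtain ⟨y, rfl⟩ | ⟨x, hx, rfl⟩ := h.cover z
    · rw [h.card_flags_eq]
      exact hG y
    · obtain ⟨e, e', hne, he, he'⟩ := id hx
      -- A new vertex has valence at least three: the edge to the old tree and two legs. This is why
      -- corollas are grafted only at points with several preimages.
      have : Function.Injective (![Sum.inl ⟨α (l x), (h.adj' x hx _).2 rfl⟩,
          Sum.inr ⟨e, by rw [h.leg, he]⟩, Sum.inr ⟨e', by rw [h.leg, he']⟩] :
          Fin 3 → {z' // H.Adj (j x) z'} ⊕ {e // l' e = j x}) := by
        intro a b hab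
        fin_cases a <;> fin_cases b <;> simp_all [hne.symm]
      simpa using Nat.card_le_card_of_injective _ this
  · intro hH y
    rw [← h.card_flags_eq]
    exact hH _

end IsGraft

/-! ### Automorphisms and weights under grafting. -/

theorem fibExp_sumElim {α β γ : Type*} [Finite α] [Finite β] [Finite γ] {φ : Equiv.Perm α}
    {ψ : Equiv.Perm β} {τ : Equiv.Perm γ} {f : α → γ} {g : β → γ} (hf : ∀ x, f (φ x) = τ (f x))
    (hg : ∀ x, g (ψ x) = τ (g x))
    (h : ∀ x, Sum.elim f g (φ.sumCongr ψ x) = τ (Sum.elim f g x)) (O : Orb τ) :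
    fibExp (Sum.elim f g) h O = fibExp f hf O + fibExp g hg O := by
  classical
  have hb : Function.Bijective (Sum.elim (Sum.inl : α → α ⊕ β) Sum.inr) := by
    rw [Sum.elim_inl_inr]
    exact Function.bijective_id
  have h1 : ∀ x, (Sum.inl (φ x) : α ⊕ β) = φ.sumCongr ψ (Sum.inl x) := fun _ => rfl
  have h2 : ∀ x, (Sum.inr (ψ x) : α ⊕ β) = φ.sumCongr ψ (Sum.inr x) := fun _ => rfl
  have h3 : ∀ c, Orb.map (Sum.elim f g) h (Orb.map Sum.inl h1 c) = Orb.map f hf c := fun c => by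
    obtain ⟨x, rfl⟩ := Orb.mk_surjective _ c
    rfl
  have h4 : ∀ c, Orb.map (Sum.elim f g) h (Orb.map Sum.inr h2 c) = Orb.map g hg c := fun c => by
    obtain ⟨x, rfl⟩ := Orb.mk_surjective _ c
    rfl
  have := Orb.prod_eq_mul h1 h2 hb (fun c => Multiplicative.ofAdd
    (if Orb.map (Sum.elim f g) h c = O then
      Finsupp.single ((c.len : ℕ) / O.len).toPNat' 1 else (0 : ℕ+ →₀ ℕ)))
  simp only [Orb.len_map_of_injective h1 Sum.inl_injective,
    Orb.len_map_of_injective h2 Sum.inr_injective, h3, h4] at this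
  simp only [fibExp, Finset.sum_filter]
  exact this

theorem ev_p_one_sub_dp₁ {k : Type u} [Field k] (f : SymFun k) (d : ℕ+ →₀ ℕ) :
    (SymFun.p 1 - f.dp₁).ev d =
      (if expWt d = 1 then 1 else 0) - f.ev (d + Finsupp.single 1 1) := by
  rw [SymFun.ev_sub, SymFun.ev_p_one_of_expWt, SymFun.ev_dp₁]

theorem IsMult.apply_iff {E N : Type} {q : E → N} {σ : Equiv.Perm E} {ρ : Equiv.Perm N}
    (hq : ∀ e, q (σ e) = ρ (q e)) (x : N) : IsMult q (ρ x) ↔ IsMult q x := by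
  constructor
  · rintro ⟨e, e', hne, he, he'⟩
    refine ⟨σ.symm e, σ.symm e', σ.symm.injective.ne hne, ρ.injective ?_, ρ.injective ?_⟩
    · rw [← hq, σ.apply_symm_apply, he]
    · rw [← hq, σ.apply_symm_apply, he']
  · rintro ⟨e, e', hne, rfl, he'⟩
    exact ⟨σ e, σ e', σ.injective.ne hne, hq e, by rw [hq, he']⟩

/-- The permutation of the points with at least two preimages. -/
def multPerm {E N : Type} {q : E → N} {σ : Equiv.Perm E} {ρ : Equiv.Perm N}
    (hq : ∀ e, q (σ e) = ρ (q e)) : Equiv.Perm {x // IsMult q x} :=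
  ρ.subtypePerm fun x => IsMult.apply_iff hq x

section IsGraft

variable {E N V W : Type} {t : STree N V} {q : E → N} {t' : STree E W} {α : V → W} {j : N → W}
  (h : IsGraft t.graph t.leg q t'.graph t'.leg α j) {τ : Equiv.Perm V} {ρ : Equiv.Perm N}
  {τ' : Equiv.Perm W} {σ : Equiv.Perm E} (hq : ∀ e, q (σ e) = ρ (q e))
  (hα : ∀ y, α (τ y) = τ' (α y)) (hj : ∀ x, j (ρ x) = τ' (j x))

include h hq hα hj

/-- In the backward direction the vertex carrying the leg x is recovered from H as the only
neighbour of the corolla at x, or as j x itself if no corolla is grafted there. -/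
theorem IsGraft.isAut_iff : t.IsAut τ ρ ↔ t'.IsAut τ' σ := by
  constructor
  · intro ht
    have hx : ∀ x, IsMult q x → ∀ z, t'.graph.Adj (τ' (j x)) (τ' z) ↔ t'.graph.Adj (j x) z :=
      fun x hx z => by
        rw [← hj, h.adj' _ ((IsMult.apply_iff hq x).2 hx), h.adj' _ hx, ht.leg, hα,
          τ'.injective.eq_iff]
    refine ⟨fun z z' => ?_, fun e => by rw [h.leg, h.leg, hq, hj]⟩
    obtain ⟨y, rfl⟩ | ⟨x, hx', rfl⟩ := h.cover z
    · obtain ⟨y', rfl⟩ | ⟨x, hx', rfl⟩ := h.cover z'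
      · rw [← hα, ← hα, h.adj, h.adj, ht.adj]
      · rw [SimpleGraph.adj_comm, hx _ hx', SimpleGraph.adj_comm]
    · exact hx _ hx' _
  · intro ht
    refine ⟨fun y y' => by rw [← h.adj, ← h.adj, hα, hα, ht.adj], fun x => h.inj ?_⟩
    by_cases hx : IsMult q x
    · rw [hα]
      have := (h.adj' x hx _).2 rfl
      rw [← ht.adj, ← hj, h.adj' _ ((IsMult.apply_iff hq x).2 hx)] at this
      exact this.symm
    · rw [hα, ← h.triv _ hx, ← hj, h.triv _ fun h' => hx ((IsMult.apply_iff hq x).1 h')]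

theorem IsGraft.flagMap_perm (ht : t.IsAut τ ρ) (ht' : t'.IsAut τ' σ) (f : t.Flag) :
    h.flagMap (ht.perm f) = ht'.perm (h.flagMap f) := by
  obtain p | x := f
  · exact congrArg Sum.inl (Subtype.ext (Prod.ext (hα _) (hα _)))
  · by_cases hx : IsMult q x
    · rw [h.flagMap_mult hx]
      refine (h.flagMap_mult ((IsMult.apply_iff hq x).2 hx)).trans ?_
      refine congrArg Sum.inl (Subtype.ext (Prod.ext ?_ (hj x)))
      change α (t.leg (ρ x)) = τ' (α (t.leg x))
      rw [ht.leg, hα]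
    · obtain ⟨e, he⟩ := h.surj x
      rw [h.flagMap_triv hx he]
      exact h.flagMap_triv (fun h' => hx ((IsMult.apply_iff hq x).1 h')) (by rw [hq, he])

variable [Finite E] [Finite N] [Finite V] [Finite W]

theorem IsGraft.fibExp_base (ht : t.IsAut τ ρ) (ht' : t'.IsAut τ' σ) (O : Orb τ) :
    fibExp t'.base ht'.base_perm (Orb.map α hα O) = fibExp t.base ht.base_perm O :=
  fibExp_of_cartesian ht.base_perm ht'.base_perm h.flagMap α
    (h.flagMap_perm hq hα hj ht ht') hα h.flagMap_injective h.inj h.base_flagMap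
    (fun _ _ hy => h.exists_flagMap_eq hy) O

omit hα [Finite V] in
-- The flags at a corolla are the fibre of q and one edge end. The edge end is fixed by the first
-- return, which adds the 1-cycle; removing it is the effect of ∂/∂p₁.
theorem IsGraft.fibExp_corolla (ht' : t'.IsAut τ' σ) (O : Orb (multPerm hq)) :
    fibExp t'.base ht'.base_perm (Orb.map (ρ := τ') (fun x => j x.1) (fun x => hj x.1) O) =
      fibExp q hq (Orb.map (ρ := ρ) Subtype.val (fun _ => rfl) O) + Finsupp.single 1 1 := by
  have h1 : ∀ p : {p : W × W // t'.graph.Adj p.1 p.2},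
      ((Equiv.subtypeEquiv (Equiv.prodCongr τ' τ') fun p => (ht'.adj p.1 p.2).symm :
        Equiv.Perm {p : W × W // t'.graph.Adj p.1 p.2}) p).1.1 = τ' p.1.1 := fun _ => rfl
  refine (fibExp_sumElim h1 ht'.leg _ _).trans ?_
  rw [add_comm]
  congr 1
  · have hs : ∀ e, IsMult q (q (σ e)) ↔ IsMult q (q e) := fun e => by
      rw [hq, IsMult.apply_iff hq]
    let σ' : Equiv.Perm {e // IsMult q (q e)} := σ.subtypePerm hs
    have hq' : ∀ e : {e // IsMult q (q e)}, (⟨q (σ' e).1, (σ' e).2⟩ : {x // IsMult q x}) =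
        multPerm hq ⟨q e.1, e.2⟩ := fun e => Subtype.ext (hq e)
    rw [fibExp_of_cartesian (π := fun e : {e // IsMult q (q e)} =>
        (⟨q e.1, e.2⟩ : {x // IsMult q x})) hq' ht'.leg Subtype.val (fun x : {x // IsMult q x} => j x.1)
      (fun _ => rfl) (fun x => hj x.1) Subtype.val_injective
      (fun x x' hx => Subtype.ext (h.inj' _ _ x.2 x'.2 hx)) (fun e => h.leg e.1),
      fibExp_of_cartesian (π := fun e : {e // IsMult q (q e)} =>
        (⟨q e.1, e.2⟩ : {x // IsMult q x})) hq' hq Subtype.val Subtype.val (fun _ => rfl) (fun _ => rfl)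
      Subtype.val_injective Subtype.val_injective fun _ => rfl]
    · rintro e ⟨x, hx⟩ he
      exact ⟨⟨e, by rw [he]; exact hx⟩, rfl⟩
    · rintro e ⟨x, hx⟩ he
      refine ⟨⟨e, ?_⟩, rfl⟩
      by_contra hne
      rw [h.leg, h.triv _ hne] at he
      exact h.ne x hx _ he
  · obtain ⟨x, rfl⟩ := Orb.mk_surjective _ O
    refine eq_single_of_expWt_eq_one ?_
    refine (expWt_fibExp (fun p : {p : W × W // t'.graph.Adj p.1 p.2} => p.1.1) h1 _).trans ?_
    rw [Nat.card_eq_one_iff_exists]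
    refine ⟨⟨⟨(j x.1, α (t.leg x.1)), (h.adj' _ x.2 _).2 rfl⟩, rfl⟩, ?_⟩
    rintro ⟨⟨⟨z, z'⟩, hz⟩, hzj⟩
    obtain rfl : z = j x.1 := hzj
    refine Subtype.ext (Subtype.ext (Prod.ext rfl ?_))
    exact (h.adj' _ x.2 _).1 hz

/-- Over a singleton fibre p₁ - f' has value 1, because f vanishes in weight 2. Over a larger fibre
p₁ vanishes and -f' is minus the weight of the grafted corolla. The old vertices keep their flags,
and hence their factors. -/
theorem IsGraft.weight_eq {k : Type u} [Field k] {f : SymFun k}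
    (hf : ∀ d, expWt d ≤ 2 → f.ev d = 0) (ht : t.IsAut τ ρ) (ht' : t'.IsAut τ' σ)
    {A : Finset (Orb τ')} (hA : ∀ z, Orb.mk τ' z ∈ A ↔ ∀ y, α y ≠ z) :
    t'.weight f ht' * (-1) ^ A.card = t.weight f ht * orbWeight (SymFun.p 1 - f.dp₁) q hq := by
  classical
  have hj' : ∀ x : {x // IsMult q x}, j (multPerm hq x).1 = τ' (j x.1) := fun x => hj x.1
  have hv : ∀ x : {x // IsMult q x}, (multPerm hq x).1 = ρ x.1 := fun _ => rfl
  have h1 : ((-1) ^ A.card : k) = ∏ O : Orb τ', if O ∈ A then -1 else 1 := by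
    rw [Finset.prod_ite_mem, Finset.univ_inter, Finset.prod_const]
  rw [h1, STree.weight, orbWeight, ← Finset.prod_mul_distrib,
    Orb.prod_eq_mul hα hj' h.bijective, STree.weight, orbWeight, orbWeight]
  congr 1
  · refine Finset.prod_congr rfl fun O _ => ?_
    rw [h.fibExp_base hq hα hj ht ht']
    obtain ⟨y, rfl⟩ := Orb.mk_surjective _ O
    rw [Orb.map_mk, if_neg fun h' => (hA _).1 h' y rfl, mul_one]
  · refine Fintype.prod_of_injective (Orb.map Subtype.val hv)
      (Orb.map_injective hv Subtype.val_injective) _ _ ?_ ?_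
    · intro O hO
      obtain ⟨x, rfl⟩ := Orb.mk_surjective _ O
      have hx : ¬ IsMult q x := fun hx => hO ⟨Orb.mk _ ⟨x, hx⟩, rfl⟩
      have hc : Nat.card {e // q e = x} = 1 := by
        rw [Nat.card_eq_one_iff_exists]
        obtain ⟨e, he⟩ := h.surj x
        refine ⟨⟨e, he⟩, fun e' => Subtype.ext ?_⟩
        by_contra hne
        exact hx ⟨_, _, hne, e'.2, he⟩
      rw [ev_p_one_sub_dp₁, hf, expWt_fibExp, if_pos hc, sub_zero]
      rw [expWt_add, expWt_fibExp, hc]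
      simp
    · intro O
      rw [h.fibExp_corolla hq hj ht', ev_p_one_sub_dp₁]
      obtain ⟨x, rfl⟩ := Orb.mk_surjective _ O
      rw [Orb.map_mk, Orb.map_mk, if_pos ((hA _).2 (h.ne _ x.2)), if_neg, mul_neg_one, zero_sub]
      · rfl
      rw [expWt_fibExp, Nat.card_eq_one_iff_exists]
      rintro ⟨e₀, he₀⟩
      obtain ⟨e, e', hne, he, he'⟩ := x.2
      exact hne (congrArg Subtype.val ((he₀ ⟨e, he⟩).trans (he₀ ⟨e', he'⟩).symm))

end IsGraft

/-! ### Grafting data, prunable vertex sets and their correspondence. -/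

/-- A set of vertices which can be pruned: leaves of the tree, no two of them adjacent. -/
def IsPrunable {W : Type} (G : SimpleGraph W) (S : W → Prop) : Prop :=
  ∀ z, S z → ∃ w, ¬ S w ∧ ∀ y, G.Adj z y ↔ y = w

/-- A tree with legs `N` and vertices `V`, together with a map from `E` onto its set of legs, and
automorphisms of all this over the permutation `σ` of `E`. -/
def GraftSource {E : Type} (σ : Equiv.Perm E) (N V : Type) : Type :=
  Σ ρ : Equiv.Perm N, Σ τ : Equiv.Perm V,
    {t : STree N V // t.IsAut τ ρ} × {q : EquivariantMap σ ρ // Function.Surjective q.1}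

/-- A tree with legs `E` and vertices `W`, together with a prunable set of vertices, and an
automorphism of all this over the permutation `σ` of `E`. -/
def GraftTarget {E : Type} (σ : Equiv.Perm E) (W : Type) : Type :=
  Σ τ : Equiv.Perm W, Σ t : {t : STree E W // t.IsAut τ σ},
    {A : Finset (Orb τ) // IsPrunable t.1.graph fun z => Orb.mk τ z ∈ A}

namespace GraftSource

variable {E N V W : Type} {σ : Equiv.Perm E}

abbrev permN (a : GraftSource σ N V) : Equiv.Perm N := a.1
abbrev permV (a : GraftSource σ N V) : Equiv.Perm V := a.2.1
abbrev tree (a : GraftSource σ N V) : STree N V := a.2.2.1.1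
theorem isAut (a : GraftSource σ N V) : a.tree.IsAut a.permV a.permN := a.2.2.1.2
abbrev q (a : GraftSource σ N V) : E → N := a.2.2.2.1.1
theorem q_perm (a : GraftSource σ N V) (e : E) : a.q (σ e) = a.permN (a.q e) := a.2.2.2.1.2 e
theorem q_surjective (a : GraftSource σ N V) : Function.Surjective a.q := a.2.2.2.2

theorem ext {a b : GraftSource σ N V} (h1 : a.permN = b.permN) (h2 : a.permV = b.permV)
    (h3 : a.tree = b.tree) (h4 : a.q = b.q) : a = b := by
  obtain ⟨ρ, τ, ⟨t, ht⟩, ⟨⟨q, hq⟩, hs⟩⟩ := a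
  obtain ⟨ρ', τ', ⟨t', ht'⟩, ⟨⟨q', hq'⟩, hs'⟩⟩ := b
  obtain rfl : ρ = ρ' := h1
  obtain rfl : τ = τ' := h2
  obtain rfl : t = t' := h3
  obtain rfl : q = q' := h4
  rfl

instance [Finite E] [Finite N] [Finite V] : Fintype (GraftSource σ N V) :=
  @Fintype.ofFinite _ (inferInstanceAs (Finite (Σ ρ : Equiv.Perm N, Σ τ : Equiv.Perm V,
    {t : STree N V // t.IsAut τ ρ} × {q : EquivariantMap σ ρ // Function.Surjective q.1})))

end GraftSource

namespace GraftTarget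

variable {E N V W : Type} {σ : Equiv.Perm E}

abbrev perm (b : GraftTarget σ W) : Equiv.Perm W := b.1
abbrev tree (b : GraftTarget σ W) : STree E W := b.2.1.1
theorem isAut (b : GraftTarget σ W) : b.tree.IsAut b.perm σ := b.2.1.2
abbrev orbits (b : GraftTarget σ W) : Finset (Orb b.perm) := b.2.2.1
abbrev IsPruned (b : GraftTarget σ W) (z : W) : Prop := Orb.mk b.perm z ∈ b.orbits
theorem isPrunable (b : GraftTarget σ W) : IsPrunable b.tree.graph b.IsPruned := b.2.2.2

theorem ext {a b : GraftTarget σ W} (h1 : a.perm = b.perm) (h2 : a.tree = b.tree)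
    (h3 : ∀ z, a.IsPruned z ↔ b.IsPruned z) : a = b := by
  obtain ⟨τ, ⟨t, ht⟩, ⟨A, hA⟩⟩ := a
  obtain ⟨τ', ⟨t', ht'⟩, ⟨A', hA'⟩⟩ := b
  obtain rfl : τ = τ' := h1
  obtain rfl : t = t' := h2
  obtain rfl : A = A' := Finset.ext fun O => by
    obtain ⟨z, rfl⟩ := Orb.mk_surjective _ O
    exact h3 z
  rfl

instance [Finite E] [Finite W] : Fintype (GraftTarget σ W) :=
  @Fintype.ofFinite _ (inferInstanceAs (Finite (Σ τ : Equiv.Perm W, Σ t : {t : STree E W //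
    t.IsAut τ σ}, {A : Finset (Orb τ) // IsPrunable t.1.graph fun z => Orb.mk τ z ∈ A})))

end GraftTarget

/-- The tree `b` is obtained from `a` by grafting, and pruning it gives back `a`. -/
structure IsGraftOf {E N V W : Type} {σ : Equiv.Perm E} (a : GraftSource σ N V)
    (b : GraftTarget σ W) (α : V → W) (j : N → W) : Prop where
  graft : IsGraft a.tree.graph a.tree.leg a.q b.tree.graph b.tree.leg α j
  perm_vertex : ∀ y, α (a.permV y) = b.perm (α y)
  perm_leg : ∀ x, j (a.permN x) = b.perm (j x)
  isPruned : ∀ z, b.IsPruned z ↔ ∀ y, α y ≠ z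

section

variable {E N V W : Type} {σ : Equiv.Perm E}

/-- Pairs of a vertex map and a leg map which exhibit `b` as obtained from `a` by grafting. -/
abbrev GraftRel (a : GraftSource σ N V) (b : GraftTarget σ W) : Type :=
  {p : (V → W) × (N → W) // IsGraftOf a b p.1 p.2}

theorem IsGraftOf.target_ext {a : GraftSource σ N V} {b b' : GraftTarget σ W} {α : V → W}
    {j : N → W} (h : IsGraftOf a b α j) (h' : IsGraftOf a b' α j) : b = b' := by
  refine GraftTarget.ext (Equiv.ext fun z => ?_) (STree.ext ?_ ?_) fun z => ?_
  · obtain ⟨y, rfl⟩ | ⟨x, -, rfl⟩ := h.graft.cover z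
    · rw [← h.perm_vertex, ← h'.perm_vertex]
    · rw [← h.perm_leg, ← h'.perm_leg]
  · ext z z'
    obtain ⟨y, rfl⟩ | ⟨x, hx, rfl⟩ := h.graft.cover z
    · obtain ⟨y', rfl⟩ | ⟨x', hx', rfl⟩ := h.graft.cover z'
      · rw [h.graft.adj, h'.graft.adj]
      · rw [SimpleGraph.adj_comm, h.graft.adj' x' hx', SimpleGraph.adj_comm, h'.graft.adj' x' hx']
    · rw [h.graft.adj' x hx, h'.graft.adj' x hx]
  · exact funext fun e => by rw [h.graft.leg, h'.graft.leg]
  · rw [h.isPruned, h'.isPruned]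

theorem exists_isGraftOf [Finite E] [Finite N] [Finite V] (a : GraftSource σ N V)
    (ε : V ⊕ {x // IsMult a.q x} ≃ W) : ∃ (b : GraftTarget σ W) (α : V → W) (j : N → W),
      IsGraftOf a b α j ∧ ∀ s, ε s = Sum.elim α (fun x : {x // IsMult a.q x} => j x) s := by
  classical
  have : Finite W := Finite.of_equiv _ ε
  let j : N → W := fun x => if hx : IsMult a.q x then ε (.inr ⟨x, hx⟩) else ε (.inl (a.tree.leg x))
  have hj : ∀ x (hx : IsMult a.q x), j x = ε (.inr ⟨x, hx⟩) := fun x hx => dif_pos hx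
  have hj' : ∀ x (hx : ¬ IsMult a.q x), j x = ε (.inl (a.tree.leg x)) := fun x hx => dif_neg hx
  let H₀ : SimpleGraph (V ⊕ {x // IsMult a.q x}) :=
    { Adj := fun s s' => match s, s' with
        | .inl y, .inl y' => a.tree.graph.Adj y y'
        | .inl y, .inr x => y = a.tree.leg x
        | .inr x, .inl y => y = a.tree.leg x
        | .inr _, .inr _ => False
      symm := ⟨by
        rintro (y | x) (y' | x') hs
        · exact SimpleGraph.Adj.symm hs
        · exact hs
        · exact hs
        · exact hs⟩
      loopless := ⟨by
        rintro (y | x) hs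
        · exact SimpleGraph.irrefl _ hs
        · exact hs⟩ }
  let H : SimpleGraph W := H₀.comap ε.symm
  have hH : ∀ s s', H.Adj (ε s) (ε s') ↔ H₀.Adj s s' := fun s s' => by simp [H]
  let τ' : Equiv.Perm W := (ε.symm.trans (a.permV.sumCongr (multPerm a.q_perm))).trans ε
  have hτ' : ∀ s, τ' (ε s) = ε (a.permV.sumCongr (multPerm a.q_perm) s) := fun s => by
    simp [τ']
  have hg : IsGraft a.tree.graph a.tree.leg a.q H (fun e => j (a.q e)) (fun y => ε (.inl y)) j :=
    { inj := ε.injective.comp Sum.inl_injective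
      surj := a.q_surjective
      triv := hj'
      ne := fun x hx y he => by
        rw [hj x hx] at he
        cases ε.injective he
      inj' := fun x x' hx hx' he => by
        rw [hj x hx, hj x' hx'] at he
        exact congrArg Subtype.val (Sum.inr.inj (ε.injective he))
      cover := fun z => by
        obtain ⟨y | x, rfl⟩ := ε.surjective z
        · exact Or.inl ⟨y, rfl⟩
        · exact Or.inr ⟨x.1, x.2, hj _ x.2⟩
      leg := fun _ => rfl
      adj := fun y y' => hH _ _
      adj' := fun x hx z => by
        obtain ⟨y | x', rfl⟩ := ε.surjective z
        · rw [hj x hx, hH, ε.injective.eq_iff, Sum.inl_injective.eq_iff]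
        · rw [hj x hx, hH, ε.injective.eq_iff]
          exact iff_of_false id (by simp) }
  have hα : ∀ y, ε (.inl (a.permV y)) = τ' (ε (.inl y)) := fun y => by rw [hτ']; rfl
  have hjp : ∀ x, j (a.permN x) = τ' (j x) := fun x => by
    by_cases hx : IsMult a.q x
    · rw [hj _ hx, hj _ ((IsMult.apply_iff a.q_perm x).2 hx), hτ']
      rfl
    · rw [hj' _ hx, hj' _ fun h => hx ((IsMult.apply_iff a.q_perm x).1 h), hτ', a.isAut.leg]
      rfl
  let t' : STree E W := ⟨H, hg.isTree_iff.1 a.tree.isTree, fun e => j (a.q e),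
    hg.stable_iff.1 a.tree.stable⟩
  have ht' : t'.IsAut τ' σ := (IsGraft.isAut_iff (t' := t') hg a.q_perm hα hjp).1 a.isAut
  let A : Finset (Orb τ') := Finset.univ.filter fun O => ∀ y, ε (.inl y) ≠ O.out
  have hpow : ∀ (i : ℕ) z, (∃ y, ε (.inl y) = (τ' ^ i) z) ↔ ∃ y, ε (.inl y) = z := fun i z => by
    have h1 := fun y => Orb.semiconj_pow (π := fun y => ε (.inl y)) hα i y
    constructor
    · rintro ⟨y, hy⟩
      refine ⟨(a.permV ^ i).symm y, (τ' ^ i).injective ?_⟩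
      rw [← h1, Equiv.apply_symm_apply, hy]
    · rintro ⟨y, rfl⟩
      exact ⟨(a.permV ^ i) y, h1 y⟩
  have hA : ∀ z, Orb.mk τ' z ∈ A ↔ ∀ y, ε (.inl y) ≠ z := fun z => by
    obtain ⟨i, hi⟩ := Orb.exists_pow (Orb.mk_out (Orb.mk τ' z))
    rw [Finset.mem_filter]
    simp only [Finset.mem_univ, true_and, ← not_exists]
    conv_rhs => rw [← hi]
    rw [hpow]
  have hpr : IsPrunable t'.graph fun z => Orb.mk τ' z ∈ A := fun z hz => by
    obtain ⟨y, hy⟩ | ⟨x, hx, rfl⟩ := hg.cover z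
    · exact absurd hy ((hA z).1 hz y)
    · exact ⟨_, fun h => (hA _).1 h _ rfl, hg.adj' x hx⟩
  refine ⟨⟨τ', ⟨t', ht'⟩, A, hpr⟩, fun y => ε (.inl y), j, ⟨hg, hα, hjp, hA⟩, ?_⟩
  rintro (y | x)
  · rfl
  · exact (hj x.1 x.2).symm

/-- Grafting is determined by a labelling of the vertices of the resulting tree. -/
theorem card_sigma_graftRel [Finite E] [Finite N] [Finite V] (a : GraftSource σ N V) :
    Nat.card (Σ b : GraftTarget σ W, GraftRel a b) =
      Nat.card (V ⊕ {x // IsMult a.q x} ≃ W) := by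
  refine Nat.card_congr (Equiv.ofBijective
    (fun s => Equiv.ofBijective _ s.2.2.graft.bijective) ⟨?_, fun ε => ?_⟩)
  · rintro ⟨b, ⟨α, j⟩, h⟩ ⟨b', ⟨α', j'⟩, h'⟩ he
    have he' := fun s => DFunLike.congr_fun he s
    obtain rfl : α = α' := funext fun y => he' (.inl y)
    obtain rfl : j = j' := funext fun x => by
      by_cases hx : IsMult a.q x
      · exact he' (.inr ⟨x, hx⟩)
      · exact (h.graft.triv x hx).trans (h'.graft.triv x hx).symm
    obtain rfl := h.target_ext h'
    rfl
  · obtain ⟨b, α, j, h, hs⟩ := exists_isGraftOf a ε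
    exact ⟨⟨b, ⟨α, j⟩, h⟩, Equiv.ext fun s => (hs s).symm⟩

end

section

variable {E N V W : Type} {σ : Equiv.Perm E}

/-- The legs of the tree which results from pruning: the legs of the other vertices, and a leg for
each pruned vertex. -/
abbrev GraftTarget.Leg (b : GraftTarget σ W) : Type :=
  {e // ¬ b.IsPruned (b.tree.leg e)} ⊕ {z // b.IsPruned z}

/-- Since q is onto, it determines the permutation of the legs and the map j; the tree is read off
from b through α and j. -/
theorem IsGraftOf.source_ext {a a' : GraftSource σ N V} {b : GraftTarget σ W} {α : V → W}
    {j j' : N → W} (h : IsGraftOf a b α j) (h' : IsGraftOf a' b α j') (hq : a.q = a'.q) :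
    a = a' ∧ j = j' := by
  have hj : j = j' := funext fun x => by
    obtain ⟨e, rfl⟩ := a.q_surjective x
    rw [← h.graft.leg, h'.graft.leg, hq]
  subst hj
  refine ⟨GraftSource.ext (Equiv.ext fun x => ?_) (Equiv.ext fun y => ?_) (STree.ext ?_ ?_) hq, rfl⟩
  · obtain ⟨e, rfl⟩ := a.q_surjective x
    rw [← a.q_perm, hq, a'.q_perm]
  · refine h.graft.inj ?_
    rw [h.perm_vertex, h'.perm_vertex]
  · ext y y'
    rw [← h.graft.adj, h'.graft.adj]
  · refine funext fun x => h.graft.inj ?_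
    by_cases hx : IsMult a.q x
    · rw [← h'.graft.adj' x (hq ▸ hx), h.graft.adj' x hx]
    · rw [← h.graft.triv x hx, h'.graft.triv x (hq ▸ hx)]

theorem IsGraftOf.isPruned_iff {a : GraftSource σ N V} {b : GraftTarget σ W} {α : V → W}
    {j : N → W} (h : IsGraftOf a b α j) (x : N) : b.IsPruned (j x) ↔ IsMult a.q x := by
  rw [h.isPruned]
  constructor
  · intro hx
    by_contra hne
    exact hx _ (h.graft.triv x hne).symm
  · exact h.graft.ne x

/-- The vertices of the pruned tree. -/
def IsGraftOf.vertexEquiv {a : GraftSource σ N V} {b : GraftTarget σ W} {α : V → W}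
    {j : N → W} (h : IsGraftOf a b α j) : V ≃ {z // ¬ b.IsPruned z} :=
  Equiv.ofBijective (fun y => ⟨α y, fun h' => (h.isPruned _).1 h' y rfl⟩)
    ⟨fun _ _ he => h.graft.inj (Subtype.ext_iff.1 he), fun z => by
      have := z.2
      rw [h.isPruned] at this
      push Not at this
      exact this.imp fun y hy => Subtype.ext hy⟩

theorem IsGraftOf.exists_mult {a : GraftSource σ N V} {b : GraftTarget σ W} {α : V → W}
    {j : N → W} (h : IsGraftOf a b α j) (z : W) (hz : b.IsPruned z) :
    ∃ x, IsMult a.q x ∧ j x = z := by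
  obtain ⟨y, hy⟩ | hx := h.graft.cover z
  · exact absurd hy ((h.isPruned z).1 hz y)
  · exact hx

/-- The legs of the pruned tree. -/
def IsGraftOf.legMap {a : GraftSource σ N V} {b : GraftTarget σ W} {α : V → W}
    {j : N → W} (h : IsGraftOf a b α j) : b.Leg → N
  | .inl e => a.q e
  | .inr z => (h.exists_mult z.1 z.2).choose

theorem IsGraftOf.legMap_inr {a : GraftSource σ N V} {b : GraftTarget σ W} {α : V → W}
    {j : N → W} (h : IsGraftOf a b α j) {x : N} (hx : IsMult a.q x) :
    h.legMap (.inr ⟨j x, (h.isPruned_iff x).2 hx⟩) = x := by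
  have := (h.exists_mult (j x) ((h.isPruned_iff x).2 hx)).choose_spec
  exact h.graft.inj' _ _ this.1 hx this.2

theorem IsGraftOf.legMap_bijective {a : GraftSource σ N V} {b : GraftTarget σ W} {α : V → W}
    {j : N → W} (h : IsGraftOf a b α j) : Function.Bijective h.legMap := by
  have h1 : ∀ e : {e // ¬ b.IsPruned (b.tree.leg e)}, ¬ IsMult a.q (a.q e) := fun e he => by
    rw [← h.isPruned_iff, ← h.graft.leg] at he
    exact e.2 he
  have h2 : ∀ z : {z // b.IsPruned z}, ∃ x, ∃ hx : IsMult a.q x,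
      z = ⟨j x, (h.isPruned_iff x).2 hx⟩ := fun z => by
    obtain ⟨x, hx, hz⟩ := h.exists_mult z.1 z.2
    exact ⟨x, hx, Subtype.ext hz.symm⟩
  constructor
  · rintro (e | z) (e' | z') he
    · refine congrArg Sum.inl (Subtype.ext ?_)
      by_contra hne
      exact h1 e ⟨e, e', hne, rfl, he.symm⟩
    · obtain ⟨x, hx, rfl⟩ := h2 z'
      rw [h.legMap_inr hx] at he
      refine absurd ?_ (h1 e)
      rwa [show a.q e = x from he]
    · obtain ⟨x, hx, rfl⟩ := h2 z
      rw [h.legMap_inr hx] at he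
      refine absurd ?_ (h1 e')
      rwa [show a.q e' = x from he.symm]
    · obtain ⟨x, hx, rfl⟩ := h2 z
      obtain ⟨x', hx', rfl⟩ := h2 z'
      rw [h.legMap_inr hx, h.legMap_inr hx'] at he
      subst he
      rfl
  · intro x
    by_cases hx : IsMult a.q x
    · exact ⟨_, h.legMap_inr hx⟩
    · obtain ⟨e, rfl⟩ := a.q_surjective x
      refine ⟨.inl ⟨e, ?_⟩, rfl⟩
      rw [h.graft.leg, h.isPruned_iff]
      exact hx

/-- This is pruning: the marked leaves are deleted, and each leaves behind one leg at its unique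
neighbour, which is not marked. The map q collapses the legs of a deleted leaf to that new leg. -/
theorem exists_isGraftOf_source [Finite E] [Finite W] (b : GraftTarget σ W)
    (ε : V ≃ {z // ¬ b.IsPruned z}) (μ : b.Leg ≃ N) :
    ∃ (a : GraftSource σ N V) (α : V → W) (j : N → W) (h : IsGraftOf a b α j),
      h.vertexEquiv = ε ∧ ∀ s, h.legMap s = μ s := by
  classical
  have : Finite V := Finite.of_equiv _ ε.symm
  have : Finite N := Finite.of_equiv _ μ
  choose nb hnb hnb' using b.isPrunable
  let q : E → N := fun e => if h : b.IsPruned (b.tree.leg e) then μ (.inr ⟨_, h⟩)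
    else μ (.inl ⟨e, h⟩)
  have hq1 : ∀ e (h : b.IsPruned (b.tree.leg e)), q e = μ (.inr ⟨_, h⟩) := fun e h => dif_pos h
  have hq2 : ∀ e (h : ¬ b.IsPruned (b.tree.leg e)), q e = μ (.inl ⟨e, h⟩) := fun e h => dif_neg h
  let j : N → W := fun x => Sum.elim (fun e => b.tree.leg e.1) Subtype.val (μ.symm x)
  have hj : ∀ s, j (μ s) = Sum.elim (fun e => b.tree.leg e.1) Subtype.val s := fun s => by
    simp [j]
  let l : N → V := fun x => ε.symm (Sum.elim (fun e => ⟨b.tree.leg e.1, e.2⟩)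
    (fun z => ⟨nb z.1 z.2, hnb z.1 z.2⟩) (μ.symm x))
  have hl : ∀ s, (ε (l (μ s))).1 = Sum.elim (fun e => b.tree.leg e.1)
      (fun z => nb z.1 z.2) s := fun s => by
    obtain e | z := s <;> simp [l]
  -- A pruned vertex lies on only one edge, so stability gives it at least two legs.
  have hm1 : ∀ z, IsMult q (μ (.inr z)) := fun z => by
    have h1 : Nat.card {y // b.tree.graph.Adj z.1 y} = 1 := by
      rw [Nat.card_eq_one_iff_exists]
      exact ⟨⟨_, (hnb' z.1 z.2 _).2 rfl⟩, fun y => Subtype.ext ((hnb' z.1 z.2 _).1 y.2)⟩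
    have h2 := b.tree.stable z.1
    rw [Nat.card_sum, h1] at h2
    have h3 : 1 < Nat.card {e // b.tree.leg e = z.1} := by omega
    rw [Finite.one_lt_card_iff_nontrivial] at h3
    obtain ⟨e, e', hne⟩ := h3
    have h4 : ∀ e : {e // b.tree.leg e = z.1}, q e.1 = μ (.inr z) := fun e => by
      have : b.IsPruned (b.tree.leg e.1) := by rw [e.2]; exact z.2
      rw [hq1 _ this]
      exact congrArg (fun z => μ (.inr z)) (Subtype.ext e.2)
    exact ⟨e.1, e'.1, fun h => hne (Subtype.ext h), h4 e, h4 e'⟩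
  have hm2 : ∀ e, ¬ IsMult q (μ (.inl e)) := by
    rintro e ⟨e₁, e₂, hne, h1, h2⟩
    have h3 : ∀ e', q e' = μ (.inl e) → e' = e.1 := fun e' he' => by
      by_cases h : b.IsPruned (b.tree.leg e')
      · rw [hq1 e' h] at he'
        cases μ.injective he'
      · rw [hq2 e' h] at he'
        exact congrArg Subtype.val (Sum.inl.inj (μ.injective he'))
    exact hne ((h3 _ h1).trans (h3 _ h2).symm)
  have hg : IsGraft (b.tree.graph.comap fun y => (ε y).1) l q b.tree.graph b.tree.leg
      (fun y => (ε y).1) j :=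
    { inj := Subtype.val_injective.comp ε.injective
      surj := fun x => by
        obtain ⟨e | z, rfl⟩ := μ.surjective x
        · exact ⟨e.1, hq2 e.1 e.2⟩
        · obtain ⟨e, -, -, he, -⟩ := hm1 z
          exact ⟨e, he⟩
      triv := fun x hx => by
        obtain ⟨e | z, rfl⟩ := μ.surjective x
        · rw [hj, hl]
          rfl
        · exact absurd (hm1 z) hx
      ne := fun x hx y he => by
        obtain ⟨e | z, rfl⟩ := μ.surjective x
        · exact hm2 e hx
        · rw [hj] at he
          refine (ε y).2 ?_
          rw [he]
          exact z.2
      inj' := fun x x' hx hx' he => by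
        obtain ⟨e | z, rfl⟩ := μ.surjective x
        · exact absurd hx (hm2 e)
        obtain ⟨e' | z', rfl⟩ := μ.surjective x'
        · exact absurd hx' (hm2 e')
        rw [hj, hj] at he
        exact congrArg (fun z => μ (.inr z)) (Subtype.ext he)
      cover := fun z => by
        by_cases hz : b.IsPruned z
        · exact Or.inr ⟨μ (.inr ⟨z, hz⟩), hm1 _, hj _⟩
        · exact Or.inl ⟨ε.symm ⟨z, hz⟩, by simp⟩
      leg := fun e => by
        by_cases h : b.IsPruned (b.tree.leg e)
        · rw [hq1 e h, hj]
          rfl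
        · rw [hq2 e h, hj]
          rfl
      adj := fun _ _ => Iff.rfl
      adj' := fun x hx z => by
        obtain ⟨e | w, rfl⟩ := μ.surjective x
        · exact absurd hx (hm2 e)
        · rw [hj, hl]
          exact hnb' w.1 w.2 z }
  have hp : ∀ z, b.IsPruned (b.perm z) ↔ b.IsPruned z := fun z => by
    rw [GraftTarget.IsPruned, Orb.mk_apply]
  let τ : Equiv.Perm V := (ε.trans (b.perm.subtypePerm fun z => not_congr (hp z))).trans ε.symm
  have hτ : ∀ y, (ε (τ y)).1 = b.perm (ε y).1 := fun y => by simp [τ]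
  have hσ : ∀ e, ¬ b.IsPruned (b.tree.leg (σ e)) ↔ ¬ b.IsPruned (b.tree.leg e) := fun e => by
    rw [b.isAut.leg, hp]
  let ρ' : Equiv.Perm b.Leg := Equiv.sumCongr (σ.subtypePerm hσ) (b.perm.subtypePerm hp)
  let ρ : Equiv.Perm N := (μ.symm.trans ρ').trans μ
  have hρ : ∀ s, ρ (μ s) = μ (ρ' s) := fun s => by simp [ρ]
  have hqσ : ∀ e, q (σ e) = ρ (q e) := fun e => by
    by_cases h : b.IsPruned (b.tree.leg e)
    · have h' : b.IsPruned (b.tree.leg (σ e)) := by rwa [b.isAut.leg, hp]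
      rw [hq1 e h, hq1 _ h', hρ]
      exact congrArg (fun z => μ (.inr z)) (Subtype.ext (b.isAut.leg e))
    · rw [hq2 e h, hq2 _ ((hσ e).2 h), hρ]
      rfl
  have hjρ : ∀ x, j (ρ x) = b.perm (j x) := fun x => by
    obtain ⟨e | z, rfl⟩ := μ.surjective x
    · rw [hρ, hj, hj]
      exact b.isAut.leg e.1
    · rw [hρ, hj, hj]
      rfl
  let t : STree N V := ⟨_, hg.isTree_iff.2 b.tree.isTree, l, hg.stable_iff.2 b.tree.stable⟩
  have ht : t.IsAut τ ρ := (IsGraft.isAut_iff (t := t) hg hqσ hτ hjρ).2 b.isAut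
  let a : GraftSource σ N V := ⟨ρ, τ, ⟨t, ht⟩, ⟨⟨q, hqσ⟩, hg.surj⟩⟩
  have h : IsGraftOf a b (fun y => (ε y).1) j := ⟨hg, hτ, hjρ, fun z => by
    constructor
    · rintro hz y rfl
      exact (ε y).2 hz
    · intro hz
      by_contra hne
      exact hz (ε.symm ⟨z, hne⟩) (by simp)⟩
  refine ⟨a, _, j, h, Equiv.ext fun y => rfl, ?_⟩
  rintro (e | z)
  · exact hq2 e.1 e.2
  · have h1 := h.legMap_inr (x := μ (.inr z)) (hm1 z)
    refine Eq.trans (congrArg (fun z => h.legMap (.inr z)) (Subtype.ext ?_)) h1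
    exact (hj (.inr z)).symm

/-- Pruning is determined by labellings of the vertices and the legs of the resulting tree. -/
theorem card_sigma_graftRel' [Finite E] [Finite W] (b : GraftTarget σ W) :
    Nat.card (Σ a : GraftSource σ N V, GraftRel a b) =
      Nat.card ((V ≃ {z // ¬ b.IsPruned z}) × (b.Leg ≃ N)) := by
  refine Nat.card_congr (Equiv.ofBijective (fun s => (s.2.2.vertexEquiv,
    Equiv.ofBijective _ s.2.2.legMap_bijective)) ⟨?_, fun ε => ?_⟩)
  · rintro ⟨a, ⟨α, j⟩, h⟩ ⟨a', ⟨α', j'⟩, h'⟩ he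
    have h1 := fun y => DFunLike.congr_fun (congrArg Prod.fst he) y
    have h2 := fun s => DFunLike.congr_fun (congrArg Prod.snd he) s
    obtain rfl : α = α' := funext fun y => congrArg Subtype.val (h1 y)
    have hq : a.q = a'.q := funext fun e => by
      by_cases hz : b.IsPruned (b.tree.leg e)
      · have e1 := h.legMap_inr (x := a.q e) (by rwa [← h.isPruned_iff, ← h.graft.leg])
        have e2 := h'.legMap_inr (x := a'.q e) (by rwa [← h'.isPruned_iff, ← h'.graft.leg])
        have e3 : h.legMap (.inr ⟨_, hz⟩) = h'.legMap (.inr ⟨_, hz⟩) := h2 (.inr ⟨_, hz⟩)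
        refine e1.symm.trans (Eq.trans ?_ (e3.trans (Eq.trans ?_ e2)))
        · exact congrArg (fun z => h.legMap (.inr z)) (Subtype.ext (h.graft.leg e).symm)
        · exact congrArg (fun z => h'.legMap (.inr z)) (Subtype.ext (h'.graft.leg e))
      · exact h2 (.inl ⟨e, hz⟩)
    obtain ⟨rfl, hj⟩ := h.source_ext h' hq
    obtain rfl : j = j' := hj
    rfl
  · obtain ⟨a, α, j, h, h1, h2⟩ := exists_isGraftOf_source b ε.1 ε.2
    exact ⟨⟨a, ⟨α, j⟩, h⟩, Prod.ext h1 (Equiv.ext h2)⟩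

end

/-! ### Comparison of the two sums by counting labellings. -/

theorem card_equiv_of_eq {α β : Type*} [Finite α] [Finite β] (h : Nat.card α = Nat.card β) :
    Nat.card (α ≃ β) = (Nat.card β).factorial := by
  classical
  have := Fintype.ofFinite α
  have := Fintype.ofFinite β
  obtain ⟨e⟩ : Nonempty (α ≃ β) := Finite.card_eq.1 h
  rw [Nat.card_eq_fintype_card, Fintype.card_equiv e, ← Nat.card_eq_fintype_card, h]

theorem card_equiv_of_ne {α β : Type*} (h : Nat.card α ≠ Nat.card β) : Nat.card (α ≃ β) = 0 :=
  Nat.card_eq_zero.2 (Or.inl ⟨fun e => h (Nat.card_congr e)⟩)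

/-- Only w = |α| contributes, with w! labellings. Summing over labelled objects with weight 1/w!
therefore counts each unlabelled configuration once. -/
theorem sum_inv_factorial_mul_card_equiv {k : Type*} [Field k] [CharZero k] {α : Type*} [Finite α]
    {M : ℕ} (h : Nat.card α ≤ M) :
    ∑ w ∈ Finset.range (M + 1), (w.factorial : k)⁻¹ * (Nat.card (α ≃ Fin w) : k) = 1 := by
  rw [Finset.sum_eq_single (Nat.card α)]
  · rw [card_equiv_of_eq (by simp), Nat.card_fin, inv_mul_cancel₀]
    exact_mod_cast Nat.factorial_ne_zero _
  · intro w _ hw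
    rw [card_equiv_of_ne (by simpa using hw.symm), Nat.cast_zero, mul_zero]
  · intro hn
    exact absurd (Finset.mem_range.2 (by omega)) hn

theorem card_equiv_comm {α β : Type*} : Nat.card (α ≃ β) = Nat.card (β ≃ α) :=
  Nat.card_congr ⟨Equiv.symm, Equiv.symm, fun _ => rfl, fun _ => rfl⟩

section

variable {k : Type u} [Field k] {E N V W : Type} {σ : Equiv.Perm E}

/-- Sources of graftings as an iterated sum type. -/
def GraftSource.equivSigma : GraftSource σ N V ≃ Σ ρ : Equiv.Perm N, Σ τ : Equiv.Perm V,
    {t : STree N V // t.IsAut τ ρ} × {q : EquivariantMap σ ρ // Function.Surjective q.1} :=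
  Equiv.refl _

/-- The weight of a tree with a map onto its set of legs. -/
def GraftSource.weight [Finite E] [Finite N] [Finite V] (f : SymFun k) (a : GraftSource σ N V) : k :=
  a.tree.weight f a.isAut * orbWeight (SymFun.p 1 - f.dp₁) a.q a.q_perm

/-- The weight of a tree with a set of pruned vertices. -/
def GraftTarget.weight [Finite E] [Finite W] (f : SymFun k) (b : GraftTarget σ W) : k :=
  b.tree.weight f b.isAut * (-1) ^ b.orbits.card

theorem IsGraftOf.weight_eq [Finite E] [Finite N] [Finite V] [Finite W] {f : SymFun k}
    (hf : ∀ d, expWt d ≤ 2 → f.ev d = 0) {a : GraftSource σ N V} {b : GraftTarget σ W}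
    {α : V → W} {j : N → W} (h : IsGraftOf a b α j) : a.weight f = b.weight f :=
  (h.graft.weight_eq a.q_perm h.perm_vertex h.perm_leg hf a.isAut b.isAut h.isPruned).symm

theorem sum_card_graftRel [CharZero k] [Finite E] [Finite N] [Finite V] (a : GraftSource σ N V) :
    ∑ w ∈ Finset.range (Nat.card E + 1), (w.factorial : k)⁻¹ *
      ∑ b : GraftTarget σ (Fin w), (Nat.card (GraftRel a b) : k) = 1 := by
  have h1 : ∀ w, ∑ b : GraftTarget σ (Fin w), (Nat.card (GraftRel a b) : k) =
      Nat.card (V ⊕ {x // IsMult a.q x} ≃ Fin w) := fun w => by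
    rw [← card_sigma_graftRel, Nat.card_sigma, Nat.cast_sum]
  simp only [h1]
  refine sum_inv_factorial_mul_card_equiv ?_
  -- The grafted tree is stable with legs E, which bounds its number of vertices by the range of
  -- summation.
  obtain ⟨b, -⟩ := exists_isGraftOf a (Finite.equivFin _)
  simpa using b.tree.card_le

theorem sum_card_graftRel' [CharZero k] [Finite E] [Finite W] (b : GraftTarget σ W) :
    ∑ n ∈ Finset.range (Nat.card E + 1), ∑ m ∈ Finset.range (Nat.card E + 1),
      (n.factorial : k)⁻¹ * (m.factorial : k)⁻¹ *
        ∑ a : GraftSource σ (Fin n) (Fin m), (Nat.card (GraftRel a b) : k) = 1 := by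
  have h1 : ∀ n m, ∑ a : GraftSource σ (Fin n) (Fin m), (Nat.card (GraftRel a b) : k) =
      Nat.card ({z // ¬ b.IsPruned z} ≃ Fin m) * Nat.card (b.Leg ≃ Fin n) := fun n m => by
    have := card_sigma_graftRel' (N := Fin n) (V := Fin m) b
    rw [Nat.card_prod, card_equiv_comm, Nat.card_sigma] at this
    rw [← Nat.cast_mul, ← this, Nat.cast_sum]
  obtain ⟨a, -⟩ := exists_isGraftOf_source b (Finite.equivFin _).symm (Finite.equivFin _)
  have h2 : Nat.card {z // ¬ b.IsPruned z} ≤ Nat.card b.Leg := by simpa using a.tree.card_le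
  have h3 : Nat.card b.Leg ≤ Nat.card E := by
    simpa using Nat.card_le_card_of_surjective _ a.q_surjective
  have h4 := sum_inv_factorial_mul_card_equiv (k := k) h3
  have h5 := sum_inv_factorial_mul_card_equiv (k := k) (h2.trans h3)
  refine Eq.trans ?_ ((Finset.sum_mul_sum _ _ _ _).symm.trans
    ((congrArg₂ (· * ·) h4 h5).trans (mul_one 1)))
  refine Finset.sum_congr rfl fun n _ => ?_
  refine Finset.sum_congr rfl fun m _ => ?_
  rw [h1]
  ring

/-- Grafting and pruning. -/
theorem sum_graftSource [CharZero k] [Finite E] {f : SymFun k}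
    (hf : ∀ d, expWt d ≤ 2 → f.ev d = 0) (σ : Equiv.Perm E) :
    ∑ n ∈ Finset.range (Nat.card E + 1), ∑ m ∈ Finset.range (Nat.card E + 1),
      (n.factorial : k)⁻¹ * (m.factorial : k)⁻¹ *
        ∑ a : GraftSource σ (Fin n) (Fin m), a.weight f =
    ∑ w ∈ Finset.range (Nat.card E + 1), (w.factorial : k)⁻¹ *
      ∑ b : GraftTarget σ (Fin w), b.weight f := by
  -- The two sums are compared through the grafting relation: weights agree on related pairs, and
  -- with the factorial factors each object is related to total mass 1 on the other side.
  have hw : ∀ {n m w} (a : GraftSource σ (Fin n) (Fin m)) (b : GraftTarget σ (Fin w)),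
      a.weight f * (Nat.card (GraftRel a b) : k) = b.weight f * (Nat.card (GraftRel a b) : k) := by
    intro n m w a b
    by_cases h : Nonempty (GraftRel a b)
    · obtain ⟨⟨p, hp⟩⟩ := h
      rw [hp.weight_eq hf]
    · rw [Nat.card_eq_zero.2 (Or.inl (not_nonempty_iff.1 h)), Nat.cast_zero, mul_zero, mul_zero]
  have h1 : ∀ n m, ∑ a : GraftSource σ (Fin n) (Fin m), a.weight f =
      ∑ a : GraftSource σ (Fin n) (Fin m), ∑ w ∈ Finset.range (Nat.card E + 1),
        ∑ b : GraftTarget σ (Fin w), (w.factorial : k)⁻¹ *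
          (b.weight f * (Nat.card (GraftRel a b) : k)) := fun n m => by
    refine Finset.sum_congr rfl fun a _ => ?_
    rw [← mul_one (a.weight f), ← sum_card_graftRel (k := k) a, Finset.mul_sum]
    refine Finset.sum_congr rfl fun w _ => ?_
    rw [mul_left_comm, Finset.mul_sum, Finset.mul_sum]
    exact Finset.sum_congr rfl fun b _ => by rw [hw]
  have h2 : ∀ w, ∑ b : GraftTarget σ (Fin w), b.weight f =
      ∑ b : GraftTarget σ (Fin w), ∑ n ∈ Finset.range (Nat.card E + 1),
        ∑ m ∈ Finset.range (Nat.card E + 1), ∑ a : GraftSource σ (Fin n) (Fin m),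
          (n.factorial : k)⁻¹ * (m.factorial : k)⁻¹ *
            (b.weight f * (Nat.card (GraftRel a b) : k)) := fun w => by
    refine Finset.sum_congr rfl fun b _ => ?_
    refine (mul_one (b.weight f)).symm.trans ?_
    rw [← sum_card_graftRel' (k := k) b, Finset.mul_sum]
    refine Finset.sum_congr rfl fun n _ => ?_
    rw [Finset.mul_sum]
    refine Finset.sum_congr rfl fun m _ => ?_
    rw [mul_left_comm, Finset.mul_sum, Finset.mul_sum]
  simp only [h1, h2, Finset.mul_sum]
  have h3 : ∀ n m, ∑ a : GraftSource σ (Fin n) (Fin m), ∑ w ∈ Finset.range (Nat.card E + 1),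
      ∑ b : GraftTarget σ (Fin w), (n.factorial : k)⁻¹ * (m.factorial : k)⁻¹ *
        ((w.factorial : k)⁻¹ * (b.weight f * (Nat.card (GraftRel a b) : k))) =
      ∑ w ∈ Finset.range (Nat.card E + 1), ∑ b : GraftTarget σ (Fin w),
        ∑ a : GraftSource σ (Fin n) (Fin m), (w.factorial : k)⁻¹ *
          ((n.factorial : k)⁻¹ * (m.factorial : k)⁻¹ *
            (b.weight f * (Nat.card (GraftRel a b) : k))) := fun n m => by
    rw [Finset.sum_comm]
    refine Finset.sum_congr rfl fun w _ => ?_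
    rw [Finset.sum_comm]
    exact Finset.sum_congr rfl fun b _ => Finset.sum_congr rfl fun a _ => by ring
  simp only [h3]
  rw [Finset.sum_congr rfl fun n _ => Finset.sum_comm, Finset.sum_comm]
  refine Finset.sum_congr rfl fun w _ => ?_
  rw [Finset.sum_congr rfl fun n _ => Finset.sum_comm, Finset.sum_comm]

end

theorem sum_dite_eq_sum_subtype {k ι : Type*} [AddCommMonoid k] [Fintype ι] (P : ι → Prop)
    [DecidablePred P] [Fintype {x // P x}] (F : ∀ x, P x → k) :
    ∑ x, (if h : P x then F x h else 0) = ∑ x : {x // P x}, F x.1 x.2 := by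
  refine (Fintype.sum_of_injective Subtype.val Subtype.val_injective _ _ ?_ ?_).symm
  · intro x hx
    exact dif_neg fun h => hx ⟨⟨x, h⟩, rfl⟩
  · intro x
    exact (dif_pos x.2).symm

open Classical in
theorem treeSum_eq {k : Type u} [Field k] {E : Type} [Finite E] (f : SymFun k)
    (σ : Equiv.Perm E) {M : ℕ} (hM : Nat.card E ≤ M) :
    treeSum f σ = ∑ m ∈ Finset.range (M + 1), (m.factorial : k)⁻¹ * ∑ τ : Equiv.Perm (Fin m),
      ∑ t : {t : STree E (Fin m) // t.IsAut τ σ}, t.1.weight f t.2 := by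
  rw [treeSum]
  simp only [sum_dite_eq_sum_subtype]
  refine Finset.sum_subset (fun m hm => ?_) fun m _ hm => ?_
  · rw [Finset.mem_range] at hm ⊢
    omega
  · rw [Finset.mem_range] at hm
    have : IsEmpty (STree E (Fin m)) := ⟨fun t => by
      have := t.card_le
      rw [Nat.card_fin] at this
      omega⟩
    simp

/-- p₁ - f' has no constant term, so only surjective q have nonzero weight. Multiplying out the sum
over trees and the sum over these q gives a sum over `GraftSource`. -/
theorem sum_treeSum_mul {k : Type u} [Field k] {E : Type} [Finite E] {f : SymFun k}
    (hf : ∀ d, expWt d ≤ 2 → f.ev d = 0) (σ : Equiv.Perm E) {n M : ℕ} (hn : n ≤ M) :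
    ∑ ρ : Equiv.Perm (Fin n), treeSum f ρ *
      ∑ q : EquivariantMap σ ρ, orbWeight (SymFun.p 1 - f.dp₁) q.1 q.2 =
    ∑ m ∈ Finset.range (M + 1), (m.factorial : k)⁻¹ *
      ∑ a : GraftSource σ (Fin n) (Fin m), a.weight f := by
  classical
  have hc : MvPowerSeries.constantCoeff (SymFun.p 1 - f.dp₁) = 0 := by
    have h1 := ev_p_one_sub_dp₁ f 0
    rw [zero_add, hf _ (by simp), expWt_zero] at h1
    simpa [SymFun.ev, SymFun.zee] using h1
  have hs : ∀ ρ : Equiv.Perm (Fin n), ∑ q : EquivariantMap σ ρ,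
      orbWeight (SymFun.p 1 - f.dp₁) q.1 q.2 =
      ∑ q : {q : EquivariantMap σ ρ // Function.Surjective q.1},
        orbWeight (SymFun.p 1 - f.dp₁) q.1.1 q.1.2 := fun ρ => by
    refine (Fintype.sum_of_injective Subtype.val Subtype.val_injective _ _ ?_ fun _ => rfl).symm
    intro q hq
    exact SymFun.orbWeight_eq_zero hc _ _ fun h => hq ⟨⟨q, h⟩, rfl⟩
  have h1 : ∀ m, ∑ a : GraftSource σ (Fin n) (Fin m), a.weight f =
      ∑ ρ : Equiv.Perm (Fin n), ∑ τ : Equiv.Perm (Fin m),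
        (∑ t : {t : STree (Fin n) (Fin m) // t.IsAut τ ρ}, t.1.weight f t.2) *
        ∑ q : {q : EquivariantMap σ ρ // Function.Surjective q.1},
          orbWeight (SymFun.p 1 - f.dp₁) q.1.1 q.1.2 := fun m => by
    refine (Fintype.sum_equiv GraftSource.equivSigma _ (fun x => x.2.2.1.1.weight f x.2.2.1.2 *
      orbWeight (SymFun.p 1 - f.dp₁) x.2.2.2.1.1 x.2.2.2.1.2) fun x => rfl).trans ?_
    rw [Fintype.sum_sigma]
    refine Finset.sum_congr rfl fun ρ _ => ?_
    rw [Fintype.sum_sigma]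
    refine Finset.sum_congr rfl fun τ _ => ?_
    rw [Fintype.sum_prod_type, Finset.sum_mul_sum]
  simp only [h1]
  conv_rhs => rw [Finset.sum_congr rfl fun m _ => Finset.mul_sum _ _ _, Finset.sum_comm]
  refine Finset.sum_congr rfl fun ρ _ => ?_
  rw [hs, treeSum_eq f ρ (M := M) (by simpa using hn), Finset.sum_mul]
  refine Finset.sum_congr rfl fun m _ => ?_
  rw [mul_assoc, Finset.sum_mul]

/-! ### Cancellation of prunings -/

/-- A walk starting at one of two adjacent leaves can never leave the pair, so a connected graph
with such leaves has no other vertex. -/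
theorem SimpleGraph.Connected.eq_or_eq_of_adj_iff {W : Type*} {G : SimpleGraph W}
    (hG : G.Connected) {z w : W} (hz : ∀ y, G.Adj z y ↔ y = w) (hw : ∀ y, G.Adj w y ↔ y = z)
    (x : W) : x = z ∨ x = w := by
  obtain ⟨p⟩ := hG.preconnected z x
  suffices h : ∀ {a b : W}, G.Walk a b → a = z ∨ a = w → b = z ∨ b = w from h p (Or.inl rfl)
  intro a b p
  induction p with
  | nil => exact id
  | cons h _ ih =>
    rintro (rfl | rfl)
    · exact ih (Or.inr ((hz _).1 h))
    · exact ih (Or.inl ((hw _).1 h))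

section

variable {E W : Type} {σ : Equiv.Perm E} {τ : Equiv.Perm W}

theorem isPrunable_iff_of_three_le [Finite W] {G : SimpleGraph W} (hG : G.Connected)
    (hW : 3 ≤ Nat.card W) (S : W → Prop) :
    IsPrunable G S ↔ ∀ z, S z → ∃ w, ∀ y, G.Adj z y ↔ y = w := by
  refine ⟨fun h z hz => (h z hz).imp fun w hw => hw.2, fun h z hz => ?_⟩
  obtain ⟨w, hw⟩ := h z hz
  refine ⟨w, fun hSw => ?_, hw⟩
  obtain ⟨z', hz'⟩ := h w hSw
  obtain rfl : z = z' := (hz' z).1 (((hw w).2 rfl).symm)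
  have hs : Function.Surjective (fun b : Bool => if b then z else w) := fun x => by
    obtain rfl | rfl := hG.eq_or_eq_of_adj_iff hw hz' x
    · exact ⟨true, rfl⟩
    · exact ⟨false, rfl⟩
  have := Nat.card_le_card_of_surjective _ hs
  simp at this
  omega

open Classical in
-- With at least three vertices no two leaves are adjacent, so the prunable unions of orbits
-- correspond to all sets of leaf orbits. There is at least one leaf, so the alternating sum over
-- these sets is 0.
theorem sum_isPrunable_of_three_le [Finite W] {k : Type*} [CommRing k] {G : SimpleGraph W}
    (hG : G.IsTree) (hτ : ∀ x y, G.Adj (τ x) (τ y) ↔ G.Adj x y) (hW : 3 ≤ Nat.card W) :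
    ∑ A : Finset (Orb τ) with IsPrunable G (fun z => Orb.mk τ z ∈ A), (-1 : k) ^ A.card = 0 := by
  have := Fintype.ofFinite W
  let P : W → Prop := fun z => ∃ w, ∀ y, G.Adj z y ↔ y = w
  have hP : ∀ z, P z → P (τ z) := fun z ⟨w, hw⟩ => ⟨τ w, fun y => by
    rw [← τ.apply_symm_apply y, hτ, hw, τ.injective.eq_iff]⟩
  have hP' : ∀ (j : ℕ) z, P z → P ((τ ^ j) z) := fun j z hz => by
    induction j with
    | zero => exact hz
    | succ j ih => rw [pow_succ']; exact hP _ ih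
  let L : Finset (Orb τ) := Finset.univ.filter fun O => P O.out
  have hL : ∀ z, Orb.mk τ z ∈ L ↔ P z := fun z => by
    simp only [L, Finset.mem_filter, Finset.mem_univ, true_and]
    obtain ⟨j, hj⟩ := Orb.exists_pow (Orb.mk_out (Orb.mk τ z))
    obtain ⟨j', hj'⟩ := Orb.exists_pow (Orb.mk_out (Orb.mk τ z)).symm
    exact ⟨fun h => hj ▸ hP' j _ h, fun h => hj' ▸ hP' j' _ h⟩
  have h1 : (Finset.univ.filter fun A : Finset (Orb τ) =>
      IsPrunable G (fun z => Orb.mk τ z ∈ A)) = L.powerset := by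
    ext A
    simp only [Finset.mem_filter, Finset.mem_univ, true_and, Finset.mem_powerset]
    rw [isPrunable_iff_of_three_le hG.connected hW]
    constructor
    · intro h O hO
      obtain ⟨z, rfl⟩ := Orb.mk_surjective τ O
      exact (hL z).2 (h z hO)
    · exact fun h z hz => (hL z).1 (h hz)
  have : Nontrivial W := by
    rw [← Finite.one_lt_card_iff_nontrivial]
    omega
  obtain ⟨z, hz⟩ := hG.exists_vert_degree_one_of_nontrivial
  have h2 : L.Nonempty := by
    refine ⟨Orb.mk τ z, (hL z).2 ?_⟩
    rw [SimpleGraph.degree_eq_one_iff_existsUnique_adj] at hz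
    obtain ⟨w, hw, hw'⟩ := hz
    exact ⟨w, fun y => ⟨fun h => hw' y h, fun h => h ▸ hw⟩⟩
  rw [h1]
  have h3 := congrArg (Int.cast : ℤ → k) (Finset.sum_powerset_neg_one_pow_card_of_nonempty h2)
  simpa using h3

open Classical in
-- Every union of orbits other than the whole vertex set is prunable. The alternating sum over all
-- sets of orbits is 0, which leaves minus the omitted term.
theorem sum_isPrunable_of_card_eq_two [Finite W] {k : Type*} [CommRing k] {G : SimpleGraph W}
    (hG : G = ⊤) (hW : Nat.card W = 2) :
    ∑ A : Finset (Orb τ) with IsPrunable G (fun z => Orb.mk τ z ∈ A), (-1 : k) ^ A.card =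
      -(-1) ^ Nat.card (Orb τ) := by
  have := Fintype.ofFinite W
  have h1 : (Finset.univ.filter fun A : Finset (Orb τ) =>
      IsPrunable G (fun z => Orb.mk τ z ∈ A)) = Finset.univ.erase Finset.univ := by
    ext A
    simp only [Finset.mem_filter, Finset.mem_univ, true_and, Finset.mem_erase, and_true]
    constructor
    · rintro h rfl
      have : Nonempty W := (Nat.card_pos_iff.1 (by omega)).1
      obtain ⟨w, hw, -⟩ := h (Classical.arbitrary W) (Finset.mem_univ _)
      exact hw (Finset.mem_univ _)
    · intro h z hz
      obtain ⟨O, hO⟩ : ∃ O, O ∉ A := by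
        by_contra! hA
        exact h (Finset.eq_univ_iff_forall.2 hA)
      obtain ⟨w, rfl⟩ := Orb.mk_surjective τ O
      have hwz : w ≠ z := fun h => hO (h ▸ hz)
      refine ⟨w, hO, fun y => ?_⟩
      rw [hG, SimpleGraph.top_adj]
      refine ⟨fun hy => ?_, fun hy => hy ▸ hwz.symm⟩
      rw [Nat.card_eq_fintype_card] at hW
      by_contra hne
      have := Finset.card_le_univ ({w, z, y} : Finset W)
      rw [Finset.card_eq_three.2 ⟨w, z, y, hwz, Ne.symm hne, hy, rfl⟩] at this
      omega
  have hn : Nonempty (Orb τ) :=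
    ⟨Orb.mk τ (Classical.choice (Nat.card_pos_iff.1 (by omega : 0 < Nat.card W)).1)⟩
  have h3 := congrArg (Int.cast : ℤ → k) (Finset.sum_powerset_neg_one_pow_card_of_nonempty
    (Finset.univ_nonempty (α := Orb τ)))
  rw [Finset.powerset_univ, ← Finset.sum_erase_add _ _ (Finset.mem_univ Finset.univ)] at h3
  push_cast at h3
  rw [h1, Nat.card_eq_fintype_card]
  exact eq_neg_of_add_eq_zero_left h3

open Classical in
theorem sum_isPrunable_of_subsingleton [Finite W] [Subsingleton W] {k : Type*} [CommRing k]
    {G : SimpleGraph W} :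
    ∑ A : Finset (Orb τ) with IsPrunable G (fun z => Orb.mk τ z ∈ A), (-1 : k) ^ A.card = 1 := by
  have h1 : (Finset.univ.filter fun A : Finset (Orb τ) =>
      IsPrunable G (fun z => Orb.mk τ z ∈ A)) = {∅} := by
    ext A
    simp only [Finset.mem_filter, Finset.mem_univ, true_and, Finset.mem_singleton]
    constructor
    · intro h
      refine Finset.eq_empty_of_forall_notMem fun O hO => ?_
      obtain ⟨z, rfl⟩ := Orb.mk_surjective τ O
      obtain ⟨w, hw, -⟩ := h z hO
      exact hw (Subsingleton.elim z w ▸ hO)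
    · rintro rfl z hz
      simp at hz
  rw [h1]
  simp

/-- Trees with a prunable set of vertices as an iterated sum type. -/
def GraftTarget.equivSigma : GraftTarget σ W ≃ Σ τ : Equiv.Perm W,
    Σ t : {t : STree E W // t.IsAut τ σ},
      {A : Finset (Orb τ) // IsPrunable t.1.graph fun z => Orb.mk τ z ∈ A} :=
  Equiv.refl _

open Classical in
theorem sum_graftTarget_weight {k : Type u} [Field k] [Finite E] [Fintype W] [DecidableEq W]
    (f : SymFun k) :
    ∑ b : GraftTarget σ W, b.weight f = ∑ τ : Equiv.Perm W, ∑ t : {t : STree E W // t.IsAut τ σ},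
      t.1.weight f t.2 * ∑ A : Finset (Orb τ) with
        IsPrunable t.1.graph (fun z => Orb.mk τ z ∈ A), (-1 : k) ^ A.card := by
  refine (Fintype.sum_equiv GraftTarget.equivSigma _
    (fun x => x.2.1.1.weight f x.2.1.2 * (-1) ^ x.2.2.1.card) fun x => rfl).trans ?_
  rw [Fintype.sum_sigma]
  refine Finset.sum_congr rfl fun τ _ => ?_
  rw [Fintype.sum_sigma]
  refine Finset.sum_congr rfl fun t _ => ?_
  rw [Finset.mul_sum]
  exact (Finset.sum_subtype _ (fun A => by simp)
    fun A : Finset (Orb τ) => t.1.weight f t.2 * (-1) ^ A.card).symm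

end

/-! ### Contributions of trees by their number of vertices. -/

theorem sum_graftTarget_of_three_le {k : Type u} [Field k] {E : Type} [Finite E] (f : SymFun k)
    (σ : Equiv.Perm E) {W : Type} [Finite W] (hW : 3 ≤ Nat.card W) :
    ∑ b : GraftTarget σ W, b.weight f = 0 := by
  classical
  have := Fintype.ofFinite W
  rw [sum_graftTarget_weight]
  refine Finset.sum_eq_zero fun τ _ => Finset.sum_eq_zero fun t _ => ?_
  rw [sum_isPrunable_of_three_le t.1.isTree t.2.adj hW, mul_zero]

theorem isEmpty_sTree_of_card_lt {E W : Type} [Finite E] [Finite W] (h : Nat.card E < Nat.card W) :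
    IsEmpty (STree E W) :=
  ⟨fun t => h.not_ge t.card_le⟩

instance {E : Type} {W : Type} [IsEmpty W] : IsEmpty (STree E W) :=
  ⟨fun t => t.isTree.connected.nonempty.elim isEmptyElim⟩

theorem sum_graftTarget_of_isEmpty {k : Type u} [Field k] {E : Type} [Finite E] (f : SymFun k)
    (σ : Equiv.Perm E) {W : Type} [Finite W] [IsEmpty (STree E W)] :
    ∑ b : GraftTarget σ W, b.weight f = 0 :=
  Finset.sum_eq_zero fun b _ => isEmptyElim b.tree

theorem STree.weight_of_unique {k : Type u} [Field k] {E W : Type} [Finite E] [Unique W]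
    (f : SymFun k) {t : STree E W} {τ : Equiv.Perm W} {σ : Equiv.Perm E} (h : t.IsAut τ σ) :
    t.weight f h = f.ev (cycExp σ) := by
  have hu : ∀ O : Orb τ, O = Orb.mk τ default := fun O => by
    obtain ⟨z, rfl⟩ := Orb.mk_surjective τ O
    rw [Subsingleton.elim z default]
  have hl : (Orb.mk τ default).len = 1 := Orb.eq_len_iff fun j => by
    simp [Subsingleton.elim ((τ ^ j) default) default]
  rw [STree.weight, orbWeight, Fintype.prod_eq_single (Orb.mk τ default) fun O hO => absurd (hu O) hO,
    cycExp_eq_fibExp h.base_perm default σ Sum.inr Sum.inr_injective]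
  · intro e
    rw [hl]
    rfl
  · rintro (p | e)
    · exact absurd (Subsingleton.elim p.1.1 p.1.2) p.2.ne
    · exact ⟨fun _ => ⟨e, rfl⟩, fun _ => Subsingleton.elim _ _⟩

/-- The single vertex carries all legs, with weight f(σ). The tree is unstable if |E| ≤ 2, but then
f(σ) vanishes as well. -/
theorem sum_graftTarget_of_unique {k : Type u} [Field k] {E : Type} [Finite E] {f : SymFun k}
    (hf : ∀ d, expWt d ≤ 2 → f.ev d = 0) (σ : Equiv.Perm E) {W : Type} [Fintype W] [Unique W] :
    ∑ b : GraftTarget σ W, b.weight f = f.ev (cycExp σ) := by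
  classical
  rw [sum_graftTarget_weight]
  simp only [sum_isPrunable_of_subsingleton, STree.weight_of_unique, mul_one]
  have hc : ∀ t : STree E W, ∀ x, Nat.card ({y // t.graph.Adj x y} ⊕ {e // t.leg e = x}) =
      Nat.card E := fun t x => by
    have : IsEmpty {y // t.graph.Adj x y} := ⟨fun y => y.2.ne (Subsingleton.elim _ _)⟩
    rw [Nat.card_congr (Equiv.emptySum _ _),
      Nat.card_congr (Equiv.subtypeUnivEquiv fun e => Subsingleton.elim _ _)]
  rw [Finset.sum_eq_single default (fun τ _ hτ => absurd (Subsingleton.elim τ default) hτ)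
    (fun h => absurd (Finset.mem_univ _) h), Finset.sum_const, Finset.card_univ,
    ← Nat.card_eq_fintype_card]
  by_cases hE : 3 ≤ Nat.card E
  · have h1 : Nat.card {t : STree E W // t.IsAut default σ} = 1 := by
      rw [Nat.card_eq_one_iff_exists]
      refine ⟨⟨⟨⊥, SimpleGraph.IsTree.of_subsingleton, fun _ => default, fun x => ?_⟩,
        ⟨fun x y => ?_, fun _ => Subsingleton.elim _ _⟩⟩, fun t => Subtype.ext (STree.ext ?_ ?_)⟩
      · have : IsEmpty {y // (⊥ : SimpleGraph W).Adj x y} := ⟨fun y => y.2⟩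
        rw [Nat.card_congr (Equiv.emptySum _ _),
          Nat.card_congr (Equiv.subtypeUnivEquiv fun e => Subsingleton.elim _ _)]
        exact hE
      · rfl
      · exact Subsingleton.elim _ _
      · exact Subsingleton.elim _ _
    rw [h1, one_smul]
  · rw [hf _ (by rw [expWt_cycExp]; omega), smul_zero]

section

variable {k : Type u} [Field k] {E W : Type} [Finite E] [Finite W] {f : SymFun k}
  {τ : Equiv.Perm W} {σ : Equiv.Perm E}

theorem SimpleGraph.Connected.eq_top_of_card_eq_two {G : SimpleGraph W} (hG : G.Connected)
    (hW : Nat.card W = 2) : G = ⊤ := by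
  have := Fintype.ofFinite W
  rw [Nat.card_eq_fintype_card] at hW
  have : Nontrivial W := Fintype.one_lt_card_iff_nontrivial.1 (by omega)
  ext x y
  rw [top_adj]
  refine ⟨fun h => h.ne, fun h => ?_⟩
  obtain ⟨z, hz⟩ := hG.preconnected.exists_adj_of_nontrivial x
  by_contra hne
  classical
  have := Finset.card_le_univ ({x, y, z} : Finset W)
  rw [Finset.card_eq_three.2 ⟨x, y, z, h, hz.ne, fun h => hne (h ▸ hz), rfl⟩] at this
  omega

theorem SimpleGraph.isTree_top_of_card_eq_two (hW : Nat.card W = 2) :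
    (⊤ : SimpleGraph W).IsTree := by
  classical
  have := Fintype.ofFinite W
  rw [Nat.card_eq_fintype_card] at hW
  have : Nonempty W := Fintype.card_pos_iff.1 (by omega)
  rw [SimpleGraph.isTree_iff_connected_and_card]
  refine ⟨SimpleGraph.connected_top, ?_⟩
  rw [Nat.card_eq_fintype_card, ← SimpleGraph.edgeFinset_card,
    SimpleGraph.card_edgeFinset_top_eq_card_choose_two, Nat.card_eq_fintype_card, hW]
  rfl

theorem card_ne_of_card_eq_two (hW : Nat.card W = 2) (x : W) : Nat.card {y // x ≠ y} = 1 := by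
  classical
  have := Fintype.ofFinite W
  rw [Nat.card_eq_fintype_card] at hW ⊢
  have := Fintype.card_subtype_compl (fun y => x = y)
  rw [hW, Fintype.card_subtype_eq'] at this
  exact this

/-- At each vertex there is exactly one edge end besides the legs, which replaces f by ∂f/∂p₁. -/
theorem STree.weight_of_card_eq_two {t : STree E W} (h : t.IsAut τ σ) (hW : Nat.card W = 2) :
    t.weight f h = orbWeight f.dp₁ t.leg h.leg := by
  rw [STree.weight, orbWeight, orbWeight]
  refine Finset.prod_congr rfl fun O _ => ?_
  obtain ⟨x, rfl⟩ := Orb.mk_surjective τ O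
  let φ : Equiv.Perm {p : W × W // t.graph.Adj p.1 p.2} :=
    Equiv.subtypeEquiv (Equiv.prodCongr τ τ) fun p => (h.adj p.1 p.2).symm
  let π : {p : W × W // t.graph.Adj p.1 p.2} → W := fun p => p.1.1
  have h1 : ∀ p, π (φ p) = τ (π p) := fun _ => rfl
  have h2 := fibExp_sumElim h1 h.leg h.base_perm (Orb.mk τ x)
  have h3 : fibExp π h1 (Orb.mk τ x) = Finsupp.single 1 1 := by
    refine eq_single_of_expWt_eq_one ?_
    rw [expWt_fibExp, ← card_ne_of_card_eq_two hW x]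
    have hG := t.isTree.connected.eq_top_of_card_eq_two hW
    refine Nat.card_congr ⟨fun p => ⟨p.1.1.2, fun h =>
      p.1.2.ne ((show p.1.1.1 = x from p.2).trans h)⟩, fun y => ⟨⟨(x, y.1), ?_⟩, rfl⟩,
      ?_, fun _ => rfl⟩
    · rw [hG]
      exact y.2
    · rintro ⟨⟨⟨a, b⟩, hp⟩, rfl⟩
      rfl
  rw [SymFun.ev_dp₁, ← h3, add_comm]
  exact congrArg f.ev h2

/-- A tree with two vertices is determined by the attachment of its legs. Attachments with fewer
than two legs at some vertex are unstable, but their weight is 0 because f vanishes in weight at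
most 2. -/
theorem sum_weight_of_card_eq_two (hf : ∀ d, expWt d ≤ 2 → f.ev d = 0) (hW : Nat.card W = 2)
    [Fintype {t : STree E W // t.IsAut τ σ}] :
    ∑ t : {t : STree E W // t.IsAut τ σ}, t.1.weight f t.2 =
      ∑ q : EquivariantMap σ τ, orbWeight f.dp₁ q.1 q.2 := by
  let F : {t : STree E W // t.IsAut τ σ} → EquivariantMap σ τ := fun t => ⟨t.1.leg, t.2.leg⟩
  refine Fintype.sum_of_injective F (fun t t' h => ?_) (fun t => t.1.weight f t.2)
    (fun q => orbWeight f.dp₁ q.1 q.2) (fun q hq => ?_)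
    fun t => STree.weight_of_card_eq_two t.2 hW
  · have h' : t.1.leg = t'.1.leg := congrArg (fun q : EquivariantMap σ τ => q.1) h
    refine Subtype.ext (STree.ext ?_ h')
    rw [t.1.isTree.connected.eq_top_of_card_eq_two hW,
      t'.1.isTree.connected.eq_top_of_card_eq_two hW]
  · by_contra hne
    refine hq ⟨⟨⟨⊤, SimpleGraph.isTree_top_of_card_eq_two hW, q.1, fun x => ?_⟩,
      fun x y => ?_, q.2⟩, rfl⟩
    · rw [Nat.card_sum]
      simp only [SimpleGraph.top_adj]
      rw [card_ne_of_card_eq_two hW, ← expWt_fibExp q.1 q.2]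
      have h1 := Finset.prod_ne_zero_iff.1 hne (Orb.mk τ x) (Finset.mem_univ _)
      rw [SymFun.ev_dp₁] at h1
      by_contra hlt
      refine h1 (hf _ ?_)
      rw [expWt_add, expWt_single]
      simp only [PNat.one_coe]
      omega
    · simp [τ.injective.eq_iff]

end

theorem SymFun.adams_one {k : Type u} [Field k] (f : SymFun k) : SymFun.adams 1 f = f := by
  ext d
  have h : Finsupp.mapDomain (fun m : ℕ+ => 1 * m) d = d := by
    simp only [one_mul]
    exact Finsupp.mapDomain_id
  conv_lhs => rw [← h, SymFun.coeff_adams]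

theorem Orb.len_one_perm {α : Type*} [Finite α] (O : Orb (1 : Equiv.Perm α)) : O.len = 1 := by
  obtain ⟨x, rfl⟩ := Orb.mk_surjective _ O
  exact Orb.eq_len_iff fun j => by simp

theorem Orb.card_one_perm {α : Type*} : Nat.card (Orb (1 : Equiv.Perm α)) = Nat.card α :=
  (Nat.card_congr (Equiv.ofBijective (Orb.mk 1) ⟨fun x y h => by
    simpa using Orb.mk_eq.1 h, Orb.mk_surjective _⟩)).symm

theorem Orb.subsingleton_swap : Subsingleton (Orb (Equiv.swap (0 : Fin 2) 1)) := by
  have h : ∀ x : Fin 2, Orb.mk (Equiv.swap 0 1) x = Orb.mk (Equiv.swap 0 1) 0 := by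
    intro x
    fin_cases x
    · rfl
    · exact Orb.mk_apply (Equiv.swap (0 : Fin 2) 1) 0
  refine ⟨fun O O' => ?_⟩
  obtain ⟨x, rfl⟩ := Orb.mk_surjective _ O
  obtain ⟨y, rfl⟩ := Orb.mk_surjective _ O'
  rw [h x, h y]

theorem Orb.len_swap (O : Orb (Equiv.swap (0 : Fin 2) 1)) : O.len = 2 := by
  have := Orb.subsingleton_swap
  refine PNat.eq ?_
  rw [← Orb.card_fiber, Nat.card_congr (Equiv.subtypeUnivEquiv fun x => Subsingleton.elim _ _)]
  simp

theorem sum_graftTarget_fin_two {k : Type u} [Field k] {E : Type} [Finite E] {f : SymFun k}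
    (hf : ∀ d, expWt d ≤ 2 → f.ev d = 0) (σ : Equiv.Perm E) :
    ∑ b : GraftTarget σ (Fin 2), b.weight f =
      (SymFun.adams 2 f.dp₁).ev (cycExp σ) - (f.dp₁ ^ 2).ev (cycExp σ) := by
  classical
  have := Orb.subsingleton_swap
  have hW : Nat.card (Fin 2) = 2 := Nat.card_fin 2
  rw [sum_graftTarget_weight]
  have h1 : ∀ (τ : Equiv.Perm (Fin 2)) (t : {t : STree E (Fin 2) // t.IsAut τ σ}),
      ∑ A : Finset (Orb τ) with IsPrunable t.1.graph (fun z => Orb.mk τ z ∈ A),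
        (-1 : k) ^ A.card = -(-1) ^ Nat.card (Orb τ) := fun τ t =>
    sum_isPrunable_of_card_eq_two (t.1.isTree.connected.eq_top_of_card_eq_two hW) hW
  simp only [h1, ← Finset.sum_mul, sum_weight_of_card_eq_two hf hW, ← Orb.ev_prod_adams]
  -- The identity has two orbits, hence the sign -1 and the term f'²; the swap has one orbit of
  -- length 2, hence the sign +1 and the term p₂ ∘ f'.
  rw [show (Finset.univ : Finset (Equiv.Perm (Fin 2))) = {1, Equiv.swap 0 1} by decide,
    Finset.sum_pair (by decide)]
  have h2 : Nat.card (Orb (Equiv.swap (0 : Fin 2) 1)) = 1 :=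
    Nat.card_eq_one_iff_unique.2 ⟨inferInstance, ⟨Orb.mk _ 0⟩⟩
  simp only [Orb.len_one_perm, Orb.len_swap, SymFun.adams_one, Finset.prod_const,
    Finset.card_univ, ← Nat.card_eq_fintype_card, Orb.card_one_perm, h2, hW, pow_one]
  ring

theorem sum_graftTarget {k : Type u} [Field k] {E : Type} [Finite E] {f : SymFun k}
    (hf : ∀ d, expWt d ≤ 2 → f.ev d = 0) (σ : Equiv.Perm E) :
    ∑ w ∈ Finset.range (Nat.card E + 1), (w.factorial : k)⁻¹ *
      ∑ b : GraftTarget σ (Fin w), b.weight f =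
    f.ev (cycExp σ) + 2⁻¹ *
      ((SymFun.adams 2 f.dp₁).ev (cycExp σ) - (f.dp₁ ^ 2).ev (cycExp σ)) := by
  -- The range is enlarged so that it contains 0, 1 and 2 for every E; the additional terms vanish
  -- because no stable tree has more vertices than legs.
  rw [Finset.sum_subset (s₂ := Finset.range (3 + Nat.card E))
    (fun w hw => by rw [Finset.mem_range] at hw ⊢; omega) fun w _ hw => ?_,
    Finset.sum_range_add, Finset.sum_range_succ, Finset.sum_range_succ, Finset.sum_range_one,
    Finset.sum_eq_zero (s := Finset.range (Nat.card E)) fun w _ => ?_, sum_graftTarget_of_isEmpty (W := Fin 0), sum_graftTarget_of_unique hf,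
    sum_graftTarget_fin_two hf]
  · simp
  · rw [sum_graftTarget_of_three_le _ _ (by simp), mul_zero]
  · have : IsEmpty (STree E (Fin w)) := isEmpty_sTree_of_card_lt (by
      rw [Finset.mem_range] at hw
      rw [Nat.card_fin]
      omega)
    rw [sum_graftTarget_of_isEmpty, mul_zero]

/-! ### The plethystic equation for the free cyclic operad. -/

open MvPowerSeries Finsupp

namespace CyclicSMod

variable {k : Type u} [Field k] {V : CyclicSMod.{u, v} k}

theorem ev_Ch_eq_zero (hV : V.FiniteDim) (h2 : V.VanishesLETwo) (d : ℕ+ →₀ ℕ) (hd : expWt d ≤ 2) :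
    V.Ch.ev d = 0 := by
  rw [SymFun.ev, coeff_Ch_eq_zero hV h2 d hd, mul_zero]

/-- The free cyclic operad has no components of arity at most two. -/
theorem vanishesLETwo_tree (V : CyclicSMod.{u, v} k) : V.tree.VanishesLETwo := fun n hn i => by
  refine ⟨fun Φ Ψ => Subtype.ext (funext fun m => funext fun t => ?_)⟩
  have h1 := t.graph.card_add_two_le_of_stable t.isTree t.leg t.stable
  have h2 : 0 < Nat.card (Fin m) := Nat.card_pos_iff.2 ⟨t.isTree.connected.nonempty, inferInstance⟩
  rw [Nat.card_fin (n + 1)] at h1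
  omega

theorem ev_Ch_tree_of_perm [CharZero k] (hV : V.FiniteDim) {n : ℕ} (σ : Equiv.Perm (Fin n)) :
    V.tree.Ch.ev (cycExp σ) = treeSum V.Ch σ := by
  cases n with
  -- In weight 0 the characteristic vanishes, and the tree sum only runs over trees without
  -- vertices, of which there are none.
  | zero =>
    have h1 : cycExp σ = 0 := expWt_eq_zero.1 (by simp [expWt_cycExp])
    rw [h1, SymFun.ev_zero, constantCoeff_Ch hV.tree]
    simp [treeSum]
  | succ n => exact ev_Ch_tree hV n σ

/-- The characteristic of the free cyclic operad. -/
theorem plethysm_Ch_tree [CharZero k] (hV : V.FiniteDim) (h2 : V.VanishesLETwo) :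
    SymFun.plethysm V.tree.Ch (SymFun.p 1 - V.Ch.dp₁) =
      V.Ch + C (2⁻¹ : k) * (SymFun.adams 2 V.Ch.dp₁ - V.Ch.dp₁ ^ 2) := by
  have hf := ev_Ch_eq_zero hV h2
  have hc : constantCoeff (SymFun.p 1 - V.Ch.dp₁) = 0 := by
    rw [← SymFun.ev_zero, ev_p_one_sub_dp₁, hf _ (by simp)]
    simp
  refine SymFun.ext_perm fun N σ => ?_
  rw [SymFun.ev_plethysm hc, SymFun.ev_add, SymFun.ev_C_mul, SymFun.ev_sub,
    ← sum_graftTarget hf σ, ← sum_graftSource hf σ]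
  refine Finset.sum_congr rfl fun n hn => ?_
  simp only [ev_Ch_tree_of_perm hV]
  rw [sum_treeSum_mul hf σ (Nat.lt_succ_iff.1 (Finset.mem_range.1 hn)), Finset.mul_sum]
  exact Finset.sum_congr rfl fun m _ => (mul_assoc _ _ _).symm

end CyclicSMod

open MvPowerSeries Finsupp

/-! ### The cobar operad -/

theorem cycExp_inv {N : ℕ} (σ : Equiv.Perm (Fin N)) : cycExp σ⁻¹ = cycExp σ := by
  rw [cycExp_eq_parts, cycExp_eq_parts, Equiv.Perm.parts_partition, Equiv.Perm.parts_partition,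
    Equiv.Perm.cycleType_inv, Equiv.Perm.support_inv]

namespace SymFun

variable {k : Type u} [Field k]

/-- The monomial of a cycle type has one power sum for each cycle. -/
theorem ev_omegaTilde {α : Type*} [Finite α] (f : SymFun k) (σ : Equiv.Perm α) :
    (omegaTilde f).ev (cycExp σ) = (-1) ^ Nat.card (Orb σ) * f.ev (cycExp σ) := by
  have h : ((cycExp σ).prod fun _ n => (-1 : k) ^ n) = (-1) ^ Nat.card (Orb σ) := by
    rw [cycExp, ← Finsupp.prod_finsetSum_index (by simp) (by intros; rw [pow_add])]
    simp
  rw [ev, omegaTilde, coeff_rescale, h, ev]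
  ring

theorem omegaTilde_h₂ : omegaTilde (h₂ : SymFun k) = C (2⁻¹ : k) * (p 1 ^ 2 - p 2) := by
  have h : ∀ n : ℕ+, rescale (fun _ => -1) (X n : SymFun k) = -X n := fun n => by
    classical
    ext d
    rw [coeff_rescale, map_neg, coeff_X]
    split_ifs with hd
    · rw [hd]
      simp
    · simp
  have h' : rescale (fun _ => -1) (C 2⁻¹ : SymFun k) = C 2⁻¹ := by
    classical
    ext d
    rw [coeff_rescale, coeff_C]
    split_ifs with hd
    · rw [hd]
      simp
    · simp
  rw [omegaTilde, h₂, p, p, map_mul, map_add, map_pow, h, h, h']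
  ring

theorem coeff_h₂ (n : ℕ) :
    coeff (single 1 n) (h₂ : SymFun k) = if n = 2 then 2⁻¹ else 0 := by
  classical
  have h1 : single (1 : ℕ+) n ≠ single 2 1 := fun h => by
    simpa using DFunLike.congr_fun h 2
  rw [h₂, coeff_C_mul, p, p, map_add, coeff_X_pow, coeff_X, if_neg h1, add_zero]
  by_cases hn : n = 2
  · simp [hn]
  · rw [if_neg hn, if_neg, mul_zero]
    exact fun h => hn (single_injective _ h)

theorem plethysm_add {f f' g : SymFun k} (hg : constantCoeff g = 0) :
    plethysm (f + f') g = plethysm f g + plethysm f' g :=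
  subst_add (hasSubst_adams hg) _ _

theorem plethysm_h₂ {g : SymFun k} (hg : constantCoeff g = 0) :
    plethysm h₂ g = C (2⁻¹ : k) * (g ^ 2 + adams 2 g) := by
  have h := hasSubst_adams hg
  rw [plethysm, h₂, subst_mul h, subst_add h, subst_pow h, p, p, subst_X h, subst_X h, subst_C,
    adams_one]

theorem adams_p_one_sub (n : ℕ+) (f : SymFun k) : adams n (p 1 - f) = p n - adams n f := by
  rw [adams, subst_sub (hasSubst_p_mul n)]
  change adams n (p 1) - adams n f = _
  rw [adams_X, mul_one]

theorem isStar_of_coeff [CharZero k] {f : SymFun k} (h : ∀ n ≤ 1, coeff (single 1 n) f = 0)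
    (h' : coeff (single 1 2) f ≠ 0) : IsStar f := by
  simp only [IsStar, rk, PowerSeries.coeff_mk]
  exact ⟨h 0 (by omega), h 1 le_rfl, h'⟩

/-- Two solutions of the Legendre equation have the same plethysm with f' = p₁ + ⋯, hence coincide,
so the choice in `legendre` returns the given one. -/
theorem legendre_eq [CharZero k] {f g : SymFun k} (hf : constantCoeff f.dp₁ = 0)
    (hf1 : f.dp₁.ev (single 1 1) = 1) (hg : IsStar g) (h : LegendreEq f g) : legendre f = g := by
  have hu : ∃! g : SymFun k, IsStar g ∧ LegendreEq f g :=
    ⟨g, ⟨hg, h⟩, fun g' hg' => plethysm_injective hf hf1 (add_right_cancel (hg'.2.trans h.symm))⟩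
  rw [legendre, dif_pos hu]
  exact hu.unique hu.choose_spec.1 ⟨hg, h⟩

end SymFun

namespace CyclicSMod

variable {k : Type u} [Field k]

theorem FiniteDim.of_regrade {V : CyclicSMod.{u, v} k} (hV : V.FiniteDim)
    {W : CyclicSMod.{u, v} k} (e : ℕ → ℤ ≃ ℤ)
    (h : ∀ n i, Nonempty (W.X n i ≃ₗ[k] V.X n (e n i))) : W.FiniteDim := fun n => by
  rw [directSum_finite_iff]
  have := hV.finite n
  refine ⟨fun i => Module.Finite.equiv (h n i).some.symm, ?_⟩
  refine ((hV.finite_support n).preimage (e n).injective.injOn).subset fun i hi hs => hi ?_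
  exact (h n i).some.toEquiv.subsingleton

theorem FiniteDim.dual {V : CyclicSMod.{u, v} k} (hV : V.FiniteDim) : V.dual.FiniteDim := fun n => by
  rw [directSum_finite_iff]
  have := hV.finite n
  refine ⟨fun i => inferInstanceAs (Module.Finite k (Module.Dual k (V.X n (-i)))), ?_⟩
  refine ((hV.finite_support n).preimage neg_injective.injOn).subset fun i hi hs => hi ?_
  exact inferInstanceAs (Subsingleton (V.X n (-i) →ₗ[k] k))

theorem FiniteDim.susp {V : CyclicSMod.{u, v} k} (hV : V.FiniteDim) (j : ℤ) :
    (V.susp j).FiniteDim :=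
  hV.of_regrade (fun _ => Equiv.subRight j) fun n i => ⟨LinearEquiv.refl k (V.X n (i - j))⟩

theorem FiniteDim.desusp {V : CyclicSMod.{u, v} k} (hV : V.FiniteDim) : V.desusp.FiniteDim :=
  hV.of_regrade (fun n => Equiv.subRight ((n : ℤ) - 1)) fun n i =>
    ⟨LinearEquiv.refl k (V.X n (i - ((n : ℤ) - 1)))⟩

/-- The generators of the cobar operad. -/
abbrev cogen (V : CyclicSMod.{u, v} k) : CyclicSMod.{u, max u v} k := (V.dual.susp (-1)).desusp

theorem VanishesLETwo.cogen {V : CyclicSMod.{u, v} k} (hV : V.VanishesLETwo) :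
    V.cogen.VanishesLETwo := fun n hn i => by
  have := hV n hn
  exact inferInstanceAs (Subsingleton (V.X n _ →ₗ[k] k))

/-- The dual contributes σ⁻¹, the shifts contribute (-1)^n and 𝔰⁻¹ the sign of σ. As σ permutes n +
1 points, (-1)^n sgn(σ) is minus (-1)^(number of cycles). -/
theorem strace_cogen {V : CyclicSMod.{u, v} k} (hV : V.FiniteDim) (n : ℕ)
    (σ : Equiv.Perm (Fin (n + 1))) :
    V.cogen.strace n σ = -(-1) ^ Nat.card (Orb σ) * V.strace n σ⁻¹ := by
  have h1 : ∀ i, LinearMap.trace k _ (V.cogen.ρ n i σ) = ((Equiv.Perm.sign σ : ℤ) : k) *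
      LinearMap.trace k _ (V.ρ n (-(i - ((n : ℤ) - 1) - -1)) σ⁻¹) := fun i => by
    have := hV.finite n
    have h2 := LinearMap.trace_transpose' (R := k) (V.ρ n (-(i - ((n : ℤ) - 1) - -1)) σ⁻¹)
    rw [← h2]
    exact map_smul (LinearMap.trace k _) _ _
  -- Degree i of the generators is dual to degree n - 2 - i of V; this reflection reindexes the
  -- alternating sum.
  let e : ℤ ≃ ℤ := Equiv.subLeft ((n : ℤ) - 2)
  have h2 := neg_one_pow_card_mul_sign σ
  have h3 : (-1 : k) ^ n * ((Equiv.Perm.sign σ : ℤ) : k) = -(-1) ^ Nat.card (Orb σ) := by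
    have := congrArg (fun z : ℤˣ => ((z : ℤ) : k)) h2
    simp only [Fintype.card_fin, pow_succ] at this
    push_cast at this
    rw [← this]
    ring
  rw [strace, strace, ← h3, ← smul_eq_mul, smul_finsum, ← finsum_comp_equiv e]
  refine finsum_congr fun i => ?_
  have h4 : -(e i - ((n : ℤ) - 1) - -1) = i := by
    simp only [e, Equiv.subLeft_apply]
    ring
  have h5 : ((e i).negOnePow : ℤ) = (-1) ^ n * (i.negOnePow : ℤ) := by
    have h6 : (2 : ℤ).negOnePow = 1 := Int.negOnePow_even 2 even_two
    have h7 : (n : ℤ).negOnePow = (-1) ^ n := by rw [Int.negOnePow_def, zpow_natCast]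
    simp [e, Int.negOnePow_sub, h6, h7]
  rw [h1, h4, h5, smul_eq_mul]
  push_cast
  ring

theorem Ch_cogen [CharZero k] {V : CyclicSMod.{u, v} k} (hV : V.FiniteDim) :
    V.cogen.Ch = -SymFun.omegaTilde V.Ch := by
  have hW : V.cogen.FiniteDim := (hV.dual.susp _).desusp
  refine SymFun.ext_perm fun N σ => ?_
  have h1 : ∀ (f : SymFun k) d, (-f).ev d = -f.ev d := fun f d => by simp [SymFun.ev]
  rw [h1, SymFun.ev_omegaTilde]
  cases N with
  | zero =>
    have h0 : cycExp σ = 0 := expWt_eq_zero.1 (by simp [expWt_cycExp])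
    rw [h0, SymFun.ev_zero, SymFun.ev_zero, constantCoeff_Ch hV, constantCoeff_Ch hW]
    simp
  | succ n =>
    rw [ev_Ch hW, strace_cogen hV, ← ev_Ch hV, cycExp_inv]
    ring

end CyclicSMod

theorem mainTheorem12 {k : Type u} [Field k] [CharZero k] (A : DGCyclicOperad.{u, v} k)
    (hA : A.toCyclicSMod.VanishesLETwo) (hfin : A.toCyclicSMod.FiniteDim) :
    A.cobar.FiniteDim ∧
      SymFun.IsStar (SymFun.omegaTilde (SymFun.h₂ + A.toCyclicSMod.Ch)) ∧
      SymFun.IsStar (SymFun.h₂ + A.cobar.Ch) ∧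
      SymFun.h₂ + A.cobar.Ch =
        SymFun.legendre (SymFun.omegaTilde (SymFun.h₂ + A.toCyclicSMod.Ch)) := by
  have hW : A.toCyclicSMod.cogen.FiniteDim := (hfin.dual.susp _).desusp
  have hW2 := hA.cogen
  have hd : ∀ n ≤ 2, expWt (single 1 n) ≤ 2 := fun n hn => by simpa [expWt_single] using hn
  have hv := CyclicSMod.ev_Ch_eq_zero hW hW2
  set v := A.toCyclicSMod.cogen.Ch with hvdef
  set T := A.toCyclicSMod.cogen.tree.Ch with hT
  have hT0 : ∀ n ≤ 2, coeff (single 1 n) T = 0 := fun n hn =>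
    CyclicSMod.coeff_Ch_eq_zero hW.tree (CyclicSMod.vanishesLETwo_tree _) _ (hd n hn)
  have hf : SymFun.omegaTilde (SymFun.h₂ + A.toCyclicSMod.Ch) =
      C (2⁻¹ : k) * (SymFun.p 1 ^ 2 - SymFun.p 2) - v := by
    rw [hvdef, CyclicSMod.Ch_cogen hfin, ← SymFun.omegaTilde_h₂, sub_neg_eq_add]
    exact map_add _ _ _
  have hC2 : (C (2⁻¹ : k) : SymFun k) * 2 = 1 := by
    rw [← map_ofNat (C (σ := ℕ+) (R := k)) 2, ← map_mul, inv_mul_cancel₀ two_ne_zero, map_one]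
  have h2 : (2⁻¹ : k) ≠ 0 := inv_ne_zero two_ne_zero
  -- T starts in weight 3, so the terms of rank at most 2 are those of h₂, with coefficient ½ at
  -- p₁².
  have hstar : SymFun.IsStar (SymFun.h₂ + T) := by
    refine SymFun.isStar_of_coeff (fun n hn => ?_) ?_
    · rw [map_add, SymFun.coeff_h₂, hT0 n (by omega), if_neg (by omega), add_zero]
    · rw [map_add, SymFun.coeff_h₂, hT0 2 le_rfl, if_pos rfl, add_zero]
      exact h2
  have hdp : (SymFun.omegaTilde (SymFun.h₂ + A.toCyclicSMod.Ch)).dp₁ = SymFun.p 1 - v.dp₁ := by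
    have hC : pderiv k (1 : ℕ+) (C (2⁻¹ : k)) = 0 := pderiv_C
    rw [hf, SymFun.dp₁, SymFun.dp₁, map_sub, Derivation.leibniz, hC, map_sub, pderiv_pow,
      SymFun.p, SymFun.p, pderiv_X_self, pderiv_X_of_ne (by decide)]
    simp only [smul_eq_mul, mul_one, sub_zero, Nat.cast_ofNat]
    rw [← mul_assoc, hC2, one_mul, mul_zero, add_zero, pow_one]
  have hc : constantCoeff (SymFun.p 1 - v.dp₁) = 0 := by
    rw [← SymFun.ev_zero, ev_p_one_sub_dp₁, hv _ (by simp)]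
    simp
  refine ⟨hW.tree, ?_, hstar, (SymFun.legendre_eq ?_ ?_ hstar ?_).symm⟩
  · have hω : ∀ n, coeff (single 1 n) (SymFun.omegaTilde (SymFun.h₂ + A.toCyclicSMod.Ch)) =
        (-1) ^ n * coeff (single 1 n) (SymFun.h₂ + A.toCyclicSMod.Ch) := fun n => by
      rw [SymFun.omegaTilde, coeff_rescale]
      simp
    have hA0 : ∀ n ≤ 2, coeff (single 1 n) A.toCyclicSMod.Ch = 0 := fun n hn =>
      CyclicSMod.coeff_Ch_eq_zero hfin hA _ (hd n hn)
    refine SymFun.isStar_of_coeff (fun n hn => ?_) ?_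
    · rw [hω, map_add, SymFun.coeff_h₂, hA0 n (by omega), if_neg (by omega), add_zero, mul_zero]
    · rw [hω, map_add, SymFun.coeff_h₂, hA0 2 le_rfl, if_pos rfl, add_zero]
      simp
  · rw [hdp, hc]
  · rw [hdp, ev_p_one_sub_dp₁, hv _ (by simp [expWt_add])]
    simp
  · have h := CyclicSMod.plethysm_Ch_tree hW hW2
    rw [← hvdef, ← hT] at h
    rw [SymFun.LegendreEq, hdp, SymFun.plethysm_add hc, SymFun.plethysm_h₂ hc, h, hf,
      SymFun.adams_p_one_sub]
    -- The terms ½ψ₂v' and ½v'² cancel between h₂ ∘ (p₁ - v') and T ∘ (p₁ - v'); what remains only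
    -- uses 2⁻¹ · 2 = 1.
    linear_combination (SymFun.p 1 ^ 2 - SymFun.p 1 * v.dp₁) * hC2
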